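/- Let $(M^n,g)$ be a smooth Riemannian manifold (Hausdorff, second countable, without boundary; not necessarily complete) of dimension $n\ge 3$ that is a gradient Ricci soliton with potential function $f$, i.e. $f:M\to\mathbb{R}$ is smooth and $\operatorname{Ric}+\nabla^2 f=\lambda g$ for some constant $\lambda\in\mathbb{R}$. Conventions: in local coordinates $R^l_{ijk}\partial_l=\nabla_{\partial_j}\nabla_{\partial_i}\partial_k-\nabla_{\partial_i}\nabla_{\partial_j}\partial_k$, $R_{ijkl}=g_{lm}R^m_{ijk}$, $R_{ik}=g^{jl}R_{ijkl}$, $R=g^{ik}R_{ik}$; the Weyl and Cotton tensors are $$W_{ijkl}=R_{ijkl}-\tfrac{1}{n-2}\big(R_{ik}g_{jl}-R_{il}g_{jk}+R_{jl}g_{ik}-R_{jk}g_{il}\big)+\tfrac{R}{(n-1)(n-2)}\big(g_{ik}g_{jl}-g_{il}g_{jk}\big),$$ $$C_{ijk}=R_{ij,k}-R_{ik,j}-\tfrac{1}{2(n-1)}\big(R_k\,g_{ij}-R_j\,g_{ik}\big).$$ Here $R_k$, $f_k$ are the components of $dR$, $df$; indices after a comma denote covariant derivatives, taken in the order in which they are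 written (so $C_{kti,it}=\nabla_t\nabla_i C_{kti}$ and $W_{lkti,lit}=\nabla_t\nabla_i\nabla_l W_{lkti}$), and repeated indices are contracted with $g$. Let $\psi:\mathbb{R}\to\mathbb{R}$ be a $C^2$ function such that $\psi(f)=\psi\circ f$ has compact support in $M$. Then the functions $|C|^2\psi(f)$ and $C_{kti,it}f_k\psi(f)$ are integrable and $$\frac12\int_M |C|^2\,\psi(f)\,dV_g=-\int_M C_{kti,it}\,f_k\,\psi(f)\,dV_g .$$ If moreover $n\ge 4$, then $W_{lkti,lit}f_k\psi(f)$ is integrable and $$\frac12\int_M |C|^2\,\psi(f)\,dV_g=\frac{n-2}{n-3}\int_M W_{lkti,lit}\,f_k\,\psi(f)\,dV_g .$$ -/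

import Mathlib

open MeasureTheory
open scoped Manifold ContDiff

noncomputable section

namespace RicciSoliton

/-! ### Tensor calculus in a coordinate domain of `ℝⁿ` -/

/-- The model space `ℝⁿ`. -/
abbrev Coord (n : ℕ) : Type := EuclideanSpace ℝ (Fin n)

/-- The components `T_{a₀ ⋯ a_{r-1}}` of a covariant `r`-tensor field as functions of the
coordinates. -/
abbrev LocalTensor (n r : ℕ) : Type := Coord n → (Fin r → Fin n) → ℝ

variable {n : ℕ}

/-- The partial derivative `∂ᵢ u`. -/
def pderiv (i : Fin n) (u : Coord n → ℝ) (y : Coord n) : ℝ :=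
  fderiv ℝ u y (EuclideanSpace.single i 1)

/-- The Christoffel symbols
`Γᵏᵢⱼ = ½ gᵏˡ (∂ᵢ gⱼₗ + ∂ⱼ gᵢₗ - ∂ₗ gᵢⱼ)` of the metric with components `G`. -/
def christoffel (G : Coord n → Matrix (Fin n) (Fin n) ℝ) (y : Coord n) (k i j : Fin n) : ℝ :=
  (1 / 2) * ∑ l, (G y)⁻¹ k l *
    (pderiv i (fun z => G z j l) y + pderiv j (fun z => G z i l) y - pderiv l (fun z => G z i j) y)

/-- The covariant derivative of a covariant tensor field. The index of differentiation is
appended as the last one: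
`T_{a₀ ⋯ a_{r-1}, b} = ∂_b T_{a₀ ⋯ a_{r-1}} - ∑ₛ Γᵐ_{b aₛ} T_{a₀ ⋯ m ⋯ a_{r-1}}`. -/
def covDeriv {r : ℕ} (G : Coord n → Matrix (Fin n) (Fin n) ℝ) (T : LocalTensor n r) :
    LocalTensor n (r + 1) := fun y a =>
  let a' : Fin r → Fin n := fun s => a s.castSucc
  let b : Fin n := a (Fin.last r)
  pderiv b (fun z => T z a') y
    - ∑ s : Fin r, ∑ m : Fin n, christoffel G y m b (a' s) * T y (Function.update a' s m)

/-- The Hessian `f_{ij} = ∇ᵢ∇ⱼ f = ∂ᵢ∂ⱼ u - Γᵏᵢⱼ ∂ₖ u` of the function with coordinate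
expression `u`. -/
def hessian (G : Coord n → Matrix (Fin n) (Fin n) ℝ) (u : Coord n → ℝ) (y : Coord n)
    (i j : Fin n) : ℝ :=
  pderiv i (pderiv j u) y - ∑ k, christoffel G y k i j * pderiv k u y

/-- The components `Rˡᵢⱼₖ`, where `Rˡᵢⱼₖ ∂ₗ = Riem(∂ᵢ, ∂ⱼ) ∂ₖ = ∇ⱼ ∇ᵢ ∂ₖ - ∇ᵢ ∇ⱼ ∂ₖ`. -/
def riemannUp (G : Coord n → Matrix (Fin n) (Fin n) ℝ) (y : Coord n) (l i j k : Fin n) : ℝ :=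
  pderiv j (fun z => christoffel G z l i k) y - pderiv i (fun z => christoffel G z l j k) y
    + ∑ m, (christoffel G y m i k * christoffel G y l j m
        - christoffel G y m j k * christoffel G y l i m)

/-- The Riemann tensor `R_{ijkl} = g_{lm} Rᵐᵢⱼₖ`. -/
def riemann (G : Coord n → Matrix (Fin n) (Fin n) ℝ) : LocalTensor n 4 := fun y a =>
  ∑ m, G y (a 3) m * riemannUp G y m (a 0) (a 1) (a 2)

/-- The Ricci tensor `R_{ik} = gʲˡ R_{ijkl}`. -/
def ricci (G : Coord n → Matrix (Fin n) (Fin n) ℝ) : LocalTensor n 2 := fun y a =>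
  ∑ j, ∑ l, (G y)⁻¹ j l * riemann G y ![a 0, j, a 1, l]

/-- The scalar curvature `R = gⁱᵏ R_{ik}`. -/
def scalarCurvature (G : Coord n → Matrix (Fin n) (Fin n) ℝ) (y : Coord n) : ℝ :=
  ∑ i, ∑ k, (G y)⁻¹ i k * ricci G y ![i, k]

/-- The Weyl tensor
`W_{ijkl} = R_{ijkl} - (R_{ik} g_{jl} - R_{il} g_{jk} + R_{jl} g_{ik} - R_{jk} g_{il}) / (n-2)
  + R (g_{ik} g_{jl} - g_{il} g_{jk}) / ((n-1)(n-2))`. -/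
def weyl (G : Coord n → Matrix (Fin n) (Fin n) ℝ) : LocalTensor n 4 := fun y a =>
  let i := a 0
  let j := a 1
  let k := a 2
  let l := a 3
  riemann G y ![i, j, k, l]
    - 1 / ((n : ℝ) - 2) * (ricci G y ![i, k] * G y j l - ricci G y ![i, l] * G y j k
        + ricci G y ![j, l] * G y i k - ricci G y ![j, k] * G y i l)
    + scalarCurvature G y / (((n : ℝ) - 1) * ((n : ℝ) - 2))
        * (G y i k * G y j l - G y i l * G y j k)

/-- The Cotton tensor
`C_{ijk} = R_{ij,k} - R_{ik,j} - (R_k g_{ij} - R_j g_{ik}) / (2(n-1))`. -/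
def cotton (G : Coord n → Matrix (Fin n) (Fin n) ℝ) : LocalTensor n 3 := fun y a =>
  let i := a 0
  let j := a 1
  let k := a 2
  covDeriv G (ricci G) y ![i, j, k] - covDeriv G (ricci G) y ![i, k, j]
    - 1 / (2 * ((n : ℝ) - 1)) * (pderiv k (scalarCurvature G) y * G y i j
        - pderiv j (scalarCurvature G) y * G y i k)

/-- The squared norm `|T|² = g^{a₀ b₀} ⋯ g^{a_{r-1} b_{r-1}} T_{a₀ ⋯ a_{r-1}} T_{b₀ ⋯ b_{r-1}}`. -/
def tensorNormSq {r : ℕ} (G : Coord n → Matrix (Fin n) (Fin n) ℝ) (T : LocalTensor n r)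
    (y : Coord n) : ℝ :=
  ∑ a : Fin r → Fin n, ∑ b : Fin r → Fin n, (∏ s, (G y)⁻¹ (a s) (b s)) * T y a * T y b

/-- `C_{kti,it} f_k`, that is `g^{kk'} g^{tt'} g^{ii'} (∇_{t'} ∇_{i'} C_{kti}) f_{k'}`. -/
def cottonTerm (G : Coord n → Matrix (Fin n) (Fin n) ℝ) (u : Coord n → ℝ) (y : Coord n) : ℝ :=
  ∑ k, ∑ k', ∑ t, ∑ t', ∑ i, ∑ i', (G y)⁻¹ k k' * (G y)⁻¹ t t' * (G y)⁻¹ i i'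
    * covDeriv G (covDeriv G (cotton G)) y ![k, t, i, i', t'] * pderiv k' u y

/-- `W_{lkti,lit} f_k`, that is
`g^{ll'} g^{kk'} g^{tt'} g^{ii'} (∇_{t'} ∇_{i'} ∇_{l'} W_{lkti}) f_{k'}`. -/
def weylTerm (G : Coord n → Matrix (Fin n) (Fin n) ℝ) (u : Coord n → ℝ) (y : Coord n) : ℝ :=
  ∑ l, ∑ l', ∑ k, ∑ k', ∑ t, ∑ t', ∑ i, ∑ i',
    (G y)⁻¹ l l' * (G y)⁻¹ k k' * (G y)⁻¹ t t' * (G y)⁻¹ i i'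
    * covDeriv G (covDeriv G (covDeriv G (weyl G))) y ![l, k, t, i, l', i', t'] * pderiv k' u y

/-! ### Riemannian manifolds -/

variable {M : Type*} [TopologicalSpace M] [ChartedSpace (EuclideanSpace ℝ (Fin n)) M]

/-- A smooth Riemannian metric on the `n`-dimensional smooth manifold `M`. -/
abbrev Metric (n : ℕ) (M : Type*) [TopologicalSpace M]
    [ChartedSpace (EuclideanSpace ℝ (Fin n)) M] [IsManifold (𝓡 n) ∞ M] : Type _ :=
  Bundle.ContMDiffRiemannianMetric (𝓡 n) ∞ (EuclideanSpace ℝ (Fin n))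
    (fun x : M => TangentSpace (𝓡 n) x)

/-- The coordinate vector field `∂ᵢ` of the chart `e`, at the point with coordinates `y`. -/
def coordVector (e : OpenPartialHomeomorph M (EuclideanSpace ℝ (Fin n))) (y : Coord n)
    (i : Fin n) : TangentSpace (𝓡 n) (e.symm y) :=
  mfderiv 𝓘(ℝ, EuclideanSpace ℝ (Fin n)) (𝓡 n) e.symm y
    (EuclideanSpace.single i (1 : ℝ) : EuclideanSpace ℝ (Fin n))

variable [IsManifold (𝓡 n) ∞ M]

/-- The components `g_{ij} = g(∂ᵢ, ∂ⱼ)` of the metric in the chart `e`, as functions of the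
coordinates. -/
def metricIn (g : Metric n M) (e : OpenPartialHomeomorph M (EuclideanSpace ℝ (Fin n)))
    (y : Coord n) : Matrix (Fin n) (Fin n) ℝ :=
  Matrix.of fun i j => g.inner (e.symm y) (coordVector e y i) (coordVector e y j)

/-- `(M, g)` is a gradient Ricci soliton with potential function `f`: the function `f` is smooth
and, for some constant `c`, the tensor equation `Ric + ∇²f = c g` holds, i.e. in every local
coordinate system `R_{ij} + f_{ij} = c g_{ij}`. -/
def IsGradientRicciSoliton (g : Metric n M) (f : M → ℝ) : Prop :=
  ContMDiff (𝓡 n) 𝓘(ℝ, ℝ) ∞ f ∧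
    ∃ c : ℝ, ∀ e ∈ IsManifold.maximalAtlas (𝓡 n) ∞ M, ∀ y ∈ e.target, ∀ i j : Fin n,
      ricci (metricIn g e) y ![i, j] + hessian (metricIn g e) (fun z => f (e.symm z)) y i j
        = c * metricIn g e y i j

/-- The function `|C|²` on `M`, computed at each point in a chart around it. -/
def cottonNormSq (g : Metric n M) (p : M) : ℝ :=
  let e := chartAt (EuclideanSpace ℝ (Fin n)) p
  tensorNormSq (metricIn g e) (cotton (metricIn g e)) (e p)

/-- The function `C_{kti,it} f_k` on `M`, computed at each point in a chart around it. -/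
def divDivCottonGrad (g : Metric n M) (f : M → ℝ) (p : M) : ℝ :=
  let e := chartAt (EuclideanSpace ℝ (Fin n)) p
  cottonTerm (metricIn g e) (fun z => f (e.symm z)) (e p)

/-- The function `W_{lkti,lit} f_k` on `M`, computed at each point in a chart around it. -/
def divDivDivWeylGrad (g : Metric n M) (f : M → ℝ) (p : M) : ℝ :=
  let e := chartAt (EuclideanSpace ℝ (Fin n)) p
  weylTerm (metricIn g e) (fun z => f (e.symm z)) (e p)

/-- The measure `√(det g_{ij}) dy` of the domain of the chart `e`, as a measure on `M`. -/
def chartVolume [MeasurableSpace M] (g : Metric n M)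
    (e : OpenPartialHomeomorph M (EuclideanSpace ℝ (Fin n))) : Measure M :=
  (((volume : Measure (EuclideanSpace ℝ (Fin n))).restrict e.target).withDensity
    fun y => ENNReal.ofReal (Real.sqrt (metricIn g e y).det)).map e.symm

/-- The Riemannian volume measure `dV_g`. The measures `√(det g_{ij}) dy` of the charts agree on
overlaps; `dV_g` is the least measure that dominates all of them, so it restricts to each of them
on the domain of the chart. -/
def riemannianVolume [MeasurableSpace M] (g : Metric n M) : Measure M :=
  ⨆ p : M, chartVolume g (chartAt (EuclideanSpace ℝ (Fin n)) p)

end RicciSoliton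

end

/-!
The identity is an integration by parts. For an arbitrary function `w` of class `C²` consider the
one-form `Z_t = w C_{kti,i} f_k - C_{kit} (w f_{ki} + f_k w_i)`, called `flux`. Its divergence is
`w (C_{kti,it} f_k + ½ |C|²)` (`divergence_flux_eq`). Indeed, the terms with one derivative on `C`
cancel after renaming indices, and of those with none the sum of `C_{kit} (f_{ki} w_t + f_{kt} w_i)`
and `C_{kit} f_k w_{it}` vanishes, as `C` is antisymmetric in its last two indices. The soliton
equation turns the remaining `-C_{kit} f_{ki,t}` into `C_{kit} R_{ki,t}`. By antisymmetry the latter only sees the antisymmetric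
part of `∇ Ric`, which is `C` up to multiples of the metric, and as `C` is trace free it equals
`½ |C|²`. The trace of `C` vanishes by the contracted second Bianchi identity.

No property of `w` other than its regularity is used, so the weight `w = ψ(f)` may be replaced by
`ρ ψ(f)` with a cut-off function `ρ` supported in one chart. There the divergence theorem is the
vanishing of the integral of a partial derivative of a compactly supported function
(`integral_chart_eq_zero`), and a partition of unity gives `∫ (C_{kti,it} f_k + ½ |C|²) ψ(f) = 0`
(`integral_divDivCottonGrad_add_eq_zero`). For `n ≥ 4` the divergence of the Weyl tensor is
`-(n-3)/(n-2)` times the Cotton tensor, so the second formula is a multiple of the first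
(`weylTerm_eq`).

Tensor identities are verified at the centre of coordinates in which the metric is Euclidean to
first order. There covariant derivatives are partial derivatives, contractions are plain sums, and
the first derivatives of the curvature are linear in the third derivatives of the metric, so that
the Bianchi identities become symmetries of the latter. Such coordinates are given by a quadratic
map (`IsMetricOn.exists_normal`), and identities are transported by the naturality of all operations
under a change of coordinates: `Pulls` expresses that one tensor field is the pull-back of another,
and the essential case is the covariant derivative (`Pulls.covDeriv`). The same naturality shows
that the integrands, defined in a preferred chart at each point, can be computed in any chart, and
hence are continuous. The Riemannian volume is the supremum of the measures `√(det g_{ij}) dy` of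
the charts; by the change of variables formula it restricts to each of them on its chart
(`riemannianVolume_restrict`).
-/

noncomputable section

namespace RicciSoliton

variable {n : ℕ}

/-! ### Tensors at a point: pull-back and contraction -/

section

variable {ι κ μ : Type*} [Fintype ι] [Fintype κ] [Fintype μ]
  [DecidableEq ι] [DecidableEq κ] [DecidableEq μ]

/-- The pullback of the components of a covariant tensor at one point under a linear map with
matrix `J`. The slots are indexed by a finite type. -/
def pullM (J : Matrix (Fin n) (Fin n) ℝ) (t : (ι → Fin n) → ℝ) (a : ι → Fin n) : ℝ :=
  ∑ b : ι → Fin n, (∏ s, J (b s) (a s)) * t b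

lemma pullM_add (J : Matrix (Fin n) (Fin n) ℝ) (t u : (ι → Fin n) → ℝ) :
    pullM J (fun a => t a + u a) = fun a => pullM J t a + pullM J u a := by
  funext a; simp [pullM, mul_add, Finset.sum_add_distrib]

lemma pullM_sub (J : Matrix (Fin n) (Fin n) ℝ) (t u : (ι → Fin n) → ℝ) :
    pullM J (fun a => t a - u a) = fun a => pullM J t a - pullM J u a := by
  funext a; simp [pullM, mul_sub, Finset.sum_sub_distrib]

lemma pullM_smul (J : Matrix (Fin n) (Fin n) ℝ) (c : ℝ) (t : (ι → Fin n) → ℝ) :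
    pullM J (fun a => c * t a) = fun a => c * pullM J t a := by
  funext a; simp only [pullM, Finset.mul_sum]
  exact Finset.sum_congr rfl fun _ _ => by ring

lemma pullM_one (t : (ι → Fin n) → ℝ) : pullM 1 t = t := by
  funext a
  unfold pullM
  rw [Finset.sum_eq_single a]
  · simp
  · intro b _ hb
    obtain ⟨s, hs⟩ := Function.ne_iff.mp hb
    rw [Finset.prod_eq_zero (Finset.mem_univ s) (by simp [hs]), zero_mul]
  · simp

lemma pullM_pullM (J K : Matrix (Fin n) (Fin n) ℝ) (t : (ι → Fin n) → ℝ) :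
    pullM K (pullM J t) = pullM (J * K) t := by
  funext a
  unfold pullM
  simp_rw [Finset.mul_sum]
  rw [Finset.sum_comm]
  refine Finset.sum_congr rfl fun c _ => ?_
  simp_rw [Matrix.mul_apply, Finset.prod_univ_sum, ← mul_assoc, ← Finset.prod_mul_distrib,
    ← Finset.sum_mul]
  congr 1
  simp only [Fintype.piFinset_univ]
  exact Finset.sum_congr rfl fun b _ => Finset.prod_congr rfl fun s _ => mul_comm _ _

/-- Pulling back commutes with reindexing of the slots along a bijection. -/
lemma pullM_reindex (J : Matrix (Fin n) (Fin n) ℝ) (t : (ι → Fin n) → ℝ) (p : ι → κ)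
    (hp : Function.Bijective p) :
    pullM J (fun a : κ → Fin n => t (a ∘ p)) = fun a => pullM J t (a ∘ p) := by
  funext a
  unfold pullM
  let e : ι ≃ κ := Equiv.ofBijective p hp
  rw [← (e.arrowCongr (Equiv.refl (Fin n))).sum_comp]
  refine Finset.sum_congr rfl fun b _ => ?_
  have h : (fun s => b (e.symm (p s))) = b := by
    funext s
    change b (e.symm (e s)) = b s
    rw [e.symm_apply_apply]
  change (∏ s, J (b (e.symm s)) (a s)) * t (fun s => b (e.symm (p s))) = _
  rw [h, ← e.prod_comp]
  congr 1
  refine Finset.prod_congr rfl fun s _ => ?_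
  rw [e.symm_apply_apply]; rfl

lemma sum_sumElim (F : (ι ⊕ κ → Fin n) → ℝ) :
    ∑ b, F b = ∑ b : ι → Fin n, ∑ c : κ → Fin n, F (Sum.elim b c) := by
  rw [← (Equiv.sumArrowEquivProdArrow ι κ (Fin n)).symm.sum_comp, Fintype.sum_prod_type]
  rfl

lemma pullM_mul_sum (J : Matrix (Fin n) (Fin n) ℝ) (t : (ι → Fin n) → ℝ) (u : (κ → Fin n) → ℝ) :
    pullM J (fun a : ι ⊕ κ → Fin n => t (a ∘ Sum.inl) * u (a ∘ Sum.inr))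
      = fun a => pullM J t (a ∘ Sum.inl) * pullM J u (a ∘ Sum.inr) := by
  funext a
  unfold pullM
  rw [sum_sumElim, Finset.sum_mul_sum]
  refine Finset.sum_congr rfl fun b _ => Finset.sum_congr rfl fun c _ => ?_
  simp only [Fintype.prod_sum_type, Sum.elim_inl, Sum.elim_inr, Function.comp_apply,
    Sum.elim_comp_inl, Sum.elim_comp_inr]
  ring

/-- Pulling back commutes with tensor products. The slots of the two factors are distributed
over the slots of the product by `p` and `q`. -/
lemma pullM_mul (J : Matrix (Fin n) (Fin n) ℝ) (t : (ι → Fin n) → ℝ) (u : (κ → Fin n) → ℝ)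
    (p : ι → μ) (q : κ → μ) (hpq : Function.Bijective (Sum.elim p q)) :
    pullM J (fun a : μ → Fin n => t (a ∘ p) * u (a ∘ q))
      = fun a => pullM J t (a ∘ p) * pullM J u (a ∘ q) := by
  have h := pullM_reindex J
    (fun a : ι ⊕ κ → Fin n => t (a ∘ Sum.inl) * u (a ∘ Sum.inr)) (Sum.elim p q) hpq
  rw [pullM_mul_sum] at h
  exact h

/-- The contraction of two slots of a covariant tensor with the bilinear form `g`; `p` tells which
slots of `t` are kept and which two are contracted. -/
def contract (p : ι → κ ⊕ Fin 2) (g : Matrix (Fin n) (Fin n) ℝ) (t : (ι → Fin n) → ℝ)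
    (a : κ → Fin n) : ℝ :=
  ∑ l, ∑ m, g l m * t (Sum.elim a ![l, m] ∘ p)

lemma sum_fin_two_fun (F : (Fin 2 → Fin n) → ℝ) : ∑ b, F b = ∑ l, ∑ m, F ![l, m] := by
  rw [← (finTwoArrowEquiv (Fin n)).symm.sum_comp, Fintype.sum_prod_type]
  rfl

lemma sum_rotate {α β γ : Type*} [Fintype α] [Fintype β] [Fintype γ] (F : α → β → γ → ℝ) :
    ∑ a, ∑ b, ∑ c, F a b c = ∑ c, ∑ a, ∑ b, F a b c := by
  exact (Finset.sum_congr rfl fun _ _ => Finset.sum_comm).trans Finset.sum_comm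

lemma sum_rotate' {α β γ : Type*} [Fintype α] [Fintype β] [Fintype γ] (F : α → β → γ → ℝ) :
    ∑ a, ∑ b, ∑ c, F a b c = ∑ b, ∑ c, ∑ a, F a b c :=
  (sum_rotate fun b c a => F a b c).symm

/-- Pulling back commutes with contraction, provided that the bilinear forms used for the
contraction correspond under the dual map. -/
lemma pullM_contract (J g g' : Matrix (Fin n) (Fin n) ℝ) (hg : J * g' * J.transpose = g)
    (p : ι → κ ⊕ Fin 2) (hp : Function.Bijective p) (t : (ι → Fin n) → ℝ) :
    contract p g' (pullM J t) = pullM J (contract p g t) := by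
  funext a
  have h1 : ∀ l m, pullM J t (Sum.elim a ![l, m] ∘ p)
      = ∑ c : κ → Fin n, ∑ l', ∑ m', (∏ s, J (c s) (a s)) * (J l' l * J m' m)
          * t (Sum.elim c ![l', m'] ∘ p) := by
    intro l m
    have := congrFun (pullM_reindex J t p hp) (Sum.elim a ![l, m])
    rw [← this]
    unfold pullM
    rw [sum_sumElim]
    refine Finset.sum_congr rfl fun c _ => ?_
    rw [sum_fin_two_fun]
    refine Finset.sum_congr rfl fun l' _ => Finset.sum_congr rfl fun m' _ => ?_
    simp [Fintype.prod_sum_type]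
  have h2 : ∀ l' m', ∑ l, ∑ m, g' l m * (J l' l * J m' m) = g l' m' := by
    intro l' m'
    rw [← hg]
    simp only [Matrix.mul_apply, Matrix.transpose_apply, Finset.sum_mul]
    rw [Finset.sum_comm]
    exact Finset.sum_congr rfl fun _ _ => Finset.sum_congr rfl fun _ _ => by ring
  have h3 : contract p g' (pullM J t) a = ∑ l, ∑ m, ∑ c : κ → Fin n, ∑ l', ∑ m',
      (∏ s, J (c s) (a s)) * (g' l m * (J l' l * J m' m)) * t (Sum.elim c ![l', m'] ∘ p) := by
    unfold contract
    refine Finset.sum_congr rfl fun l _ => Finset.sum_congr rfl fun m _ => ?_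
    rw [h1]
    simp only [Finset.mul_sum]
    refine Finset.sum_congr rfl fun c _ => Finset.sum_congr rfl fun l' _ =>
      Finset.sum_congr rfl fun m' _ => by ring
  rw [h3]
  rw [sum_rotate]
  unfold pullM contract
  refine Finset.sum_congr rfl fun c _ => ?_
  simp_rw [Finset.mul_sum]
  rw [sum_rotate]
  refine Finset.sum_congr rfl fun l' _ => ?_
  rw [sum_rotate]
  refine Finset.sum_congr rfl fun m' _ => ?_
  rw [← h2]
  simp only [Finset.mul_sum, Finset.sum_mul]
  refine Finset.sum_congr rfl fun l _ => Finset.sum_congr rfl fun m _ => by ring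

end

/-! ### Partial derivatives -/

section

lemma pderiv_congr {i : Fin n} {u v : Coord n → ℝ} {x : Coord n} (h : u =ᶠ[nhds x] v) :
    pderiv i u x = pderiv i v x := by
  unfold pderiv; rw [h.fderiv_eq]

lemma pderiv_congr_on {i : Fin n} {u v : Coord n → ℝ} {U : Set (Coord n)} (hU : IsOpen U)
    (h : ∀ x ∈ U, u x = v x) {x : Coord n} (hx : x ∈ U) : pderiv i u x = pderiv i v x :=
  pderiv_congr (Filter.eventuallyEq_of_mem (hU.mem_nhds hx) h)

@[simp] lemma pderiv_const (i : Fin n) (c : ℝ) (x : Coord n) : pderiv i (fun _ => c) x = 0 := by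
  simp [pderiv]

section Rules
variable {i : Fin n} {u v : Coord n → ℝ} {x : Coord n}

lemma pderiv_add (hu : DifferentiableAt ℝ u x) (hv : DifferentiableAt ℝ v x) :
    pderiv i (fun y => u y + v y) x = pderiv i u x + pderiv i v x := by
  unfold pderiv; rw [fderiv_fun_add hu hv]; rfl

lemma pderiv_sub (hu : DifferentiableAt ℝ u x) (hv : DifferentiableAt ℝ v x) :
    pderiv i (fun y => u y - v y) x = pderiv i u x - pderiv i v x := by
  unfold pderiv; rw [fderiv_fun_sub hu hv]; rfl

lemma pderiv_mul (hu : DifferentiableAt ℝ u x) (hv : DifferentiableAt ℝ v x) :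
    pderiv i (fun y => u y * v y) x = pderiv i u x * v x + u x * pderiv i v x := by
  unfold pderiv; rw [fderiv_fun_mul hu hv]; simp; ring

lemma pderiv_const_mul (c : ℝ) (hv : DifferentiableAt ℝ v x) :
    pderiv i (fun y => c * v y) x = c * pderiv i v x := by
  rw [pderiv_mul (differentiableAt_const c) hv]; simp

lemma pderiv_sum {ι : Type*} {s : Finset ι} {w : ι → Coord n → ℝ}
    (hw : ∀ j ∈ s, DifferentiableAt ℝ (w j) x) :
    pderiv i (fun y => ∑ j ∈ s, w j y) x = ∑ j ∈ s, pderiv i (w j) x := by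
  unfold pderiv; rw [fderiv_fun_sum hw]; simp

lemma pderiv_prod {ι : Type*} [DecidableEq ι] {s : Finset ι} {w : ι → Coord n → ℝ}
    (hw : ∀ j ∈ s, DifferentiableAt ℝ (w j) x) :
    pderiv i (fun y => ∏ j ∈ s, w j y) x
      = ∑ j ∈ s, pderiv i (w j) x * ∏ k ∈ s.erase j, w k x := by
  unfold pderiv; rw [fderiv_finsetProd hw]; simp [mul_comm]

end Rules

lemma fderiv_apply_eq_sum (u : Coord n → ℝ) (x v : Coord n) :
    fderiv ℝ u x v = ∑ a, v a * pderiv a u x := by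
  conv_lhs => rw [← (EuclideanSpace.basisFun (Fin n) ℝ).sum_repr v]
  simp [pderiv]

/-- The Jacobian matrix `∂ᵢ φᵃ` of a map between coordinate domains. -/
def jac (φ : Coord n → Coord n) (x : Coord n) : Matrix (Fin n) (Fin n) ℝ :=
  Matrix.of fun a i => pderiv i (fun z => φ z a) x

lemma jac_apply (φ : Coord n → Coord n) (x : Coord n) (a i : Fin n) :
    jac φ x a i = pderiv i (fun z => φ z a) x := rfl

lemma fderiv_coord {φ : Coord n → Coord n} {x : Coord n} (hφ : DifferentiableAt ℝ φ x)
    (v : Coord n) (a : Fin n) : fderiv ℝ (fun z => φ z a) x v = fderiv ℝ φ x v a := by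
  have h := (((EuclideanSpace.proj a : EuclideanSpace ℝ (Fin n) →L[ℝ] ℝ).hasFDerivAt).comp x
    hφ.hasFDerivAt).fderiv
  have h2 : ((EuclideanSpace.proj a : EuclideanSpace ℝ (Fin n) →L[ℝ] ℝ) ∘ φ)
    = fun z => φ z a := rfl
  rw [h2] at h
  rw [h]; rfl

lemma jac_eq_fderiv {φ : Coord n → Coord n} {x : Coord n} (hφ : DifferentiableAt ℝ φ x)
    (a i : Fin n) : jac φ x a i = fderiv ℝ φ x (EuclideanSpace.single i 1) a :=
  fderiv_coord hφ _ a

lemma pderiv_comp {i : Fin n} {φ : Coord n → Coord n} {h : Coord n → ℝ} {x : Coord n}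
    (hφ : DifferentiableAt ℝ φ x) (hh : DifferentiableAt ℝ h (φ x)) :
    pderiv i (fun z => h (φ z)) x = ∑ a, jac φ x a i * pderiv a h (φ x) := by
  have h1 : fderiv ℝ (fun z => h (φ z)) x = (fderiv ℝ h (φ x)).comp (fderiv ℝ φ x) :=
    fderiv_comp x hh hφ
  unfold pderiv
  rw [h1, ContinuousLinearMap.comp_apply, fderiv_apply_eq_sum]
  exact Finset.sum_congr rfl fun a _ => by rw [jac_eq_fderiv hφ]; rfl

section Smooth
variable {U : Set (Coord n)}

lemma contDiffOn_pderiv (hU : IsOpen U) {u : Coord n → ℝ} {k m : WithTop ℕ∞}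
    (hu : ContDiffOn ℝ m u U) (hkm : k + 1 ≤ m) (i : Fin n) : ContDiffOn ℝ k (pderiv i u) U :=
  (hu.fderiv_of_isOpen hU hkm).clm_apply contDiffOn_const

lemma smooth_pderiv (hU : IsOpen U) {u : Coord n → ℝ} (hu : ContDiffOn ℝ ∞ u U) (i : Fin n) :
    ContDiffOn ℝ ∞ (pderiv i u) U := contDiffOn_pderiv hU hu (by simp) i

lemma diffAt_of_smooth (hU : IsOpen U) {u : Coord n → ℝ} (hu : ContDiffOn ℝ ∞ u U) {x : Coord n}
    (hx : x ∈ U) : DifferentiableAt ℝ u x :=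
  (hu.contDiffAt (hU.mem_nhds hx)).differentiableAt (by simp)

/-- Symmetry of second partial derivatives. -/
lemma pderiv_comm {u : Coord n → ℝ} {x : Coord n} (hu : ContDiffAt ℝ 2 u x) (i j : Fin n) :
    pderiv i (pderiv j u) x = pderiv j (pderiv i u) x := by
  have hs : IsSymmSndFDerivAt ℝ u x := hu.isSymmSndFDerivAt (by simp)
  have hd : DifferentiableAt ℝ (fderiv ℝ u) x :=
    (hu.fderiv_right (m := 1) (by norm_num)).differentiableAt (by simp)
  have key : ∀ a b : Fin n, pderiv a (pderiv b u) x
      = fderiv ℝ (fderiv ℝ u) x (EuclideanSpace.single a 1) (EuclideanSpace.single b 1) := by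
    intro a b
    unfold pderiv
    rw [fderiv_clm_apply hd (differentiableAt_const _)]
    simp
  rw [key, key, hs]

end Smooth

/-! ### Metrics on coordinate domains -/

/-- The matrix field `G` is a smooth Riemannian metric on the open set `V`. -/
structure IsMetricOn (V : Set (Coord n)) (G : Coord n → Matrix (Fin n) (Fin n) ℝ) : Prop where
  isOpen : IsOpen V
  smooth : ∀ i j, ContDiffOn ℝ ∞ (fun y => G y i j) V
  posDef : ∀ y ∈ V, (G y).PosDef

lemma contDiffOn_det {V : Set (Coord n)} {ι : Type*} [Fintype ι] [DecidableEq ι]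
    {A : Coord n → Matrix ι ι ℝ} {m : WithTop ℕ∞}
    (hA : ∀ i j, ContDiffOn ℝ m (fun y => A y i j) V) : ContDiffOn ℝ m (fun y => (A y).det) V := by
  simp only [Matrix.det_apply']
  refine ContDiffOn.sum fun σ _ => contDiffOn_const.mul ?_
  exact contDiffOn_prod fun i _ => hA _ _

namespace IsMetricOn
variable {V : Set (Coord n)} {G : Coord n → Matrix (Fin n) (Fin n) ℝ}

lemma symm (hG : IsMetricOn V G) {y : Coord n} (hy : y ∈ V) (i j : Fin n) : G y i j = G y j i := by
  have h := (hG.posDef y hy).isHermitian.apply i j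
  simpa using h.symm

lemma det_pos (hG : IsMetricOn V G) {y : Coord n} (hy : y ∈ V) : 0 < (G y).det :=
  (hG.posDef y hy).det_pos

lemma isUnit_det (hG : IsMetricOn V G) {y : Coord n} (hy : y ∈ V) : IsUnit (G y).det :=
  (hG.det_pos hy).ne'.isUnit

lemma smooth_inv (hG : IsMetricOn V G) (i j : Fin n) :
    ContDiffOn ℝ ∞ (fun y => (G y)⁻¹ i j) V := by
  have h : ∀ y, (G y)⁻¹ i j = ((G y).det)⁻¹ * ((G y).updateRow j (Pi.single i 1)).det := by
    intro y
    rw [Matrix.inv_def, Matrix.smul_apply, Matrix.adjugate_apply, Ring.inverse_eq_inv']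
    rfl
  -- Cramer's rule: the entries are rational functions of those of `G`
  simp only [h]
  refine ContDiffOn.mul ((contDiffOn_det hG.smooth).inv fun y hy => (hG.det_pos hy).ne') ?_
  refine contDiffOn_det fun k l => ?_
  by_cases hk : k = j
  · subst hk; simpa using contDiffOn_const
  · simpa [Matrix.updateRow_ne hk] using hG.smooth k l

lemma inv_symm (hG : IsMetricOn V G) {y : Coord n} (hy : y ∈ V) (i j : Fin n) :
    (G y)⁻¹ i j = (G y)⁻¹ j i := by
  have h : ((G y)⁻¹).IsHermitian := (hG.posDef y hy).isHermitian.inv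
  simpa using (h.apply i j).symm

lemma inv_mul_sum (hG : IsMetricOn V G) {y : Coord n} (hy : y ∈ V) (i j : Fin n) :
    ∑ k, (G y)⁻¹ i k * G y k j = if i = j then 1 else 0 := by
  rw [← Matrix.mul_apply, Matrix.nonsing_inv_mul _ (hG.isUnit_det hy), Matrix.one_apply]

lemma mul_inv_sum (hG : IsMetricOn V G) {y : Coord n} (hy : y ∈ V) (i j : Fin n) :
    ∑ k, G y i k * (G y)⁻¹ k j = if i = j then 1 else 0 := by
  rw [← Matrix.mul_apply, Matrix.mul_nonsing_inv _ (hG.isUnit_det hy), Matrix.one_apply]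

lemma smooth_christoffel (hG : IsMetricOn V G) (k i j : Fin n) :
    ContDiffOn ℝ ∞ (fun y => christoffel G y k i j) V := by
  unfold christoffel
  refine contDiffOn_const.mul (ContDiffOn.sum fun l _ => (hG.smooth_inv k l).mul ?_)
  exact ((smooth_pderiv hG.isOpen (hG.smooth j l) i).add
    (smooth_pderiv hG.isOpen (hG.smooth i l) j)).sub (smooth_pderiv hG.isOpen (hG.smooth i j) l)

end IsMetricOn

lemma christoffel_symm {V : Set (Coord n)} {G : Coord n → Matrix (Fin n) (Fin n) ℝ}
    (hG : IsMetricOn V G) {y : Coord n} (hy : y ∈ V) (k i j : Fin n) :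
    christoffel G y k i j = christoffel G y k j i := by
  unfold christoffel
  congr 1
  refine Finset.sum_congr rfl fun l _ => ?_
  rw [pderiv_congr_on hG.isOpen (fun x hx => hG.symm hx i j) hy]
  ring

/-- Lowering the upper index of the Christoffel symbols. -/
lemma metric_mul_christoffel {V : Set (Coord n)} {G : Coord n → Matrix (Fin n) (Fin n) ℝ}
    (hG : IsMetricOn V G) {y : Coord n} (hy : y ∈ V) (l i j : Fin n) :
    ∑ k, G y l k * christoffel G y k i j
      = (1 / 2) * (pderiv i (fun z => G z j l) y + pderiv j (fun z => G z i l) y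
          - pderiv l (fun z => G z i j) y) := by
  unfold christoffel
  have : ∀ (F : Fin n → ℝ), ∑ k, G y l k * (1 / 2 * ∑ m, (G y)⁻¹ k m * F m) = 1 / 2 * F l := by
    intro F
    calc _ = 1 / 2 * ∑ m, (∑ k, G y l k * (G y)⁻¹ k m) * F m := by
          simp only [Finset.mul_sum, Finset.sum_mul]
          rw [Finset.sum_comm]
          exact Finset.sum_congr rfl fun _ _ => Finset.sum_congr rfl fun _ _ => by ring
      _ = _ := by simp [hG.mul_inv_sum hy]
  exact this _

/-- The metric is parallel. -/
lemma pderiv_metric {V : Set (Coord n)} {G : Coord n → Matrix (Fin n) (Fin n) ℝ}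
    (hG : IsMetricOn V G) {y : Coord n} (hy : y ∈ V) (b i j : Fin n) :
    pderiv b (fun z => G z i j) y
      = ∑ m, christoffel G y m b i * G y m j + ∑ m, christoffel G y m b j * G y i m := by
  have h1 := metric_mul_christoffel hG hy j b i
  have h2 := metric_mul_christoffel hG hy i b j
  have e1 : ∑ m, christoffel G y m b i * G y m j = ∑ k, G y j k * christoffel G y k b i :=
    Finset.sum_congr rfl fun m _ => by rw [hG.symm hy m j, mul_comm]
  have e2 : ∑ m, christoffel G y m b j * G y i m = ∑ k, G y i k * christoffel G y k b j :=
    Finset.sum_congr rfl fun m _ => by rw [mul_comm]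
  rw [e1, e2, h1, h2, pderiv_congr_on (i := b) hG.isOpen (fun x hx => hG.symm hx j i) hy]
  ring

end

/-! ### Change of coordinates -/

section

/-- On `U`, the metric `G₁` is the pullback of the metric `G₂` on `V` under the smooth map `φ`.
Since `G₁` is nondegenerate, this forces `φ` to be a local diffeomorphism. -/
structure IsPullback (φ : Coord n → Coord n) (U V : Set (Coord n))
    (G₁ G₂ : Coord n → Matrix (Fin n) (Fin n) ℝ) : Prop where
  left : IsMetricOn U G₁
  right : IsMetricOn V G₂
  smooth : ContDiffOn ℝ ∞ φ U
  mapsTo : Set.MapsTo φ U V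
  eq : ∀ x ∈ U, G₁ x = (jac φ x).transpose * G₂ (φ x) * jac φ x

namespace IsPullback
variable {φ : Coord n → Coord n} {U V : Set (Coord n)}
  {G₁ G₂ : Coord n → Matrix (Fin n) (Fin n) ℝ}

lemma diffAt (h : IsPullback φ U V G₁ G₂) {x : Coord n} (hx : x ∈ U) : DifferentiableAt ℝ φ x :=
  (h.smooth.contDiffAt (h.left.isOpen.mem_nhds hx)).differentiableAt (by simp)

lemma smooth_coord (h : IsPullback φ U V G₁ G₂) (a : Fin n) :
    ContDiffOn ℝ ∞ (fun z => φ z a) U :=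
  (contDiffOn_euclidean.mp h.smooth) a

lemma smooth_jac (h : IsPullback φ U V G₁ G₂) (a i : Fin n) :
    ContDiffOn ℝ ∞ (fun z => jac φ z a i) U :=
  smooth_pderiv h.left.isOpen (h.smooth_coord a) i

lemma pderiv_jac (h : IsPullback φ U V G₁ G₂) {x : Coord n} (hx : x ∈ U) (a i j : Fin n) :
    pderiv i (fun z => jac φ z a j) x = pderiv j (fun z => jac φ z a i) x :=
  pderiv_comm (((h.smooth_coord a).contDiffAt (h.left.isOpen.mem_nhds hx)).of_le
    ENat.LEInfty.out) i j

lemma isUnit_det (h : IsPullback φ U V G₁ G₂) {x : Coord n} (hx : x ∈ U) :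
    IsUnit (jac φ x).det := by
  have h1 := h.left.isUnit_det hx
  rw [h.eq x hx, Matrix.det_mul] at h1
  exact (IsUnit.mul_iff.mp h1).2

/-- The inverse metric, as a contravariant tensor, is pushed forward. -/
lemma inv_eq (h : IsPullback φ U V G₁ G₂) {x : Coord n} (hx : x ∈ U) :
    jac φ x * (G₁ x)⁻¹ * (jac φ x).transpose = (G₂ (φ x))⁻¹ := by
  have hJ := h.isUnit_det hx
  have hJt : IsUnit (jac φ x).transpose.det := by rwa [Matrix.det_transpose]
  rw [h.eq x hx, Matrix.mul_inv_rev, Matrix.mul_inv_rev, ← Matrix.mul_assoc, ← Matrix.mul_assoc,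
    Matrix.mul_nonsing_inv _ hJ, Matrix.one_mul, Matrix.mul_assoc, Matrix.nonsing_inv_mul _ hJt,
    Matrix.mul_one]

lemma metric_apply (h : IsPullback φ U V G₁ G₂) {x : Coord n} (hx : x ∈ U) (i j : Fin n) :
    G₁ x i j = ∑ a, ∑ b, jac φ x a i * jac φ x b j * G₂ (φ x) a b := by
  rw [h.eq x hx]
  simp only [Matrix.mul_apply, Matrix.transpose_apply, Finset.sum_mul]
  rw [Finset.sum_comm]
  exact Finset.sum_congr rfl fun _ _ => Finset.sum_congr rfl fun _ _ => by ring

lemma diffAt_comp (h : IsPullback φ U V G₁ G₂) {u : Coord n → ℝ} {x : Coord n} (hx : x ∈ U)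
    (hu : DifferentiableAt ℝ u (φ x)) : DifferentiableAt ℝ (fun z => u (φ z)) x :=
  hu.comp x (h.diffAt hx)

lemma diffAt_jac (h : IsPullback φ U V G₁ G₂) {x : Coord n} (hx : x ∈ U) (a i : Fin n) :
    DifferentiableAt ℝ (fun z => jac φ z a i) x :=
  diffAt_of_smooth h.left.isOpen (h.smooth_jac a i) hx

lemma diffAt_metric (h : IsPullback φ U V G₁ G₂) {x : Coord n} (hx : x ∈ U) (a b : Fin n) :
    DifferentiableAt ℝ (fun y => G₂ y a b) (φ x) :=
  diffAt_of_smooth h.right.isOpen (h.right.smooth a b) (h.mapsTo hx)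

lemma pderiv_metric_left (h : IsPullback φ U V G₁ G₂) {x : Coord n} (hx : x ∈ U) (i j l : Fin n) :
    pderiv l (fun z => G₁ z i j) x
      = (∑ a, ∑ b, pderiv l (fun z => jac φ z a i) x * jac φ x b j * G₂ (φ x) a b)
        + (∑ a, ∑ b, pderiv l (fun z => jac φ z a j) x * jac φ x b i * G₂ (φ x) a b)
        + ∑ a, ∑ b, ∑ c, jac φ x a i * jac φ x b j * jac φ x c l
            * pderiv c (fun y => G₂ y a b) (φ x) := by
  rw [pderiv_congr_on h.left.isOpen (fun z hz => h.metric_apply hz i j) hx]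
  have hd : ∀ a b, DifferentiableAt ℝ (fun z => jac φ z a i * jac φ z b j) x := fun a b =>
    (h.diffAt_jac hx a i).mul (h.diffAt_jac hx b j)
  have hG : ∀ a b, DifferentiableAt ℝ (fun z => G₂ (φ z) a b) x := fun a b =>
    h.diffAt_comp hx (h.diffAt_metric hx a b)
  have e : ∀ a b, pderiv l (fun z => jac φ z a i * jac φ z b j * G₂ (φ z) a b) x
      = pderiv l (fun z => jac φ z a i) x * jac φ x b j * G₂ (φ x) a b
        + pderiv l (fun z => jac φ z b j) x * jac φ x a i * G₂ (φ x) a b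
        + ∑ c, jac φ x a i * jac φ x b j * jac φ x c l
            * pderiv c (fun y => G₂ y a b) (φ x) := by
    intro a b
    rw [pderiv_mul (hd a b) (hG a b), pderiv_mul (h.diffAt_jac hx a i) (h.diffAt_jac hx b j),
      pderiv_comp (h := fun y => G₂ y a b) (h.diffAt hx) (h.diffAt_metric hx a b), Finset.mul_sum]
    have : ∀ c, jac φ x a i * jac φ x b j * (jac φ x c l * pderiv c (fun y => G₂ y a b) (φ x))
      = jac φ x a i * jac φ x b j * jac φ x c l * pderiv c (fun y => G₂ y a b) (φ x) :=
      fun c => by ring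
    simp only [this]
    ring
  rw [pderiv_sum fun a _ => DifferentiableAt.fun_sum fun b _ => (hd a b).fun_mul (hG a b)]
  have e2 : ∀ a, pderiv l (fun z => ∑ b, jac φ z a i * jac φ z b j * G₂ (φ z) a b) x
      = ∑ b, pderiv l (fun z => jac φ z a i * jac φ z b j * G₂ (φ z) a b) x := fun a =>
    pderiv_sum fun b _ => (hd a b).fun_mul (hG a b)
  simp only [e2, e, Finset.sum_add_distrib]
  congr 2
  rw [Finset.sum_comm]
  exact Finset.sum_congr rfl fun a _ => Finset.sum_congr rfl fun b _ => by
    rw [h.right.symm (h.mapsTo hx)]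

/-- The transformation law of the Christoffel symbols. -/
lemma christoffel_law (h : IsPullback φ U V G₁ G₂) {x : Coord n} (hx : x ∈ U) (a i j : Fin n) :
    ∑ k, jac φ x a k * christoffel G₁ x k i j
      = pderiv i (fun z => jac φ z a j) x
        + ∑ b, ∑ c, christoffel G₂ (φ x) a b c * jac φ x b i * jac φ x c j := by
  -- it suffices to prove the law after multiplication with the invertible matrix `Jᵀ G₂`, which
  -- amounts to lowering the upper index on both sides
  have key : ∀ l, ∑ k, G₁ x l k * christoffel G₁ x k i j
      = ∑ a, (∑ b, jac φ x b l * G₂ (φ x) b a) * (pderiv i (fun z => jac φ z a j) x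
        + ∑ b, ∑ c, christoffel G₂ (φ x) a b c * jac φ x b i * jac φ x c j) := by
    intro l
    -- the terms containing second derivatives of `φ`
    have hs : ∀ p i' j', (∑ a, ∑ b, pderiv p (fun z => jac φ z a i') x * jac φ x b j'
        * G₂ (φ x) a b) = ∑ a, ∑ b, pderiv i' (fun z => jac φ z a p) x * jac φ x b j'
        * G₂ (φ x) a b := by
      intro p i' j'
      simp only [h.pderiv_jac hx _ p i']
    -- the terms containing the Christoffel symbols of `G₂`
    have hK : ∑ a, ∑ b, jac φ x b l * G₂ (φ x) b a *
        ∑ p, ∑ q, christoffel G₂ (φ x) a p q * jac φ x p i * jac φ x q j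
        = 1 / 2 * ((∑ a, ∑ b, ∑ c, jac φ x a j * jac φ x b l * jac φ x c i
              * pderiv c (fun y => G₂ y a b) (φ x))
          + (∑ a, ∑ b, ∑ c, jac φ x a i * jac φ x b l * jac φ x c j
              * pderiv c (fun y => G₂ y a b) (φ x))
          - ∑ a, ∑ b, ∑ c, jac φ x a i * jac φ x b j * jac φ x c l
              * pderiv c (fun y => G₂ y a b) (φ x)) := by
      calc _ = ∑ b, ∑ p, ∑ q, jac φ x b l * jac φ x p i * jac φ x q j *
            ∑ a, G₂ (φ x) b a * christoffel G₂ (φ x) a p q := by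
            rw [Finset.sum_comm]
            refine Finset.sum_congr rfl fun b _ => ?_
            simp only [Finset.mul_sum]
            rw [Finset.sum_comm]
            refine Finset.sum_congr rfl fun p _ => ?_
            rw [Finset.sum_comm]
            exact Finset.sum_congr rfl fun q _ => Finset.sum_congr rfl fun a _ => by ring
        _ = ∑ b, ∑ p, ∑ q, jac φ x b l * jac φ x p i * jac φ x q j * ((1 / 2) *
            (pderiv p (fun z => G₂ z q b) (φ x) + pderiv q (fun z => G₂ z p b) (φ x)
              - pderiv b (fun z => G₂ z p q) (φ x))) := by
            simp only [metric_mul_christoffel h.right (h.mapsTo hx)]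
        _ = 1 / 2 * ((∑ b, ∑ p, ∑ q, jac φ x b l * jac φ x p i * jac φ x q j *
              pderiv p (fun z => G₂ z q b) (φ x))
            + (∑ b, ∑ p, ∑ q, jac φ x b l * jac φ x p i * jac φ x q j *
              pderiv q (fun z => G₂ z p b) (φ x))
            - ∑ b, ∑ p, ∑ q, jac φ x b l * jac φ x p i * jac φ x q j *
              pderiv b (fun z => G₂ z p q) (φ x)) := by
            simp only [← Finset.sum_add_distrib, ← Finset.sum_sub_distrib, Finset.mul_sum]
            exact Finset.sum_congr rfl fun b _ => Finset.sum_congr rfl fun p _ =>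
              Finset.sum_congr rfl fun q _ => by ring
        _ = _ := by
            congr 2
            · congr 1
              · rw [sum_rotate]
                refine Finset.sum_congr rfl fun q _ => Finset.sum_congr rfl fun b _ =>
                  Finset.sum_congr rfl fun p _ => by ring
              · rw [Finset.sum_comm]
                refine Finset.sum_congr rfl fun q _ => Finset.sum_congr rfl fun b _ =>
                  Finset.sum_congr rfl fun p _ => by ring
            · rw [← sum_rotate]
              refine Finset.sum_congr rfl fun q _ => Finset.sum_congr rfl fun b _ =>
                  Finset.sum_congr rfl fun p _ => by ring
    have hH : ∑ a, (∑ b, jac φ x b l * G₂ (φ x) b a) * pderiv i (fun z => jac φ z a j) x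
        = ∑ a, ∑ b, pderiv i (fun z => jac φ z a j) x * jac φ x b l * G₂ (φ x) a b := by
      refine Finset.sum_congr rfl fun a _ => ?_
      rw [Finset.sum_mul]
      refine Finset.sum_congr rfl fun b _ => ?_
      rw [h.right.symm (h.mapsTo hx) b a]; ring
    rw [metric_mul_christoffel h.left hx, h.pderiv_metric_left hx, h.pderiv_metric_left hx,
      h.pderiv_metric_left hx]
    simp only [mul_add, Finset.sum_add_distrib, hH]
    simp only [Finset.sum_mul, hK]
    rw [hs j i l, hs l i j, hs l j i]
    ring
  have hM : IsUnit ((jac φ x).transpose * G₂ (φ x)) := by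
    rw [Matrix.isUnit_iff_isUnit_det, Matrix.det_mul, Matrix.det_transpose]
    exact (h.isUnit_det hx).mul (h.right.isUnit_det (h.mapsTo hx))
  have := Matrix.mulVec_injective_of_isUnit hM
  refine congrFun (@this (fun a => ∑ k, jac φ x a k * christoffel G₁ x k i j)
    (fun a => pderiv i (fun z => jac φ z a j) x
        + ∑ b, ∑ c, christoffel G₂ (φ x) a b c * jac φ x b i * jac φ x c j) ?_) a
  funext l
  have hk := key l
  rw [h.eq x hx] at hk
  simp only [Matrix.mulVec, dotProduct]
  simp only [Matrix.mul_apply (M := (jac φ x).transpose * G₂ (φ x))] at hk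
  have e : ∀ a, ((jac φ x).transpose * G₂ (φ x)) l a = ∑ b, jac φ x b l * G₂ (φ x) b a := by
    intro a; simp [Matrix.mul_apply]
  simp only [e] at hk ⊢
  rw [← hk]
  simp only [Finset.mul_sum, Finset.sum_mul]
  rw [Finset.sum_comm]
  refine Finset.sum_congr rfl fun k _ => Finset.sum_congr rfl fun a _ =>
    Finset.sum_congr rfl fun b _ => by ring

end IsPullback

/-- The components of the tensor `T` depend smoothly on the point of `V`. -/
def SmoothOn {r : ℕ} (V : Set (Coord n)) (T : LocalTensor n r) : Prop :=
  ∀ a, ContDiffOn ℝ ∞ (fun y => T y a) V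

lemma IsMetricOn.smoothOn_covDeriv {r : ℕ} {V : Set (Coord n)}
    {G : Coord n → Matrix (Fin n) (Fin n) ℝ} (hG : IsMetricOn V G) {T : LocalTensor n r}
    (hT : SmoothOn V T) : SmoothOn V (covDeriv G T) := by
  intro a
  unfold covDeriv
  refine (smooth_pderiv hG.isOpen (hT _) _).sub (ContDiffOn.sum fun s _ => ContDiffOn.sum
    fun m _ => (hG.smooth_christoffel _ _ _).mul (hT _))

/-- On `U`, the tensor field `T₁` is the pullback of `T₂` under `φ`. -/
def Pulls {r : ℕ} (φ : Coord n → Coord n) (U : Set (Coord n)) (T₁ T₂ : LocalTensor n r) : Prop :=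
  ∀ x ∈ U, T₁ x = pullM (jac φ x) (T₂ (φ x))

/-- In a sum over a multi-index `c` and an index `m`, the entry of `c` in the slot `s` can be
exchanged with `m`. -/
lemma sum_update_swap {r : ℕ} (s : Fin r) (F : (Fin r → Fin n) → Fin n → ℝ) :
    ∑ c, ∑ m, F c m = ∑ c, ∑ m, F (Function.update c s m) (c s) := by
  rw [← Fintype.sum_prod_type', ← Fintype.sum_prod_type']
  refine Finset.sum_bij' (fun p _ => (Function.update p.1 s p.2, p.1 s))
    (fun p _ => (Function.update p.1 s p.2, p.1 s)) (by simp) (by simp) ?_ ?_ ?_ <;>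
  · rintro ⟨c, m⟩ _
    simp

lemma sum_snoc {r : ℕ} (F : (Fin (r + 1) → Fin n) → ℝ) :
    ∑ c, F c = ∑ c : Fin r → Fin n, ∑ d, F (Fin.snoc c d) := by
  rw [← (Fin.snocEquiv fun _ => Fin n).sum_comp, Fintype.sum_prod_type, Finset.sum_comm]
  rfl

/-- The covariant derivative commutes with changes of coordinates. -/
lemma Pulls.covDeriv {r : ℕ} {φ : Coord n → Coord n} {U V : Set (Coord n)}
    {G₁ G₂ : Coord n → Matrix (Fin n) (Fin n) ℝ} (h : IsPullback φ U V G₁ G₂)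
    {T₁ T₂ : LocalTensor n r} (hT : Pulls φ U T₁ T₂)
    (hd : ∀ y ∈ V, ∀ a, DifferentiableAt ℝ (fun z => T₂ z a) y) :
    Pulls φ U (covDeriv G₁ T₁) (covDeriv G₂ T₂) := by
  intro x hx
  funext a
  set a' : Fin r → Fin n := fun s => a s.castSucc with ha'
  set b : Fin n := a (Fin.last r) with hb
  have hJd := fun (c : Fin r → Fin n) (s : Fin r) => h.diffAt_jac hx (c s) (a' s)
  have hTd := fun c => h.diffAt_comp hx (hd _ (h.mapsTo hx) c)
  have hPd : ∀ c : Fin r → Fin n, DifferentiableAt ℝ (fun z => ∏ s, jac φ z (c s) (a' s)) x :=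
    fun c => (HasFDerivAt.finsetProd fun s _ => (hJd c s).hasFDerivAt).differentiableAt
  -- the partial derivative of the pulled back components
  have hder : pderiv b (fun z => T₁ z a') x
      = (∑ s, ∑ c : Fin r → Fin n, pderiv b (fun z => jac φ z (c s) (a' s)) x
            * (∏ k ∈ Finset.univ.erase s, jac φ x (c k) (a' k)) * T₂ (φ x) c)
        + ∑ c : Fin r → Fin n, ∑ d, (∏ s, jac φ x (c s) (a' s)) * jac φ x d b
            * pderiv d (fun z => T₂ z c) (φ x) := by
    rw [pderiv_congr_on h.left.isOpen (v := fun z => ∑ c : Fin r → Fin n,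
      (∏ s, jac φ z (c s) (a' s)) * T₂ (φ z) c) (fun z hz => by rw [hT z hz]; rfl) hx,
      pderiv_sum fun c _ => (hPd c).fun_mul (hTd c)]
    have e : ∀ c : Fin r → Fin n, pderiv b (fun z => (∏ s, jac φ z (c s) (a' s)) * T₂ (φ z) c) x
        = (∑ s, pderiv b (fun z => jac φ z (c s) (a' s)) x
            * (∏ k ∈ Finset.univ.erase s, jac φ x (c k) (a' k)) * T₂ (φ x) c)
        + ∑ d, (∏ s, jac φ x (c s) (a' s)) * jac φ x d b
            * pderiv d (fun z => T₂ z c) (φ x) := by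
      intro c
      rw [pderiv_mul (hPd c) (hTd c), pderiv_prod fun s _ => hJd c s,
        pderiv_comp (h := fun z => T₂ z c) (h.diffAt hx) (hd _ (h.mapsTo hx) c),
        Finset.sum_mul, Finset.mul_sum]
      simp only [mul_assoc]
    simp only [e, Finset.sum_add_distrib]
    rw [Finset.sum_comm]
  -- the correction terms on the side of `G₁`
  have hupd : ∀ (s : Fin r) (m : Fin n) (c : Fin r → Fin n),
      ∏ k, jac φ x (c k) (Function.update a' s m k)
        = jac φ x (c s) m * ∏ k ∈ Finset.univ.erase s, jac φ x (c k) (a' k) := by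
    intro s m c
    rw [← Finset.mul_prod_erase _ _ (Finset.mem_univ s)]
    congr 1
    · simp
    · refine Finset.prod_congr rfl fun k hk => ?_
      rw [Function.update_of_ne (Finset.ne_of_mem_erase hk)]
  have hcor : ∀ s : Fin r, ∑ m, christoffel G₁ x m b (a' s) * T₁ x (Function.update a' s m)
      = (∑ c : Fin r → Fin n, pderiv b (fun z => jac φ z (c s) (a' s)) x
            * (∏ k ∈ Finset.univ.erase s, jac φ x (c k) (a' k)) * T₂ (φ x) c)
        + ∑ c : Fin r → Fin n, ∑ e, ∑ d, christoffel G₂ (φ x) (c s) d e * jac φ x d b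
            * jac φ x e (a' s) * (∏ k ∈ Finset.univ.erase s, jac φ x (c k) (a' k))
            * T₂ (φ x) c := by
    intro s
    rw [hT x hx]
    unfold pullM
    simp only [hupd, Finset.mul_sum]
    rw [Finset.sum_comm, ← Finset.sum_add_distrib]
    refine Finset.sum_congr rfl fun c _ => ?_
    have := h.christoffel_law hx (c s) b (a' s)
    calc _ = (∑ k, jac φ x (c s) k * christoffel G₁ x k b (a' s))
            * ((∏ k ∈ Finset.univ.erase s, jac φ x (c k) (a' k)) * T₂ (φ x) c) := by
          rw [Finset.sum_mul]
          exact Finset.sum_congr rfl fun _ _ => by ring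
      _ = _ := by
          rw [this, add_mul, ← mul_assoc, Finset.sum_comm (s := Finset.univ) (f := fun e d =>
            christoffel G₂ (φ x) (c s) d e * jac φ x d b
            * jac φ x e (a' s) * (∏ k ∈ Finset.univ.erase s, jac φ x (c k) (a' k))
            * T₂ (φ x) c)]
          simp only [Finset.sum_mul, mul_assoc]
  have hswap : ∀ s : Fin r, (∑ c : Fin r → Fin n, ∑ e, ∑ d, christoffel G₂ (φ x) (c s) d e
            * jac φ x d b
            * jac φ x e (a' s) * (∏ k ∈ Finset.univ.erase s, jac φ x (c k) (a' k))
            * T₂ (φ x) c)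
      = ∑ c : Fin r → Fin n, ∑ d, ∑ m, (∏ s, jac φ x (c s) (a' s)) * jac φ x d b
          * (christoffel G₂ (φ x) m d (c s) * T₂ (φ x) (Function.update c s m)) := by
    intro s
    rw [sum_update_swap s]
    refine Finset.sum_congr rfl fun c _ => ?_
    rw [Finset.sum_comm]
    refine Finset.sum_congr rfl fun d _ => Finset.sum_congr rfl fun m _ => ?_
    have e1 : ∏ k ∈ Finset.univ.erase s, jac φ x (Function.update c s m k) (a' k)
        = ∏ k ∈ Finset.univ.erase s, jac φ x (c k) (a' k) :=
      Finset.prod_congr rfl fun k hk => by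
        rw [Function.update_of_ne (Finset.ne_of_mem_erase hk)]
    rw [e1, ← Finset.mul_prod_erase _ _ (Finset.mem_univ s)]
    simp only [Function.update_self]
    ring
  have hL : RicciSoliton.covDeriv G₁ T₁ x a = pderiv b (fun z => T₁ z a') x
    - ∑ s : Fin r, ∑ m : Fin n, christoffel G₁ x m b (a' s) * T₁ x (Function.update a' s m) := rfl
  -- the derivatives of the Jacobian cancel; what remains is the covariant derivative of `T₂`
  rw [hL, hder]
  simp only [hcor, hswap, Finset.sum_add_distrib]
  rw [add_sub_add_left_eq_sub]
  unfold pullM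
  rw [sum_snoc, Finset.sum_comm (s := (Finset.univ : Finset (Fin r))), ← Finset.sum_sub_distrib]
  refine Finset.sum_congr rfl fun c _ => ?_
  rw [Finset.sum_comm (s := (Finset.univ : Finset (Fin r))), ← Finset.sum_sub_distrib]
  refine Finset.sum_congr rfl fun d _ => ?_
  have hR : RicciSoliton.covDeriv G₂ T₂ (φ x) (Fin.snoc c d : Fin (r + 1) → Fin n)
      = pderiv d (fun z => T₂ z c) (φ x)
        - ∑ s : Fin r, ∑ m, christoffel G₂ (φ x) m d (c s)
            * T₂ (φ x) (Function.update c s m) := by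
    unfold RicciSoliton.covDeriv
    simp [Fin.snoc_castSucc, Fin.snoc_last]
  rw [hR, Fin.prod_univ_castSucc]
  simp only [Fin.snoc_castSucc, Fin.snoc_last, mul_sub, Finset.mul_sum]
  rfl

end

/-! ### Covariant derivatives of tensors of small rank -/

section

lemma covDeriv_snoc {r : ℕ} (G : Coord n → Matrix (Fin n) (Fin n) ℝ) (T : LocalTensor n r)
    (y : Coord n) (a : Fin r → Fin n) (b : Fin n) :
    covDeriv G T y (Fin.snoc a b : Fin (r + 1) → Fin n)
      = pderiv b (fun z => T z a) y
        - ∑ s : Fin r, ∑ m, christoffel G y m b (a s) * T y (Function.update a s m) := by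
  unfold covDeriv
  simp [Fin.snoc_castSucc, Fin.snoc_last]

section Expand
variable (G : Coord n → Matrix (Fin n) (Fin n) ℝ) (y : Coord n)

lemma covDeriv_rank_one (T : LocalTensor n 1) (k b : Fin n) :
    covDeriv G T y ![k, b] = pderiv b (fun z => T z ![k]) y
      - ∑ m, christoffel G y m b k * T y ![m] := by
  have h := covDeriv_snoc G T y ![k] b
  rw [show (Fin.snoc ![k] b : Fin 2 → Fin n) = ![k, b] by ext s; fin_cases s <;> rfl] at h
  rw [h, Fin.sum_univ_one]
  simp only [show ∀ m, Function.update ![k] 0 m = ![m] by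
    intro m; ext s; fin_cases s; rfl]
  rfl

lemma covDeriv_rank_two (T : LocalTensor n 2) (k i b : Fin n) :
    covDeriv G T y ![k, i, b] = pderiv b (fun z => T z ![k, i]) y
      - ∑ m, christoffel G y m b k * T y ![m, i]
      - ∑ m, christoffel G y m b i * T y ![k, m] := by
  have h := covDeriv_snoc G T y ![k, i] b
  rw [show (Fin.snoc ![k, i] b : Fin 3 → Fin n) = ![k, i, b] by ext s; fin_cases s <;> rfl] at h
  rw [h, Fin.sum_univ_two]
  simp only [show ∀ m, Function.update ![k, i] 0 m = ![m, i] by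
    intro m; ext s; fin_cases s <;> rfl, show ∀ m, Function.update ![k, i] 1 m = ![k, m] by
    intro m; ext s; fin_cases s <;> rfl, sub_sub]
  rfl

end Expand

lemma sum_vecCons {r : ℕ} (F : (Fin (r + 1) → Fin n) → ℝ) :
    ∑ c, F c = ∑ d, ∑ c : Fin r → Fin n, F (Matrix.vecCons d c) := by
  rw [← (Fin.consEquiv fun _ => Fin n).sum_comp, Fintype.sum_prod_type]
  rfl

lemma sum_vecEmpty (F : (Fin 0 → Fin n) → ℝ) : ∑ c, F c = F ![] := by
  rw [Fintype.sum_unique]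
  congr 1

/-- The commutator of two covariant derivatives of a one-form. -/
lemma ricci_identity {V : Set (Coord n)} {G : Coord n → Matrix (Fin n) (Fin n) ℝ}
    (hG : IsMetricOn V G) {η : LocalTensor n 1} (hη : SmoothOn V η) {y : Coord n} (hy : y ∈ V)
    (i j k : Fin n) :
    covDeriv G (covDeriv G η) y ![k, i, j] - covDeriv G (covDeriv G η) y ![k, j, i]
      = - ∑ l, riemannUp G y l i j k * η y ![l] := by
  have hΓ : ∀ l p q, DifferentiableAt ℝ (fun z => christoffel G z l p q) y := fun l p q =>
    diffAt_of_smooth hG.isOpen (hG.smooth_christoffel l p q) hy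
  have hd : ∀ l, DifferentiableAt ℝ (fun z => η z ![l]) y := fun l =>
    diffAt_of_smooth hG.isOpen (hη _) hy
  have hdd : ∀ p l, DifferentiableAt ℝ (pderiv p fun z => η z ![l]) y := fun p l =>
    diffAt_of_smooth hG.isOpen (smooth_pderiv hG.isOpen (hη _) p) hy
  have h1 : ∀ p q : Fin n, pderiv q (fun z => covDeriv G η z ![k, p]) y
      = pderiv q (pderiv p fun z => η z ![k]) y
        - ∑ l, (pderiv q (fun z => christoffel G z l p k) y * η y ![l]
            + christoffel G y l p k * pderiv q (fun z => η z ![l]) y) := by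
    intro p q
    simp only [covDeriv_rank_one]
    rw [pderiv_sub (hdd p k) (DifferentiableAt.fun_sum fun l _ => (hΓ l p k).fun_mul (hd l)),
      pderiv_sum fun l _ => (hΓ l p k).fun_mul (hd l)]
    congr 1
    exact Finset.sum_congr rfl fun l _ => pderiv_mul (hΓ l p k) (hd l)
  have h2 : ∀ p q : Fin n, ∑ m, christoffel G y m q k * covDeriv G η y ![m, p]
      = ∑ m, christoffel G y m q k * pderiv p (fun z => η z ![m]) y
        - ∑ l, (∑ m, christoffel G y m q k * christoffel G y l p m) * η y ![l] := by
    intro p q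
    simp only [covDeriv_rank_one, mul_sub, Finset.sum_sub_distrib, Finset.mul_sum, Finset.sum_mul]
    congr 1
    rw [Finset.sum_comm]
    exact Finset.sum_congr rfl fun _ _ => Finset.sum_congr rfl fun _ _ => by ring
  have h3 : ∑ m, christoffel G y m j i * covDeriv G η y ![k, m]
      = ∑ m, christoffel G y m i j * covDeriv G η y ![k, m] :=
    Finset.sum_congr rfl fun m _ => by rw [christoffel_symm hG hy]
  have h4 : pderiv j (pderiv i fun z => η z ![k]) y = pderiv i (pderiv j fun z => η z ![k]) y :=
    pderiv_comm (((hη _).contDiffAt (hG.isOpen.mem_nhds hy)).of_le ENat.LEInfty.out) j i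
  rw [covDeriv_rank_two, covDeriv_rank_two, h1, h1, h2, h2, h3, h4]
  unfold riemannUp
  simp only [Finset.sum_add_distrib, add_mul, sub_mul, Finset.sum_sub_distrib]
  ring

/-! ### Natural operations -/

/-! Sums, tensor products and contractions of tensor fields commute with changes of coordinates. A
slot permutation or distribution is recorded by explicit maps between the index sets `Fin r`. -/

namespace Pulls
variable {φ : Coord n → Coord n} {U V : Set (Coord n)} {r s : ℕ}
  {G₁ G₂ : Coord n → Matrix (Fin n) (Fin n) ℝ}

lemma add {T₁ T₂ S₁ S₂ : LocalTensor n r} (hT : Pulls φ U T₁ T₂) (hS : Pulls φ U S₁ S₂) :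
    Pulls φ U (fun x a => T₁ x a + S₁ x a) (fun x a => T₂ x a + S₂ x a) := by
  intro x hx
  rw [pullM_add, ← hT x hx, ← hS x hx]

lemma sub {T₁ T₂ S₁ S₂ : LocalTensor n r} (hT : Pulls φ U T₁ T₂) (hS : Pulls φ U S₁ S₂) :
    Pulls φ U (fun x a => T₁ x a - S₁ x a) (fun x a => T₂ x a - S₂ x a) := by
  intro x hx
  rw [pullM_sub, ← hT x hx, ← hS x hx]

lemma const_mul {T₁ T₂ : LocalTensor n r} (c : ℝ) (hT : Pulls φ U T₁ T₂) :
    Pulls φ U (fun x a => c * T₁ x a) (fun x a => c * T₂ x a) := by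
  intro x hx
  rw [pullM_smul, ← hT x hx]

lemma fun_mul {T₁ T₂ : LocalTensor n r} (u : Coord n → ℝ) (hT : Pulls φ U T₁ T₂) :
    Pulls φ U (fun x a => u (φ x) * T₁ x a) (fun y a => u y * T₂ y a) := by
  intro x hx
  rw [pullM_smul, ← hT x hx]

lemma reindex {T₁ T₂ : LocalTensor n r} (hT : Pulls φ U T₁ T₂) (p : Fin r → Fin s)
    (hp : Function.Bijective p) :
    Pulls φ U (fun x a => T₁ x (a ∘ p)) (fun x a => T₂ x (a ∘ p)) := by
  intro x hx
  rw [pullM_reindex _ _ p hp, ← hT x hx]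

lemma mul {t : ℕ} {T₁ T₂ : LocalTensor n r} {S₁ S₂ : LocalTensor n s} (hT : Pulls φ U T₁ T₂)
    (hS : Pulls φ U S₁ S₂) (p : Fin r → Fin t) (q : Fin s → Fin t)
    (hpq : Function.Bijective (Sum.elim p q)) :
    Pulls φ U (fun x a => T₁ x (a ∘ p) * S₁ x (a ∘ q))
      (fun x a => T₂ x (a ∘ p) * S₂ x (a ∘ q)) := by
  intro x hx
  rw [pullM_mul _ _ _ p q hpq, ← hT x hx, ← hS x hx]

lemma contract (h : IsPullback φ U V G₁ G₂) {T₁ T₂ : LocalTensor n r} (hT : Pulls φ U T₁ T₂)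
    (p : Fin r → Fin s ⊕ Fin 2) (hp : Function.Bijective p) :
    Pulls φ U (fun x => RicciSoliton.contract p (G₁ x)⁻¹ (T₁ x))
      (fun y => RicciSoliton.contract p (G₂ y)⁻¹ (T₂ y)) := by
  intro x hx
  rw [← pullM_contract _ _ _ (h.inv_eq hx) p hp, ← hT x hx]

lemma congr {T₁ T₂ S₁ S₂ : LocalTensor n r} (hT : Pulls φ U T₁ T₂)
    (h₁ : ∀ x a, S₁ x a = T₁ x a) (h₂ : ∀ x a, S₂ x a = T₂ x a) : Pulls φ U S₁ S₂ := by
  rwa [show S₁ = T₁ from funext fun x => funext (h₁ x),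
    show S₂ = T₂ from funext fun x => funext (h₂ x)]

/-- A natural tensor of rank zero is an invariant function. -/
lemma eval_rank_zero {T₁ T₂ : LocalTensor n 0} (hT : Pulls φ U T₁ T₂) {x : Coord n} (hx : x ∈ U)
    (a b : Fin 0 → Fin n) : T₁ x a = T₂ (φ x) b := by
  rw [hT x hx, Subsingleton.elim a b]
  unfold pullM
  rw [Fintype.sum_unique, Subsingleton.elim b default]
  simp

end Pulls

namespace IsPullback
variable {φ : Coord n → Coord n} {U V : Set (Coord n)}
  {G₁ G₂ : Coord n → Matrix (Fin n) (Fin n) ℝ}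

/-- The tensor character of the curvature. -/
lemma riemannUp_law (h : IsPullback φ U V G₁ G₂) {x : Coord n} (hx : x ∈ U) (c i j k : Fin n) :
    ∑ l, jac φ x c l * riemannUp G₁ x l i j k
      = ∑ a, ∑ b, ∑ d, jac φ x a i * jac φ x b j * jac φ x d k * riemannUp G₂ (φ x) c a b d := by
  -- apply the Ricci identity to the constant one-form `dyᶜ` and to its pullback
  set η₂ : LocalTensor n 1 := fun _ a => if a 0 = c then 1 else 0 with hη₂
  set η₁ : LocalTensor n 1 := fun x => pullM (jac φ x) (η₂ (φ x)) with hη₁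
  have hη : Pulls φ U η₁ η₂ := fun x _ => rfl
  have hs₂ : SmoothOn V η₂ := fun a => contDiffOn_const
  have hs₁ : SmoothOn U η₁ := fun a => ContDiffOn.sum fun b _ =>
    (contDiffOn_prod fun s _ => h.smooth_jac _ _).mul contDiffOn_const
  have hd₂ : ∀ y ∈ V, ∀ a, DifferentiableAt ℝ (fun z => η₂ z a) y := fun y hy a =>
    diffAt_of_smooth h.right.isOpen (hs₂ a) hy
  have h1 := hη.covDeriv h hd₂
  have h2 := h1.covDeriv h fun y hy a =>
    diffAt_of_smooth h.right.isOpen (h.right.smoothOn_covDeriv hs₂ a) hy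
  have e1 := ricci_identity h.left hs₁ hx i j k
  have e2 := fun a b d => ricci_identity h.right hs₂ (h.mapsTo hx) a b d
  have ew : ∀ l, η₁ x ![l] = jac φ x c l := by
    intro l
    simp [hη₁, hη₂, pullM, sum_vecCons]
  simp only [ew] at e1
  have e3 : ∀ a b d, ∑ l, riemannUp G₂ (φ x) l a b d * η₂ (φ x) ![l]
      = riemannUp G₂ (φ x) c a b d := by
    intro a b d
    simp [hη₂]
  simp only [e3] at e2
  have e4 : ∀ i j : Fin n, covDeriv G₁ (covDeriv G₁ η₁) x ![k, i, j]
      = ∑ a, ∑ b, ∑ d, jac φ x a i * jac φ x b j * jac φ x d k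
        * covDeriv G₂ (covDeriv G₂ η₂) (φ x) ![d, a, b] := by
    intro i j
    rw [h2 x hx]
    simp only [pullM, sum_vecCons, sum_vecEmpty]
    rw [sum_rotate (fun a b d => jac φ x a i * jac φ x b j * jac φ x d k
        * covDeriv G₂ (covDeriv G₂ η₂) (φ x) ![d, a, b])]
    refine Finset.sum_congr rfl fun d _ => Finset.sum_congr rfl fun a _ =>
      Finset.sum_congr rfl fun b _ => ?_
    change (∏ s : Fin 3, jac φ x (![d, a, b] s) (![k, i, j] s)) * _ = _
    rw [Fin.prod_univ_three]
    change jac φ x d k * jac φ x a i * jac φ x b j * _ = _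
    ring
  rw [e4 i j, e4 j i] at e1
  have e5 : ∑ l, jac φ x c l * riemannUp G₁ x l i j k
      = ∑ l, riemannUp G₁ x l i j k * jac φ x c l :=
    Finset.sum_congr rfl fun _ _ => mul_comm _ _
  rw [e5, ← neg_eq_iff_eq_neg.mpr e1]
  rw [Finset.sum_comm (f := fun a b => ∑ d, jac φ x a j * jac φ x b i * jac φ x d k
        * covDeriv G₂ (covDeriv G₂ η₂) (φ x) ![d, a, b])]
  simp only [← Finset.sum_sub_distrib, ← Finset.sum_neg_distrib]
  refine Finset.sum_congr rfl fun a _ => Finset.sum_congr rfl fun b _ =>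
    Finset.sum_congr rfl fun d _ => ?_
  linear_combination (-(jac φ x a i * jac φ x b j * jac φ x d k)) * e2 a b d

lemma riemann (h : IsPullback φ U V G₁ G₂) :
    Pulls φ U (RicciSoliton.riemann G₁) (RicciSoliton.riemann G₂) := by
  intro x hx
  funext a
  simp only [pullM, sum_vecCons, sum_vecEmpty]
  unfold RicciSoliton.riemann
  calc _ = ∑ p, ∑ q, jac φ x p (a 3) * G₂ (φ x) p q
          * ∑ m, jac φ x q m * riemannUp G₁ x m (a 0) (a 1) (a 2) := by
        simp only [h.metric_apply hx, Finset.sum_mul, Finset.mul_sum]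
        rw [sum_rotate']
        refine Finset.sum_congr rfl fun p _ => Finset.sum_congr rfl fun q _ =>
          Finset.sum_congr rfl fun m _ => by ring
    _ = ∑ p, ∑ q, ∑ i, ∑ j, ∑ k, jac φ x p (a 3) * G₂ (φ x) p q
          * (jac φ x i (a 0) * jac φ x j (a 1) * jac φ x k (a 2)
            * riemannUp G₂ (φ x) q i j k) := by
        simp only [h.riemannUp_law hx, Finset.mul_sum]
    _ = ∑ i, ∑ j, ∑ k, ∑ p, ∑ q, jac φ x p (a 3) * G₂ (φ x) p q
          * (jac φ x i (a 0) * jac φ x j (a 1) * jac φ x k (a 2)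
            * riemannUp G₂ (φ x) q i j k) := by
        rw [sum_rotate]
        refine Finset.sum_congr rfl fun i _ => ?_
        rw [sum_rotate]
        refine Finset.sum_congr rfl fun j _ => ?_
        rw [sum_rotate]
    _ = _ := by
        refine Finset.sum_congr rfl fun i _ => Finset.sum_congr rfl fun j _ =>
          Finset.sum_congr rfl fun k _ => Finset.sum_congr rfl fun p _ => ?_
        simp only [Finset.mul_sum, Fin.prod_univ_succ]
        refine Finset.sum_congr rfl fun q _ => ?_
        simp
        ring

end IsPullback

end

/-! ### Smoothness and naturality of the curvature tensors -/

section

/-- The metric as a covariant two-tensor. -/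
def metricTensor (G : Coord n → Matrix (Fin n) (Fin n) ℝ) : LocalTensor n 2 :=
  fun y a => G y (a 0) (a 1)

/-- The differential of a function, as a one-form. -/
def differential (u : Coord n → ℝ) : LocalTensor n 1 := fun y a => pderiv (a 0) u y

/-- The Weyl tensor contracted with its derivative index, `g^{ll'} W_{lkti,l'}`. -/
def divWeyl (G : Coord n → Matrix (Fin n) (Fin n) ℝ) : LocalTensor n 3 := fun y =>
  contract ![Sum.inr 0, Sum.inl 0, Sum.inl 1, Sum.inl 2, Sum.inr 1] (G y)⁻¹
    (covDeriv G (weyl G) y)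

lemma ricci_eq_contract (G : Coord n → Matrix (Fin n) (Fin n) ℝ) (y : Coord n) (a : Fin 2 → Fin n) :
    ricci G y a = contract ![Sum.inl 0, Sum.inr 0, Sum.inl 1, Sum.inr 1] (G y)⁻¹
      (riemann G y) a := by
  unfold ricci contract
  refine Finset.sum_congr rfl fun j _ => Finset.sum_congr rfl fun l _ => ?_
  congr 2
  ext s; fin_cases s <;> rfl

lemma scalarCurvature_eq_contract (G : Coord n → Matrix (Fin n) (Fin n) ℝ) (y : Coord n)
    (a : Fin 0 → Fin n) :
    scalarCurvature G y = contract ![Sum.inr 0, Sum.inr 1] (G y)⁻¹ (ricci G y) a := by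
  unfold scalarCurvature contract
  refine Finset.sum_congr rfl fun j _ => Finset.sum_congr rfl fun l _ => ?_
  congr 2
  ext s; fin_cases s <;> rfl

lemma cotton_eq (G : Coord n → Matrix (Fin n) (Fin n) ℝ) (y : Coord n) (a : Fin 3 → Fin n) :
    cotton G y a = covDeriv G (ricci G) y a - covDeriv G (ricci G) y (a ∘ ![0, 2, 1])
      - 1 / (2 * ((n : ℝ) - 1)) * (differential (scalarCurvature G) y (a ∘ ![2])
          * metricTensor G y (a ∘ ![0, 1])
        - differential (scalarCurvature G) y (a ∘ ![1]) * metricTensor G y (a ∘ ![0, 2])) := by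
  have h1 : ![a 0, a 1, a 2] = a := by ext s; fin_cases s <;> rfl
  have h2 : ![a 0, a 2, a 1] = a ∘ ![0, 2, 1] := by ext s; fin_cases s <;> rfl
  unfold cotton
  simp only [h1, h2]
  rfl

lemma weyl_eq (G : Coord n → Matrix (Fin n) (Fin n) ℝ) (y : Coord n) (a : Fin 4 → Fin n) :
    weyl G y a = riemann G y a
      - 1 / ((n : ℝ) - 2) * (ricci G y (a ∘ ![0, 2]) * metricTensor G y (a ∘ ![1, 3])
          - ricci G y (a ∘ ![0, 3]) * metricTensor G y (a ∘ ![1, 2])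
          + ricci G y (a ∘ ![1, 3]) * metricTensor G y (a ∘ ![0, 2])
          - ricci G y (a ∘ ![1, 2]) * metricTensor G y (a ∘ ![0, 3]))
      + 1 / (((n : ℝ) - 1) * ((n : ℝ) - 2)) * (scalarCurvature G y
        * (metricTensor G y (a ∘ ![0, 2]) * metricTensor G y (a ∘ ![1, 3])
          - metricTensor G y (a ∘ ![0, 3]) * metricTensor G y (a ∘ ![1, 2]))) := by
  have h1 : ![a 0, a 1, a 2, a 3] = a := by ext s; fin_cases s <;> rfl
  have h2 : ∀ i j : Fin 4, ![a i, a j] = a ∘ ![i, j] := by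
    intro i j; ext s; fin_cases s <;> rfl
  have h3 : ∀ i j : Fin 4, G y (a i) (a j) = metricTensor G y (a ∘ ![i, j]) := fun _ _ => rfl
  unfold weyl
  simp only [h1]
  simp only [h2, h3]
  ring

namespace IsMetricOn
variable {V : Set (Coord n)} {G : Coord n → Matrix (Fin n) (Fin n) ℝ}

lemma smoothOn_contract (hG : IsMetricOn V G) {r s : ℕ} {T : LocalTensor n r} (hT : SmoothOn V T)
    (p : Fin r → Fin s ⊕ Fin 2) : SmoothOn V (fun y => contract p (G y)⁻¹ (T y)) := fun _ =>
  ContDiffOn.sum fun _ _ => ContDiffOn.sum fun _ _ => (hG.smooth_inv _ _).mul (hT _)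

lemma smooth_riemannUp (hG : IsMetricOn V G) (l i j k : Fin n) :
    ContDiffOn ℝ ∞ (fun y => riemannUp G y l i j k) V := by
  have hΓ := hG.smooth_christoffel
  unfold riemannUp
  refine ((smooth_pderiv hG.isOpen (hΓ _ _ _) _).sub (smooth_pderiv hG.isOpen (hΓ _ _ _) _)).add
    (ContDiffOn.sum fun m _ => ((hΓ _ _ _).mul (hΓ _ _ _)).sub ((hΓ _ _ _).mul (hΓ _ _ _)))

lemma smoothOn_riemann (hG : IsMetricOn V G) : SmoothOn V (riemann G) := fun _ =>
  ContDiffOn.sum fun _ _ => (hG.smooth _ _).mul (hG.smooth_riemannUp _ _ _ _)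

lemma smoothOn_ricci (hG : IsMetricOn V G) : SmoothOn V (ricci G) := fun a => by
  simpa only [ricci_eq_contract] using hG.smoothOn_contract hG.smoothOn_riemann _ a

lemma smooth_scalarCurvature (hG : IsMetricOn V G) : ContDiffOn ℝ ∞ (scalarCurvature G) V := by
  refine (hG.smoothOn_contract hG.smoothOn_ricci ![Sum.inr 0, Sum.inr 1] ![]).congr fun y _ => ?_
  rw [scalarCurvature_eq_contract]

lemma smoothOn_metricTensor (hG : IsMetricOn V G) : SmoothOn V (metricTensor G) := fun _ =>
  hG.smooth _ _

lemma smoothOn_cotton (hG : IsMetricOn V G) : SmoothOn V (cotton G) := fun a => by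
  have h1 := hG.smoothOn_covDeriv hG.smoothOn_ricci
  have h2 := hG.smooth_scalarCurvature
  exact ((h1 _).sub (h1 _)).sub (contDiffOn_const.mul
    (((smooth_pderiv hG.isOpen h2 _).mul (hG.smooth _ _)).sub
      ((smooth_pderiv hG.isOpen h2 _).mul (hG.smooth _ _))))

lemma smoothOn_weyl (hG : IsMetricOn V G) : SmoothOn V (weyl G) := fun a => by
  have h0 := hG.smoothOn_ricci
  have h1 := hG.smoothOn_riemann
  have h2 := hG.smooth_scalarCurvature
  have h3 := hG.smoothOn_metricTensor
  simp only [weyl_eq]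
  exact ((h1 _).sub (contDiffOn_const.mul (((((h0 _).mul (h3 _)).sub ((h0 _).mul (h3 _))).add
    ((h0 _).mul (h3 _))).sub ((h0 _).mul (h3 _))))).add (contDiffOn_const.mul
    (h2.mul (((h3 _).mul (h3 _)).sub ((h3 _).mul (h3 _)))))

lemma diffAt_tensor (hG : IsMetricOn V G) {r : ℕ} {T : LocalTensor n r} (hT : SmoothOn V T)
    {y : Coord n} (hy : y ∈ V) (a : Fin r → Fin n) : DifferentiableAt ℝ (fun z => T z a) y :=
  diffAt_of_smooth hG.isOpen (hT a) hy

end IsMetricOn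

namespace IsPullback
variable {φ : Coord n → Coord n} {U V : Set (Coord n)}
  {G₁ G₂ : Coord n → Matrix (Fin n) (Fin n) ℝ}

lemma metricTensor (h : IsPullback φ U V G₁ G₂) :
    Pulls φ U (RicciSoliton.metricTensor G₁) (RicciSoliton.metricTensor G₂) := by
  intro x hx
  funext a
  unfold RicciSoliton.metricTensor
  rw [h.metric_apply hx]
  simp [pullM, sum_vecCons]

lemma differential (h : IsPullback φ U V G₁ G₂) {u₁ u₂ : Coord n → ℝ}
    (hu : ∀ x ∈ U, u₁ x = u₂ (φ x)) (hd : ∀ y ∈ V, DifferentiableAt ℝ u₂ y) :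
    Pulls φ U (RicciSoliton.differential u₁) (RicciSoliton.differential u₂) := by
  intro x hx
  funext a
  unfold RicciSoliton.differential
  rw [pderiv_congr_on h.left.isOpen hu hx, pderiv_comp (h.diffAt hx) (hd _ (h.mapsTo hx))]
  simp [pullM, sum_vecCons]

lemma ricci (h : IsPullback φ U V G₁ G₂) :
    Pulls φ U (RicciSoliton.ricci G₁) (RicciSoliton.ricci G₂) :=
  (h.riemann.contract h _ (by decide)).congr (fun x a => ricci_eq_contract G₁ x a)
    fun x a => ricci_eq_contract G₂ x a

lemma scalarCurvature (h : IsPullback φ U V G₁ G₂) {x : Coord n} (hx : x ∈ U) :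
    RicciSoliton.scalarCurvature G₁ x = RicciSoliton.scalarCurvature G₂ (φ x) := by
  have := (h.ricci.contract h (s := 0) ![Sum.inr 0, Sum.inr 1]
    (by decide)).eval_rank_zero hx ![] ![]
  rwa [← scalarCurvature_eq_contract, ← scalarCurvature_eq_contract] at this

lemma differential_scalarCurvature (h : IsPullback φ U V G₁ G₂) :
    Pulls φ U (RicciSoliton.differential (RicciSoliton.scalarCurvature G₁))
      (RicciSoliton.differential (RicciSoliton.scalarCurvature G₂)) :=
  h.differential (fun _ hx => h.scalarCurvature hx) fun _ hy =>
    diffAt_of_smooth h.right.isOpen h.right.smooth_scalarCurvature hy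

lemma covDeriv (h : IsPullback φ U V G₁ G₂) {r : ℕ} {T₁ T₂ : LocalTensor n r}
    (hT : Pulls φ U T₁ T₂) (hs : SmoothOn V T₂) :
    Pulls φ U (RicciSoliton.covDeriv G₁ T₁) (RicciSoliton.covDeriv G₂ T₂) :=
  hT.covDeriv h fun _ hy a => h.right.diffAt_tensor hs hy a

lemma cotton (h : IsPullback φ U V G₁ G₂) :
    Pulls φ U (RicciSoliton.cotton G₁) (RicciSoliton.cotton G₂) := by
  have h1 := h.covDeriv h.ricci h.right.smoothOn_ricci
  have h2 := h.differential_scalarCurvature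
  have h3 := h.metricTensor
  exact ((h1.sub (h1.reindex ![0, 2, 1] (by decide))).sub
    (((h2.mul h3 ![2] ![0, 1] (by decide)).sub (h2.mul h3 ![1] ![0, 2] (by decide))).const_mul
      (1 / (2 * ((n : ℝ) - 1))))).congr (fun x a => cotton_eq G₁ x a) fun x a => cotton_eq G₂ x a

lemma weyl (h : IsPullback φ U V G₁ G₂) :
    Pulls φ U (RicciSoliton.weyl G₁) (RicciSoliton.weyl G₂) := by
  have h0 := h.riemann
  have h1 := h.ricci
  have h3 := h.metricTensor
  have h4 : Pulls φ U (fun x a => RicciSoliton.scalarCurvature G₁ x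
      * (RicciSoliton.metricTensor G₁ x (a ∘ ![0, 2]) * RicciSoliton.metricTensor G₁ x (a ∘ ![1, 3])
      - RicciSoliton.metricTensor G₁ x (a ∘ ![0, 3])
        * RicciSoliton.metricTensor G₁ x (a ∘ ![1, 2])))
      (fun x (a : Fin 4 → Fin n) => RicciSoliton.scalarCurvature G₂ x
      * (RicciSoliton.metricTensor G₂ x (a ∘ ![0, 2]) * RicciSoliton.metricTensor G₂ x (a ∘ ![1, 3])
      - RicciSoliton.metricTensor G₂ x (a ∘ ![0, 3])
        * RicciSoliton.metricTensor G₂ x (a ∘ ![1, 2]))) := by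
    intro x hx
    beta_reduce
    rw [h.scalarCurvature hx]
    exact (((h3.mul h3 ![0, 2] ![1, 3] (by decide)).sub
      (h3.mul h3 ![0, 3] ![1, 2] (by decide))).fun_mul (RicciSoliton.scalarCurvature G₂)) x hx
  exact ((h0.sub (((((h1.mul h3 ![0, 2] ![1, 3] (by decide)).sub
    (h1.mul h3 ![0, 3] ![1, 2] (by decide))).add (h1.mul h3 ![1, 3] ![0, 2] (by decide))).sub
    (h1.mul h3 ![1, 2] ![0, 3] (by decide))).const_mul (1 / ((n : ℝ) - 2)))).add
    (h4.const_mul (1 / (((n : ℝ) - 1) * ((n : ℝ) - 2))))).congr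
    (fun x a => weyl_eq G₁ x a) fun x a => weyl_eq G₂ x a

lemma divWeyl (h : IsPullback φ U V G₁ G₂) :
    Pulls φ U (RicciSoliton.divWeyl G₁) (RicciSoliton.divWeyl G₂) :=
  (h.covDeriv h.weyl h.right.smoothOn_weyl).contract h _ (by decide)

end IsPullback

/-- The full contraction of a covariant six-tensor in the pairs of slots `(0,1)`, `(2,3)`,
`(4,5)`. -/
def contractPairs (G : Coord n → Matrix (Fin n) (Fin n) ℝ) (T : LocalTensor n 6) :
    LocalTensor n 0 := fun y =>
  contract (κ := Fin 0) ![Sum.inr 0, Sum.inr 1] (G y)⁻¹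
    (contract (κ := Fin 2) ![Sum.inl 0, Sum.inl 1, Sum.inr 0, Sum.inr 1] (G y)⁻¹
      (contract (κ := Fin 4) ![Sum.inl 0, Sum.inl 1, Sum.inl 2, Sum.inl 3, Sum.inr 0, Sum.inr 1]
        (G y)⁻¹ (T y)))

lemma contractPairs_apply (G : Coord n → Matrix (Fin n) (Fin n) ℝ) (T : LocalTensor n 6)
    (y : Coord n) (a : Fin 0 → Fin n) :
    contractPairs G T y a = ∑ k, ∑ k', ∑ t, ∑ t', ∑ i, ∑ i', (G y)⁻¹ k k' * (G y)⁻¹ t t'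
      * (G y)⁻¹ i i' * T y ![k, k', t, t', i, i'] := by
  unfold contractPairs contract
  simp only [Finset.mul_sum, mul_assoc]
  refine Finset.sum_congr rfl fun k _ => Finset.sum_congr rfl fun k' _ =>
    Finset.sum_congr rfl fun t _ => Finset.sum_congr rfl fun t' _ =>
    Finset.sum_congr rfl fun i _ => Finset.sum_congr rfl fun i' _ => ?_
  congr 4
  ext s; fin_cases s <;> rfl

lemma IsPullback.contractPairs {φ : Coord n → Coord n} {U V : Set (Coord n)}
    {G₁ G₂ : Coord n → Matrix (Fin n) (Fin n) ℝ} (h : IsPullback φ U V G₁ G₂)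
    {T₁ T₂ : LocalTensor n 6} (hT : Pulls φ U T₁ T₂) :
    Pulls φ U (RicciSoliton.contractPairs G₁ T₁) (RicciSoliton.contractPairs G₂ T₂) :=
  ((hT.contract h _ (by decide)).contract h _ (by decide)).contract h _ (by decide)

lemma cottonTerm_eq (G : Coord n → Matrix (Fin n) (Fin n) ℝ) (u : Coord n → ℝ) (y : Coord n)
    (a : Fin 0 → Fin n) :
    cottonTerm G u y = contractPairs G (fun z b => covDeriv G (covDeriv G (cotton G)) z
      (b ∘ ![0, 2, 4, 5, 3]) * differential u z (b ∘ ![1])) y a := by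
  rw [contractPairs_apply]
  unfold cottonTerm
  refine Finset.sum_congr rfl fun k _ => Finset.sum_congr rfl fun k' _ =>
    Finset.sum_congr rfl fun t _ => Finset.sum_congr rfl fun t' _ =>
    Finset.sum_congr rfl fun i _ => Finset.sum_congr rfl fun i' _ => ?_
  rw [mul_assoc]
  congr 3
  ext s; fin_cases s <;> rfl

lemma cottonNorm_eq (G : Coord n → Matrix (Fin n) (Fin n) ℝ) (y : Coord n)
    (a : Fin 0 → Fin n) :
    tensorNormSq G (cotton G) y = contractPairs G (fun z b => cotton G z (b ∘ ![0, 2, 4])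
      * cotton G z (b ∘ ![1, 3, 5])) y a := by
  rw [contractPairs_apply]
  unfold tensorNormSq
  simp only [sum_vecCons, sum_vecEmpty]
  refine Finset.sum_congr rfl fun k _ => ?_
  rw [sum_rotate]
  refine Finset.sum_congr rfl fun k' _ => Finset.sum_congr rfl fun t _ => ?_
  rw [Finset.sum_comm]
  refine Finset.sum_congr rfl fun t' _ => Finset.sum_congr rfl fun i _ =>
    Finset.sum_congr rfl fun i' _ => ?_
  change (∏ s : Fin 3, (G y)⁻¹ (![k, t, i] s) (![k', t', i'] s)) * _ * _ = _
  rw [Fin.prod_univ_three, mul_assoc]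
  congr 3
  · ext s; fin_cases s <;> rfl
  · ext s; fin_cases s <;> rfl

namespace IsPullback
variable {φ : Coord n → Coord n} {U V : Set (Coord n)}
  {G₁ G₂ : Coord n → Matrix (Fin n) (Fin n) ℝ}

lemma cottonTerm (h : IsPullback φ U V G₁ G₂) {u₁ u₂ : Coord n → ℝ}
    (hu : ∀ x ∈ U, u₁ x = u₂ (φ x)) (hd : ∀ y ∈ V, DifferentiableAt ℝ u₂ y) {x : Coord n}
    (hx : x ∈ U) : RicciSoliton.cottonTerm G₁ u₁ x = RicciSoliton.cottonTerm G₂ u₂ (φ x) := by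
  rw [cottonTerm_eq _ _ _ ![], cottonTerm_eq _ _ _ ![]]
  have h1 := h.covDeriv (h.covDeriv h.cotton h.right.smoothOn_cotton)
    (h.right.smoothOn_covDeriv h.right.smoothOn_cotton)
  exact (h.contractPairs (h1.mul (h.differential hu hd) ![0, 2, 4, 5, 3] ![1]
    (by decide))).eval_rank_zero hx _ _

lemma cottonNorm (h : IsPullback φ U V G₁ G₂) {x : Coord n} (hx : x ∈ U) :
    tensorNormSq G₁ (RicciSoliton.cotton G₁) x
      = tensorNormSq G₂ (RicciSoliton.cotton G₂) (φ x) := by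
  rw [cottonNorm_eq _ _ ![], cottonNorm_eq _ _ ![]]
  exact (h.contractPairs (h.cotton.mul h.cotton ![0, 2, 4] ![1, 3, 5]
    (by decide))).eval_rank_zero hx _ _

end IsPullback

end

/-! ### Normal coordinates -/

section

/-- The metric `G` on `U` is Euclidean to first order at the point `x`: its components there are
`δᵢⱼ` and their first partial derivatives vanish. -/
structure IsNormalAt (U : Set (Coord n)) (G : Coord n → Matrix (Fin n) (Fin n) ℝ) (x : Coord n) :
    Prop where
  metric : IsMetricOn U G
  mem : x ∈ U
  eq_one : G x = 1
  pderiv_eq_zero : ∀ l i j, pderiv l (fun z => G z i j) x = 0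

lemma pderiv_coord (i j : Fin n) (x : Coord n) :
    pderiv i (fun z : Coord n => z j) x = if i = j then 1 else 0 := by
  have : (fun z : Coord n => z j) = (EuclideanSpace.proj j : Coord n →L[ℝ] ℝ) := rfl
  unfold pderiv
  rw [this, ContinuousLinearMap.fderiv]
  simp [PiLp.single_apply, eq_comm]

lemma contDiff_coord (j : Fin n) {m : WithTop ℕ∞} : ContDiff ℝ m (fun z : Coord n => z j) :=
  (EuclideanSpace.proj j : Coord n →L[ℝ] ℝ).contDiff

open scoped MatrixOrder in
/-- A positive definite form has an orthonormal basis, given by the columns of `P`. -/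
lemma exists_congr_one {A : Matrix (Fin n) (Fin n) ℝ} (hA : A.PosDef) :
    ∃ P : Matrix (Fin n) (Fin n) ℝ, IsUnit P.det ∧ P.transpose * A * P = 1 := by
  obtain ⟨B, hB⟩ := CStarAlgebra.nonneg_iff_eq_star_mul_self.mp hA.posSemidef.nonneg
  rw [Matrix.star_eq_conjTranspose] at hB
  have hdet : IsUnit B.det := by
    have := hA.det_pos
    rw [hB, Matrix.det_mul] at this
    exact (right_ne_zero_of_mul this.ne').isUnit
  refine ⟨B⁻¹, by simpa using hdet, ?_⟩
  rw [hB, Matrix.conjTranspose_eq_transpose_of_trivial, Matrix.transpose_nonsing_inv,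
    ← Matrix.mul_assoc, Matrix.nonsing_inv_mul _ (by simpa using hdet), Matrix.one_mul,
    Matrix.mul_nonsing_inv _ hdet]

/-- Around every point there are coordinates that are normal to first order. The coordinate change
is the quadratic map `x ↦ y₀ + P x - ½ Γ(P x, P x)`, where the columns of `P` form an orthonormal
basis at `y₀`. -/
lemma IsMetricOn.exists_normal {V : Set (Coord n)} {G : Coord n → Matrix (Fin n) (Fin n) ℝ}
    (hG : IsMetricOn V G) {y₀ : Coord n} (hy₀ : y₀ ∈ V) :
    ∃ (φ : Coord n → Coord n) (U : Set (Coord n)) (G₁ : Coord n → Matrix (Fin n) (Fin n) ℝ),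
      IsPullback φ U V G₁ G ∧ IsNormalAt U G₁ 0 ∧ φ 0 = y₀ := by
  obtain ⟨P, hPu, hP⟩ := exists_congr_one (hG.posDef y₀ hy₀)
  set Q : Fin n → Fin n → Fin n → ℝ := fun a i j =>
    ∑ b, ∑ c, christoffel G y₀ a b c * P b i * P c j with hQ
  have hQs : ∀ a i j, Q a i j = Q a j i := by
    intro a i j
    simp only [hQ]
    rw [Finset.sum_comm]
    refine Finset.sum_congr rfl fun c _ => Finset.sum_congr rfl fun b _ => ?_
    rw [christoffel_symm hG hy₀]
    ring
  set φ : Coord n → Coord n := fun x => WithLp.toLp 2 fun a =>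
    y₀ a + ∑ i, P a i * x i - 1 / 2 * ∑ i, ∑ j, Q a i j * (x i * x j) with hφ
  have hφs : ContDiff ℝ ∞ φ := by
    rw [contDiff_euclidean]
    intro a
    exact (contDiff_const.add (ContDiff.sum fun i _ => contDiff_const.mul (contDiff_coord i))).sub
      (contDiff_const.mul (ContDiff.sum fun i _ => ContDiff.sum fun j _ =>
        contDiff_const.mul ((contDiff_coord i).mul (contDiff_coord j))))
  have hcd : ∀ (i : Fin n) (x : Coord n), DifferentiableAt ℝ (fun z : Coord n => z i) x :=
    fun i x => (contDiff_coord i (m := 1)).differentiable (by simp) x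
  have hjac : ∀ x a k, jac φ x a k = P a k - ∑ j, Q a k j * x j := by
    intro x a k
    have e0 : (fun z => φ z a)
        = fun z : Coord n => y₀ a + ∑ i, P a i * z i - 1 / 2 * ∑ i, ∑ j, Q a i j * (z i * z j) :=
      rfl
    have d1 : ∀ i, DifferentiableAt ℝ (fun z : Coord n => P a i * z i) x := fun i =>
      (differentiableAt_const _).fun_mul (hcd i x)
    have d2 : ∀ i j, DifferentiableAt ℝ (fun z : Coord n => Q a i j * (z i * z j)) x := fun i j =>
      (differentiableAt_const _).fun_mul ((hcd i x).fun_mul (hcd j x))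
    have d3 : ∀ i, DifferentiableAt ℝ (fun z : Coord n => ∑ j, Q a i j * (z i * z j)) x := fun i =>
      DifferentiableAt.fun_sum fun j _ => d2 i j
    rw [jac_apply, e0, pderiv_sub ((differentiableAt_const _).fun_add
        (DifferentiableAt.fun_sum fun i _ => d1 i))
        ((differentiableAt_const _).fun_mul (DifferentiableAt.fun_sum fun i _ => d3 i)),
      pderiv_add (differentiableAt_const _) (DifferentiableAt.fun_sum fun i _ => d1 i),
      pderiv_const_mul _ (DifferentiableAt.fun_sum fun i _ => d3 i),
      pderiv_sum fun i _ => d1 i, pderiv_sum fun i _ => d3 i]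
    have e1 : ∀ i, pderiv k (fun z : Coord n => P a i * z i) x
        = if k = i then P a i else 0 := by
      intro i; rw [pderiv_const_mul _ (hcd i x), pderiv_coord]; simp
    have e2 : ∀ i, pderiv k (fun z : Coord n => ∑ j, Q a i j * (z i * z j)) x
        = (if k = i then ∑ j, Q a i j * x j else 0) + Q a i k * x i := by
      intro i
      rw [pderiv_sum fun j _ => d2 i j]
      have : ∀ j, pderiv k (fun z : Coord n => Q a i j * (z i * z j)) x
          = (if k = i then Q a i j * x j else 0) + if k = j then Q a i j * x i else 0 := by
        intro j
        rw [pderiv_const_mul _ ((hcd i x).fun_mul (hcd j x)), pderiv_mul (hcd i x) (hcd j x),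
          pderiv_coord, pderiv_coord]
        split_ifs <;> ring
      simp only [this, Finset.sum_add_distrib]
      congr 1
      · split_ifs <;> simp
      · simp
    simp only [e1, e2, Finset.sum_add_distrib, pderiv_const]
    have e3 : ∑ i, Q a i k * x i = ∑ j, Q a k j * x j :=
      Finset.sum_congr rfl fun i _ => by rw [hQs]
    simp only [e3, Finset.sum_ite_eq, Finset.mem_univ, if_true]
    ring
  have hφ0 : φ 0 = y₀ := by
    ext a
    simp [hφ]
  have hJ0 : jac φ 0 = P := by
    ext a k
    simp [hjac]
  have hjs : ∀ a i, ContDiff ℝ ∞ (fun x => jac φ x a i) := by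
    intro a i
    simp only [hjac]
    exact contDiff_const.sub (ContDiff.sum fun j _ => contDiff_const.mul (contDiff_coord j))
  -- `φ` need not be injective on `U`: the transformation laws only use that it is a local
  -- diffeomorphism
  set U : Set (Coord n) := φ ⁻¹' V ∩ {x | (jac φ x).det ≠ 0} with hU
  have hUo : IsOpen U := by
    refine (hG.isOpen.preimage hφs.continuous).inter ?_
    have : ContDiffOn ℝ ∞ (fun x => (jac φ x).det) Set.univ :=
      contDiffOn_det fun i j => (hjs i j).contDiffOn
    exact isOpen_ne_fun (contDiffOn_univ.mp this).continuous continuous_const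
  set G₁ : Coord n → Matrix (Fin n) (Fin n) ℝ := fun x =>
    (jac φ x).transpose * G (φ x) * jac φ x with hG₁
  have hmaps : Set.MapsTo φ U V := fun x hx => hx.1
  have hmet : IsMetricOn U G₁ := by
    refine ⟨hUo, fun i j => ?_, fun x hx => ?_⟩
    · simp only [hG₁, Matrix.mul_apply, Matrix.transpose_apply]
      exact ContDiffOn.sum fun b _ => (ContDiffOn.sum fun a _ => (hjs a i).contDiffOn.mul
        ((hG.smooth a b).comp hφs.contDiffOn hmaps)).mul (hjs b j).contDiffOn
    · have := (hG.posDef (φ x) hx.1).conjTranspose_mul_mul_same (B := jac φ x)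
        (Matrix.mulVec_injective_of_isUnit
          ((Matrix.isUnit_iff_isUnit_det _).mpr (Ne.isUnit hx.2)))
      rwa [Matrix.conjTranspose_eq_transpose_of_trivial] at this
  have hpull : IsPullback φ U V G₁ G := ⟨hmet, hG, hφs.contDiffOn, hmaps, fun _ _ => rfl⟩
  have h0 : (0 : Coord n) ∈ U := ⟨by simpa [hφ0] using hy₀, by simpa [hJ0] using hPu.ne_zero⟩
  have hone : G₁ 0 = 1 := by simp only [hG₁, hJ0, hφ0, hP]
  -- `P Γ₁ = ∂J + Γ(P, P)` at the centre by the transformation law, and the quadratic term of `φ`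
  -- makes the right hand side vanish
  have hΓ : ∀ k i j, christoffel G₁ 0 k i j = 0 := by
    intro k i j
    have hlaw : ∀ a, ∑ k, P a k * christoffel G₁ 0 k i j = 0 := by
      intro a
      have := hpull.christoffel_law h0 a i j
      rw [hJ0, hφ0] at this
      rw [this]
      have e : pderiv i (fun z => jac φ z a j) 0 = - Q a j i := by
        simp only [hjac]
        have d : ∀ l, DifferentiableAt ℝ (fun z : Coord n => Q a j l * z l) 0 := fun l =>
          (differentiableAt_const _).fun_mul (hcd l 0)
        rw [pderiv_sub (differentiableAt_const _) (DifferentiableAt.fun_sum fun l _ => d l),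
          pderiv_sum fun l _ => d l]
        have : ∀ l, pderiv i (fun z : Coord n => Q a j l * z l) 0
            = if i = l then Q a j l else 0 := by
          intro l; rw [pderiv_const_mul _ (hcd l 0), pderiv_coord]; simp
        simp [this]
      rw [e, hQs]
      simp [hQ]
    have hinj := Matrix.mulVec_injective_of_isUnit ((Matrix.isUnit_iff_isUnit_det P).mpr hPu)
    have : (fun k => christoffel G₁ 0 k i j) = fun _ => 0 := by
      apply hinj
      funext a
      simp only [Matrix.mulVec, dotProduct, mul_zero, Finset.sum_const_zero]
      exact hlaw a
    exact congrFun this k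
  exact ⟨φ, U, G₁, hpull, ⟨hmet, h0, hone, fun l i j => by
    rw [pderiv_metric hmet h0]; simp [hΓ]⟩, hφ0⟩

namespace IsNormalAt
variable {U : Set (Coord n)} {G : Coord n → Matrix (Fin n) (Fin n) ℝ} {x : Coord n}

lemma inv_eq_one (h : IsNormalAt U G x) : (G x)⁻¹ = 1 := by rw [h.eq_one, inv_one]

lemma christoffel_eq_zero (h : IsNormalAt U G x) (k i j : Fin n) : christoffel G x k i j = 0 := by
  simp [christoffel, h.pderiv_eq_zero]

lemma covDeriv_apply (h : IsNormalAt U G x) {r : ℕ} (T : LocalTensor n r)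
    (a : Fin (r + 1) → Fin n) :
    covDeriv G T x a = pderiv (a (Fin.last r)) (fun z => T z fun s => a s.castSucc) x := by
  simp [covDeriv, h.christoffel_eq_zero]

lemma diffAt (h : IsNormalAt U G x) {u : Coord n → ℝ} (hu : ContDiffOn ℝ ∞ u U) :
    DifferentiableAt ℝ u x :=
  diffAt_of_smooth h.metric.isOpen hu h.mem

lemma pderiv_inv (h : IsNormalAt U G x) (l i j : Fin n) :
    pderiv l (fun z => (G z)⁻¹ i j) x = 0 := by
  have h1 : pderiv l (fun z => ∑ k, (G z)⁻¹ i k * G z k j) x = 0 := by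
    rw [pderiv_congr_on h.metric.isOpen (fun z hz => h.metric.inv_mul_sum hz i j) h.mem,
      pderiv_const]
  have d1 : ∀ k, DifferentiableAt ℝ (fun z => (G z)⁻¹ i k) x := fun k =>
    h.diffAt (h.metric.smooth_inv i k)
  have d2 : ∀ k, DifferentiableAt ℝ (fun z => G z k j) x := fun k => h.diffAt (h.metric.smooth k j)
  rw [pderiv_sum fun k _ => (d1 k).fun_mul (d2 k)] at h1
  simpa [pderiv_mul (d1 _) (d2 _), h.pderiv_eq_zero, h.eq_one, Matrix.one_apply] using h1

lemma contract_apply (h : IsNormalAt U G x) {ι κ : Type*} (p : ι → κ ⊕ Fin 2)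
    (t : (ι → Fin n) → ℝ) (a : κ → Fin n) :
    contract p (G x)⁻¹ t a = ∑ l, t (Sum.elim a ![l, l] ∘ p) := by
  simp [contract, h.inv_eq_one, Matrix.one_apply]

/-- At the centre of normal coordinates contractions commute with partial derivatives. -/
lemma pderiv_contract (h : IsNormalAt U G x) {ι κ : Type*} (p : ι → κ ⊕ Fin 2)
    {t : Coord n → (ι → Fin n) → ℝ} (ht : ∀ b, DifferentiableAt ℝ (fun z => t z b) x)
    (a : κ → Fin n) (b : Fin n) :
    pderiv b (fun z => contract p (G z)⁻¹ (t z) a) x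
      = ∑ l, pderiv b (fun z => t z (Sum.elim a ![l, l] ∘ p)) x := by
  have d1 : ∀ i k, DifferentiableAt ℝ (fun z => (G z)⁻¹ i k) x := fun i k =>
    h.diffAt (h.metric.smooth_inv i k)
  have d2 : ∀ l m, DifferentiableAt ℝ
      (fun z => (G z)⁻¹ l m * t z (Sum.elim a ![l, m] ∘ p)) x := fun l m =>
    (d1 l m).fun_mul (ht _)
  unfold contract
  rw [pderiv_sum fun l _ => DifferentiableAt.fun_sum fun m _ => d2 l m]
  refine Finset.sum_congr rfl fun l _ => ?_
  rw [pderiv_sum fun m _ => d2 l m]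
  have : ∀ m, pderiv b (fun z => (G z)⁻¹ l m * t z (Sum.elim a ![l, m] ∘ p)) x
      = if l = m then pderiv b (fun z => t z (Sum.elim a ![l, m] ∘ p)) x else 0 := by
    intro m
    rw [pderiv_mul (d1 l m) (ht _), h.pderiv_inv, h.inv_eq_one]
    simp [Matrix.one_apply]
  simp [this]

lemma diffAt_contract (h : IsNormalAt U G x) {ι κ : Type*} (p : ι → κ ⊕ Fin 2)
    {t : Coord n → (ι → Fin n) → ℝ} (ht : ∀ b, DifferentiableAt ℝ (fun z => t z b) x)
    (a : κ → Fin n) : DifferentiableAt ℝ (fun z => contract p (G z)⁻¹ (t z) a) x :=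
  DifferentiableAt.fun_sum fun _ _ => DifferentiableAt.fun_sum fun _ _ =>
    (h.diffAt (h.metric.smooth_inv _ _)).fun_mul (ht _)

end IsNormalAt

end

/-! ### Derivatives of the curvature at the centre of normal coordinates -/

section

/-- The third partial derivatives `∂_a ∂_b ∂_c g_{ij}` of the metric. -/
def thirdDeriv (G : Coord n → Matrix (Fin n) (Fin n) ℝ) (x : Coord n) (a b c i j : Fin n) : ℝ :=
  pderiv a (pderiv b (pderiv c fun z => G z i j)) x

namespace IsNormalAt
variable {U : Set (Coord n)} {G : Coord n → Matrix (Fin n) (Fin n) ℝ} {x : Coord n}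

lemma smooth₁ (h : IsNormalAt U G x) (c i j : Fin n) :
    ContDiffOn ℝ ∞ (pderiv c fun z => G z i j) U :=
  smooth_pderiv h.metric.isOpen (h.metric.smooth i j) c

lemma thirdDeriv_swap_left (h : IsNormalAt U G x) (a b c i j : Fin n) :
    thirdDeriv G x a b c i j = thirdDeriv G x b a c i j :=
  pderiv_comm (((h.smooth₁ c i j).contDiffAt (h.metric.isOpen.mem_nhds h.mem)).of_le
    ENat.LEInfty.out) a b

lemma thirdDeriv_swap_right (h : IsNormalAt U G x) (a b c i j : Fin n) :
    thirdDeriv G x a b c i j = thirdDeriv G x a c b i j :=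
  pderiv_congr_on h.metric.isOpen (fun _ hz =>
    pderiv_comm (((h.metric.smooth i j).contDiffAt (h.metric.isOpen.mem_nhds hz)).of_le
      ENat.LEInfty.out) b c) h.mem

lemma thirdDeriv_symm (h : IsNormalAt U G x) (a b c i j : Fin n) :
    thirdDeriv G x a b c i j = thirdDeriv G x a b c j i :=
  pderiv_congr_on h.metric.isOpen (fun _ hz => pderiv_congr_on h.metric.isOpen (fun _ hz' =>
    pderiv_congr_on h.metric.isOpen (fun _ hz'' => h.metric.symm hz'' i j) hz') hz) h.mem

/-- The second derivative of a product at a point where the first factor is stationary and the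
second one vanishes. -/
lemma pderiv_pderiv_mul (h : IsNormalAt U G x) {u v : Coord n → ℝ} (hu : ContDiffOn ℝ ∞ u U)
    (hv : ContDiffOn ℝ ∞ v U) (hu0 : ∀ b, pderiv b u x = 0) (hv0 : v x = 0) (a b : Fin n) :
    pderiv a (pderiv b fun z => u z * v z) x = u x * pderiv a (pderiv b v) x := by
  have hU := h.metric.isOpen
  have hu1 := smooth_pderiv hU hu b
  have hv1 := smooth_pderiv hU hv b
  rw [pderiv_congr_on hU (fun z hz => pderiv_mul (diffAt_of_smooth hU hu hz)
      (diffAt_of_smooth hU hv hz)) h.mem,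
    pderiv_add ((h.diffAt hu1).fun_mul (h.diffAt hv)) ((h.diffAt hu).fun_mul (h.diffAt hv1)),
    pderiv_mul (h.diffAt hu1) (h.diffAt hv), pderiv_mul (h.diffAt hu) (h.diffAt hv1),
    hu0, hu0, hv0]
  ring

lemma pderiv_pderiv_christoffel (h : IsNormalAt U G x) (a b l i k : Fin n) :
    pderiv a (pderiv b fun z => christoffel G z l i k) x
      = 1 / 2 * (thirdDeriv G x a b i k l + thirdDeriv G x a b k i l
          - thirdDeriv G x a b l i k) := by
  have hU := h.metric.isOpen
  set F : Fin n → Coord n → ℝ := fun p z => pderiv i (fun z => G z k p) z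
    + pderiv k (fun z => G z i p) z - pderiv p (fun z => G z i k) z with hF
  have hFs : ∀ p, ContDiffOn ℝ ∞ (F p) U := fun p =>
    ((h.smooth₁ i k p).add (h.smooth₁ k i p)).sub (h.smooth₁ p i k)
  have hF0 : ∀ p, F p x = 0 := fun p => by simp [hF, h.pderiv_eq_zero]
  have hI := h.metric.smooth_inv l
  have hm : ∀ p, ContDiffOn ℝ ∞ (fun z => (G z)⁻¹ l p * F p z) U := fun p => (hI p).mul (hFs p)
  have e : (fun z => christoffel G z l i k) = fun z => 1 / 2 * ∑ p, (G z)⁻¹ l p * F p z := rfl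
  have e1 : ∀ z ∈ U, pderiv b (fun z => christoffel G z l i k) z
      = 1 / 2 * ∑ p, pderiv b (fun z => (G z)⁻¹ l p * F p z) z := by
    intro z hz
    rw [e, pderiv_const_mul _ (DifferentiableAt.fun_sum fun p _ => diffAt_of_smooth hU (hm p) hz),
      pderiv_sum fun p _ => diffAt_of_smooth hU (hm p) hz]
  have hms := fun p => h.diffAt (smooth_pderiv hU (hm p) b)
  rw [pderiv_congr_on hU e1 h.mem, pderiv_const_mul _ (DifferentiableAt.fun_sum fun p _ => hms p),
    pderiv_sum fun p _ => hms p]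
  simp only [h.pderiv_pderiv_mul (hI _) (hFs _) (fun b => h.pderiv_inv b l _) (hF0 _),
    h.inv_eq_one, Matrix.one_apply, ite_mul, one_mul, zero_mul, Finset.sum_ite_eq,
    Finset.mem_univ, if_true]
  have e2 : ∀ z ∈ U, pderiv b (F l) z = pderiv b (pderiv i fun z => G z k l) z
      + pderiv b (pderiv k fun z => G z i l) z - pderiv b (pderiv l fun z => G z i k) z := by
    intro z hz
    have d := fun c i j => diffAt_of_smooth hU (h.smooth₁ c i j) hz
    rw [hF, pderiv_sub ((d i k l).fun_add (d k i l)) (d l i k), pderiv_add (d i k l) (d k i l)]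
  have d := fun c i j => h.diffAt (smooth_pderiv hU (h.smooth₁ c i j) b)
  rw [pderiv_congr_on hU e2 h.mem, pderiv_sub ((d i k l).fun_add (d k i l)) (d l i k),
    pderiv_add (d i k l) (d k i l)]
  rfl

/-- The first derivatives of the curvature at the centre are linear in the third derivatives of the
metric: the terms quadratic in the Christoffel symbols vanish to second order there. -/
lemma pderiv_riemann (h : IsNormalAt U G x) (m i j k l : Fin n) :
    pderiv m (fun z => riemann G z ![i, j, k, l]) x
      = 1 / 2 * (thirdDeriv G x m j k i l - thirdDeriv G x m j l i k
          - thirdDeriv G x m i k j l + thirdDeriv G x m i l j k) := by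
  have hU := h.metric.isOpen
  have hΓ := h.metric.smooth_christoffel
  have dΓ := fun p q r => h.diffAt (hΓ p q r)
  have e : (fun z => riemann G z ![i, j, k, l]) = fun z => ∑ p, G z l p * riemannUp G z p i j k :=
    rfl
  have dG := fun p => h.diffAt (h.metric.smooth l p)
  have dR := fun p => h.diffAt (h.metric.smooth_riemannUp p i j k)
  rw [e, pderiv_sum fun p _ => (dG p).fun_mul (dR p)]
  simp only [pderiv_mul (dG _) (dR _), h.pderiv_eq_zero, h.eq_one, Matrix.one_apply, ite_mul,
    one_mul, zero_mul, zero_add, Finset.sum_ite_eq, Finset.mem_univ, if_true]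
  unfold riemannUp
  have d1 := h.diffAt (smooth_pderiv hU (hΓ l i k) j)
  have d2 := h.diffAt (smooth_pderiv hU (hΓ l j k) i)
  have d3 : ∀ q, DifferentiableAt ℝ (fun z => christoffel G z q i k * christoffel G z l j q
      - christoffel G z q j k * christoffel G z l i q) x := fun q =>
    ((dΓ _ _ _).fun_mul (dΓ _ _ _)).fun_sub ((dΓ _ _ _).fun_mul (dΓ _ _ _))
  have e3 : ∀ q, pderiv m (fun z => christoffel G z q i k * christoffel G z l j q
      - christoffel G z q j k * christoffel G z l i q) x = 0 := by
    intro q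
    rw [pderiv_sub ((dΓ _ _ _).fun_mul (dΓ _ _ _)) ((dΓ _ _ _).fun_mul (dΓ _ _ _)),
      pderiv_mul (dΓ _ _ _) (dΓ _ _ _), pderiv_mul (dΓ _ _ _) (dΓ _ _ _)]
    simp [h.christoffel_eq_zero]
  rw [pderiv_add (d1.fun_sub d2) (DifferentiableAt.fun_sum fun q _ => d3 q), pderiv_sub d1 d2,
    pderiv_sum fun q _ => d3 q]
  simp only [e3, Finset.sum_const_zero, add_zero]
  change pderiv m (pderiv j fun z => christoffel G z l i k) x
    - pderiv m (pderiv i fun z => christoffel G z l j k) x = _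
  rw [h.pderiv_pderiv_christoffel, h.pderiv_pderiv_christoffel, h.thirdDeriv_swap_right m i j]
  ring

lemma pderiv_ricci (h : IsNormalAt U G x) (m i k : Fin n) :
    pderiv m (fun z => ricci G z ![i, k]) x
      = ∑ j, pderiv m (fun z => riemann G z ![i, j, k, j]) x := by
  simp only [ricci_eq_contract]
  rw [h.pderiv_contract _ fun b => h.diffAt (h.metric.smoothOn_riemann b)]
  refine Finset.sum_congr rfl fun j _ => ?_
  congr 2

lemma pderiv_scalarCurvature (h : IsNormalAt U G x) (m : Fin n) :
    pderiv m (scalarCurvature G) x = ∑ i, pderiv m (fun z => ricci G z ![i, i]) x := by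
  have e : scalarCurvature G = fun z => contract ![Sum.inr 0, Sum.inr 1] (G z)⁻¹ (ricci G z) ![] :=
    funext fun z => scalarCurvature_eq_contract G z ![]
  rw [e, h.pderiv_contract _ fun b => h.diffAt (h.metric.smoothOn_ricci b)]
  refine Finset.sum_congr rfl fun j _ => ?_
  congr 2

/-- The contracted second Bianchi identity. -/
lemma contracted_bianchi (h : IsNormalAt U G x) (k : Fin n) :
    ∑ i, pderiv i (fun z => ricci G z ![i, k]) x = 1 / 2 * pderiv k (scalarCurvature G) x := by
  simp only [h.pderiv_scalarCurvature, h.pderiv_ricci, h.pderiv_riemann, ← Finset.mul_sum,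
    Finset.sum_add_distrib, Finset.sum_sub_distrib]
  -- both sides are combinations of full contractions of the third derivatives; the symmetries of
  -- the latter identify them
  have e1 : ∑ i, ∑ j, thirdDeriv G x i i j j k = ∑ i, ∑ j, thirdDeriv G x i j j i k := by
    rw [Finset.sum_comm]
    refine Finset.sum_congr rfl fun i _ => Finset.sum_congr rfl fun j _ => ?_
    rw [h.thirdDeriv_swap_right, h.thirdDeriv_swap_left]
  have e2 : ∑ i, ∑ j, thirdDeriv G x k j j i i = ∑ i, ∑ j, thirdDeriv G x i i k j j := by
    rw [Finset.sum_comm]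
    refine Finset.sum_congr rfl fun i _ => Finset.sum_congr rfl fun j _ => ?_
    rw [h.thirdDeriv_swap_left, h.thirdDeriv_swap_right]
  have e3 : ∑ i, ∑ j, thirdDeriv G x k i i j j = ∑ i, ∑ j, thirdDeriv G x i i k j j :=
    Finset.sum_congr rfl fun i _ => Finset.sum_congr rfl fun j _ => by
      rw [h.thirdDeriv_swap_left, h.thirdDeriv_swap_right]
  have e4 : ∑ i, ∑ j, thirdDeriv G x k j i i j = ∑ i, ∑ j, thirdDeriv G x i j k i j :=
    Finset.sum_congr rfl fun i _ => Finset.sum_congr rfl fun j _ => by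
      rw [h.thirdDeriv_swap_left, h.thirdDeriv_swap_right, h.thirdDeriv_swap_left]
  have e5 : ∑ i, ∑ j, thirdDeriv G x k i j j i = ∑ i, ∑ j, thirdDeriv G x i j k i j :=
    Finset.sum_congr rfl fun i _ => Finset.sum_congr rfl fun j _ => by
      rw [h.thirdDeriv_swap_left, h.thirdDeriv_swap_right, h.thirdDeriv_symm]
  rw [e1, e2, e3, e4, e5]
  ring

/-- The divergence of the Riemann tensor, contracted from the second Bianchi identity. -/
lemma div_riemann (h : IsNormalAt U G x) (k t i : Fin n) :
    ∑ l, pderiv l (fun z => riemann G z ![l, k, t, i]) x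
      = pderiv t (fun z => ricci G z ![k, i]) x - pderiv i (fun z => ricci G z ![k, t]) x := by
  simp only [h.pderiv_ricci, h.pderiv_riemann]
  rw [← Finset.sum_sub_distrib]
  refine Finset.sum_congr rfl fun l _ => ?_
  have e1 : thirdDeriv G x t l i k l = thirdDeriv G x i l t k l := by
    rw [h.thirdDeriv_swap_right, h.thirdDeriv_swap_left, h.thirdDeriv_swap_right]
  have e2 : thirdDeriv G x t k i l l = thirdDeriv G x i k t l l := by
    rw [h.thirdDeriv_swap_right, h.thirdDeriv_swap_left, h.thirdDeriv_swap_right]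
  have e3 : thirdDeriv G x l k t l i = thirdDeriv G x t k l l i := by
    rw [h.thirdDeriv_swap_right, h.thirdDeriv_swap_left, h.thirdDeriv_swap_right]
  have e4 : thirdDeriv G x l k i l t = thirdDeriv G x i k l l t := by
    rw [h.thirdDeriv_swap_right, h.thirdDeriv_swap_left, h.thirdDeriv_swap_right]
  have e5 : thirdDeriv G x l l t k i = thirdDeriv G x t l l k i := by
    rw [h.thirdDeriv_swap_right, h.thirdDeriv_swap_left]
  have e6 : thirdDeriv G x l l i k t = thirdDeriv G x i l l k t := by
    rw [h.thirdDeriv_swap_right, h.thirdDeriv_swap_left]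
  rw [e1, e2, e3, e4, e5, e6]
  ring

lemma cotton_apply (h : IsNormalAt U G x) (i j k : Fin n) :
    cotton G x ![i, j, k] = pderiv k (fun z => ricci G z ![i, j]) x
      - pderiv j (fun z => ricci G z ![i, k]) x
      - 1 / (2 * ((n : ℝ) - 1)) * (pderiv k (scalarCurvature G) x * (1 : Matrix _ _ ℝ) i j
        - pderiv j (scalarCurvature G) x * (1 : Matrix _ _ ℝ) i k) := by
  have e : ∀ j k : Fin n, covDeriv G (ricci G) x ![i, j, k]
      = pderiv k (fun z => ricci G z ![i, j]) x := by
    intro j k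
    rw [covDeriv_rank_two]
    simp [h.christoffel_eq_zero]
  change covDeriv G (ricci G) x ![i, j, k] - covDeriv G (ricci G) x ![i, k, j]
    - 1 / (2 * ((n : ℝ) - 1)) * (pderiv k (scalarCurvature G) x * G x i j
        - pderiv j (scalarCurvature G) x * G x i k) = _
  rw [e, e, h.eq_one]

/-- The Cotton tensor is trace free. -/
lemma trace_cotton (h : IsNormalAt U G x) (hn : 3 ≤ n) (i : Fin n) :
    ∑ k, cotton G x ![k, k, i] = 0 := by
  have hn' : (n : ℝ) - 1 ≠ 0 := by
    have : (3 : ℝ) ≤ n := by exact_mod_cast hn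
    linarith
  have hb := h.contracted_bianchi i
  have hs := h.pderiv_scalarCurvature i
  simp only [h.cotton_apply, Finset.sum_sub_distrib, ← Finset.mul_sum]
  rw [hb, ← hs]
  simp only [Matrix.one_apply, if_true, mul_one, mul_ite, mul_zero, Finset.sum_const,
    Finset.card_univ, Fintype.card_fin, nsmul_eq_mul, Finset.sum_ite_eq', Finset.mem_univ]
  field_simp
  ring

lemma pderiv_weyl (h : IsNormalAt U G x) (m i j k l : Fin n) :
    pderiv m (fun z => weyl G z ![i, j, k, l]) x
      = pderiv m (fun z => riemann G z ![i, j, k, l]) x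
        - 1 / ((n : ℝ) - 2) * (
            pderiv m (fun z => ricci G z ![i, k]) x * (1 : Matrix _ _ ℝ) j l
          - pderiv m (fun z => ricci G z ![i, l]) x * (1 : Matrix _ _ ℝ) j k
          + pderiv m (fun z => ricci G z ![j, l]) x * (1 : Matrix _ _ ℝ) i k
          - pderiv m (fun z => ricci G z ![j, k]) x * (1 : Matrix _ _ ℝ) i l)
        + 1 / (((n : ℝ) - 1) * ((n : ℝ) - 2)) * (pderiv m (scalarCurvature G) x
          * ((1 : Matrix _ _ ℝ) i k * (1 : Matrix _ _ ℝ) j l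
            - (1 : Matrix _ _ ℝ) i l * (1 : Matrix _ _ ℝ) j k)) := by
  have e : (fun z => weyl G z ![i, j, k, l]) = fun z => riemann G z ![i, j, k, l]
      - 1 / ((n : ℝ) - 2) * (ricci G z ![i, k] * G z j l - ricci G z ![i, l] * G z j k
          + ricci G z ![j, l] * G z i k - ricci G z ![j, k] * G z i l)
      + scalarCurvature G z / (((n : ℝ) - 1) * ((n : ℝ) - 2))
          * (G z i k * G z j l - G z i l * G z j k) := rfl
  have e' : (fun z => weyl G z ![i, j, k, l]) = fun z => riemann G z ![i, j, k, l]
      - 1 / ((n : ℝ) - 2) * (ricci G z ![i, k] * G z j l - ricci G z ![i, l] * G z j k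
          + ricci G z ![j, l] * G z i k - ricci G z ![j, k] * G z i l)
      + 1 / (((n : ℝ) - 1) * ((n : ℝ) - 2)) * (scalarCurvature G z
          * (G z i k * G z j l - G z i l * G z j k)) := by
    rw [e]; funext z; ring
  have dR := h.diffAt (h.metric.smoothOn_riemann ![i, j, k, l])
  have dS := h.diffAt h.metric.smooth_scalarCurvature
  have dr := fun a b => h.diffAt (h.metric.smoothOn_ricci ![a, b])
  have dg := fun a b => h.diffAt (h.metric.smooth a b)
  have drg := fun a b c d => (dr a b).fun_mul (dg c d)
  have dgg := fun a b c d => (dg a b).fun_mul (dg c d)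
  have d2 := (((drg i k j l).fun_sub (drg i l j k)).fun_add (drg j l i k)).fun_sub (drg j k i l)
  have d3 := dS.fun_mul ((dgg i k j l).fun_sub (dgg i l j k))
  rw [e', pderiv_add (dR.fun_sub ((differentiableAt_const _).fun_mul d2))
      ((differentiableAt_const _).fun_mul d3),
    pderiv_sub dR ((differentiableAt_const _).fun_mul d2), pderiv_const_mul _ d2,
    pderiv_const_mul _ d3,
    pderiv_sub (((drg i k j l).fun_sub (drg i l j k)).fun_add (drg j l i k)) (drg j k i l),
    pderiv_add ((drg i k j l).fun_sub (drg i l j k)) (drg j l i k),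
    pderiv_sub (drg i k j l) (drg i l j k),
    pderiv_mul dS ((dgg i k j l).fun_sub (dgg i l j k)),
    pderiv_sub (dgg i k j l) (dgg i l j k)]
  simp only [pderiv_mul (dr _ _) (dg _ _), pderiv_mul (dg _ _) (dg _ _), h.pderiv_eq_zero, h.eq_one]
  ring

/-- The divergence of the Weyl tensor at the centre of normal coordinates: the divergence of the
Riemann tensor is the antisymmetrized derivative of the Ricci tensor, and the remaining terms are
evaluated with the contracted Bianchi identity. -/
lemma divWeyl_apply (h : IsNormalAt U G x) (hn : 3 ≤ n) (k t i : Fin n) :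
    divWeyl G x ![k, t, i] = -(((n : ℝ) - 3) / ((n : ℝ) - 2)) * cotton G x ![k, t, i] := by
  have hn3 : (3 : ℝ) ≤ n := by exact_mod_cast hn
  have hn1 : (n : ℝ) - 1 ≠ 0 := by linarith
  have hn2 : (n : ℝ) - 2 ≠ 0 := by linarith
  have e : divWeyl G x ![k, t, i] = ∑ l, pderiv l (fun z => weyl G z ![l, k, t, i]) x := by
    unfold divWeyl
    rw [h.contract_apply]
    refine Finset.sum_congr rfl fun l _ => ?_
    rw [h.covDeriv_apply]
    congr 2
  have hb := fun j => h.contracted_bianchi j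
  have hd := h.div_riemann k t i
  have hδ : ∀ (F : Fin n → ℝ) (m : Fin n), ∑ l, F l * (1 : Matrix _ _ ℝ) l m = F m := fun F m => by
    simp [Matrix.one_apply]
  have hδ₂ : ∀ (F : Fin n → ℝ) (m : Fin n) (c : ℝ), ∑ l, F l * ((1 : Matrix _ _ ℝ) l m * c)
      = F m * c := fun F m c => by
    simp only [← mul_assoc, ← Finset.sum_mul, hδ]
  rw [e, h.cotton_apply]
  simp only [h.pderiv_weyl, Finset.sum_add_distrib, Finset.sum_sub_distrib, ← Finset.mul_sum,
    ← Finset.sum_mul, hb, hd, mul_sub (pderiv _ _ _), hδ, hδ₂]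
  field_simp
  ring

end IsNormalAt

end

/-! ### Transfer from normal coordinates -/

section

namespace IsPullback
variable {φ : Coord n → Coord n} {U V : Set (Coord n)}
  {G₁ G₂ : Coord n → Matrix (Fin n) (Fin n) ℝ}

/-- A natural tensor identity that holds at `x` in one coordinate system holds at `φ x` in the
other. -/
lemma eq_of_eq (h : IsPullback φ U V G₁ G₂) {r : ℕ} {T₁ T₂ S₁ S₂ : LocalTensor n r}
    (hT : Pulls φ U T₁ T₂) (hS : Pulls φ U S₁ S₂) {x : Coord n} (hx : x ∈ U)
    (heq : T₁ x = S₁ x) : T₂ (φ x) = S₂ (φ x) := by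
  have hinv : ∀ t : (Fin r → Fin n) → ℝ, pullM (jac φ x)⁻¹ (pullM (jac φ x) t) = t := fun t => by
    rw [pullM_pullM, Matrix.mul_nonsing_inv _ (h.isUnit_det hx), pullM_one]
  rw [← hinv (T₂ (φ x)), ← hinv (S₂ (φ x)), ← hT x hx, ← hS x hx, heq]

lemma smoothOn_pullM (h : IsPullback φ U V G₁ G₂) {r : ℕ} {T : LocalTensor n r}
    (hT : SmoothOn V T) : SmoothOn U fun x => pullM (jac φ x) (T (φ x)) := fun _ =>
  ContDiffOn.sum fun b _ => (contDiffOn_prod fun _ _ => h.smooth_jac _ _).mul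
    ((hT b).comp h.smooth h.mapsTo)

end IsPullback

/-- Covariant differentiation commutes with contractions. The map `q` extends `p` by the slot of the
derivative, which is kept as the last one. In normal coordinates the claim is clear, because the
derivatives of the inverse metric vanish at the centre. -/
lemma covDeriv_contract {V : Set (Coord n)} {G : Coord n → Matrix (Fin n) (Fin n) ℝ}
    (hG : IsMetricOn V G) {r s : ℕ} {T : LocalTensor n r} (hT : SmoothOn V T)
    (p : Fin r → Fin s ⊕ Fin 2) (hp : Function.Bijective p)
    (q : Fin (r + 1) → Fin (s + 1) ⊕ Fin 2) (hq : Function.Bijective q)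
    (hpq : ∀ i, q i.castSucc = Sum.map Fin.castSucc id (p i))
    (hl : q (Fin.last r) = Sum.inl (Fin.last s))
    {y : Coord n} (hy : y ∈ V) :
    covDeriv G (fun z => contract p (G z)⁻¹ (T z)) y = contract q (G y)⁻¹ (covDeriv G T y) := by
  obtain ⟨φ, U, G₁, h, hN, rfl⟩ := hG.exists_normal hy
  have hT₁ := h.smoothOn_pullM hT
  have hP : Pulls φ U (fun x => pullM (jac φ x) (T (φ x))) T := fun _ _ => rfl
  refine h.eq_of_eq (h.covDeriv (hP.contract h p hp) (hG.smoothOn_contract hT p))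
    ((h.covDeriv hP hT).contract h q hq) hN.mem ?_
  funext a
  rw [hN.covDeriv_apply, hN.pderiv_contract _ fun b => hN.diffAt (hT₁ b), hN.contract_apply]
  refine Finset.sum_congr rfl fun l _ => ?_
  rw [hN.covDeriv_apply]
  simp only [Function.comp_apply, hl, Sum.elim_inl]
  congr 2
  funext z
  congr 1
  funext i
  simp only [Function.comp_apply, hpq]
  rcases p i with j | j <;> rfl

/-- The divergence of the Weyl tensor is a multiple of the Cotton tensor. -/
lemma divWeyl_eq {V : Set (Coord n)} {G : Coord n → Matrix (Fin n) (Fin n) ℝ}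
    (hG : IsMetricOn V G) (hn : 3 ≤ n) {y : Coord n} (hy : y ∈ V) (a : Fin 3 → Fin n) :
    divWeyl G y a = -(((n : ℝ) - 3) / ((n : ℝ) - 2)) * cotton G y a := by
  obtain ⟨φ, U, G₁, h, hN, rfl⟩ := hG.exists_normal hy
  refine congrFun (h.eq_of_eq h.divWeyl (h.cotton.const_mul (-(((n : ℝ) - 3) / ((n : ℝ) - 2))))
    hN.mem ?_) a
  funext a
  have := hN.divWeyl_apply hn (a 0) (a 1) (a 2)
  rwa [show ![a 0, a 1, a 2] = a by ext s; fin_cases s <;> rfl] at this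

lemma covDeriv_congr_on {r : ℕ} {V : Set (Coord n)} (hV : IsOpen V)
    (G : Coord n → Matrix (Fin n) (Fin n) ℝ) {T S : LocalTensor n r} (h : ∀ y ∈ V, T y = S y)
    {y : Coord n} (hy : y ∈ V) : covDeriv G T y = covDeriv G S y := by
  funext a
  unfold covDeriv
  simp only [h y hy]
  congr 1
  exact pderiv_congr_on hV (fun z hz => by rw [h z hz]) hy

lemma covDeriv_const_mul {r : ℕ} (G : Coord n → Matrix (Fin n) (Fin n) ℝ) {T : LocalTensor n r}
    (c : ℝ) {y : Coord n} (hT : ∀ a, DifferentiableAt ℝ (fun z => T z a) y) :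
    covDeriv G (fun z a => c * T z a) y = fun a => c * covDeriv G T y a := by
  funext a
  unfold covDeriv
  simp only [pderiv_const_mul c (hT _), mul_sub, Finset.mul_sum]
  congr 1
  exact Finset.sum_congr rfl fun _ _ => Finset.sum_congr rfl fun _ _ => by ring

/-- Since covariant differentiation commutes with contraction, `∇_t ∇_i ∇_l W_{lkti}` is
`∇_t ∇_i` of the divergence of the Weyl tensor, a multiple of the Cotton tensor. -/
lemma weylTerm_eq {V : Set (Coord n)} {G : Coord n → Matrix (Fin n) (Fin n) ℝ}
    (hG : IsMetricOn V G) (hn : 3 ≤ n) (u : Coord n → ℝ) {y : Coord n} (hy : y ∈ V) :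
    weylTerm G u y = -(((n : ℝ) - 3) / ((n : ℝ) - 2)) * cottonTerm G u y := by
  set c : ℝ := -(((n : ℝ) - 3) / ((n : ℝ) - 2)) with hc
  have hW := hG.smoothOn_weyl
  have hW1 := hG.smoothOn_covDeriv hW
  have hW2 := hG.smoothOn_covDeriv hW1
  have hC := hG.smoothOn_cotton
  have hC1 := hG.smoothOn_covDeriv hC
  -- `∇_i` of the divergence of the Weyl tensor
  have h1 : ∀ z ∈ V, contract ![Sum.inr 0, Sum.inl 0, Sum.inl 1, Sum.inl 2, Sum.inr 1, Sum.inl 3]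
      (G z)⁻¹ (covDeriv G (covDeriv G (weyl G)) z) = fun a => c * covDeriv G (cotton G) z a := by
    intro z hz
    rw [← covDeriv_contract (s := 3) hG hW1
        (p := ![Sum.inr 0, Sum.inl 0, Sum.inl 1, Sum.inl 2, Sum.inr 1]) (by decide)
        (q := ![Sum.inr 0, Sum.inl 0, Sum.inl 1, Sum.inl 2, Sum.inr 1, Sum.inl 3])
        (by decide) (by decide) rfl hz,
      ← covDeriv_const_mul G c fun a => hG.diffAt_tensor hC hz a]
    exact covDeriv_congr_on hG.isOpen G (fun z hz => funext (divWeyl_eq hG hn hz)) hz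
  -- `∇_t ∇_i` of the divergence of the Weyl tensor
  have h2 : contract
      ![Sum.inr 0, Sum.inl 0, Sum.inl 1, Sum.inl 2, Sum.inr 1, Sum.inl 3, Sum.inl 4]
      (G y)⁻¹ (covDeriv G (covDeriv G (covDeriv G (weyl G))) y)
      = fun a => c * covDeriv G (covDeriv G (cotton G)) y a := by
    rw [← covDeriv_contract (s := 4) hG hW2
        (p := ![Sum.inr 0, Sum.inl 0, Sum.inl 1, Sum.inl 2, Sum.inr 1, Sum.inl 3]) (by decide)
        (q := ![Sum.inr 0, Sum.inl 0, Sum.inl 1, Sum.inl 2, Sum.inr 1, Sum.inl 3, Sum.inl 4])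
        (by decide) (by decide) rfl hy,
      ← covDeriv_const_mul G c fun a => hG.diffAt_tensor hC1 hy a]
    exact covDeriv_congr_on hG.isOpen G h1 hy
  have h3 : ∀ k t i i' t' : Fin n, ∑ l, ∑ l', (G y)⁻¹ l l'
      * covDeriv G (covDeriv G (covDeriv G (weyl G))) y ![l, k, t, i, l', i', t']
      = c * covDeriv G (covDeriv G (cotton G)) y ![k, t, i, i', t'] := by
    intro k t i i' t'
    rw [← congrFun h2 ![k, t, i, i', t']]
    unfold contract
    refine Finset.sum_congr rfl fun l _ => Finset.sum_congr rfl fun l' _ => ?_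
    congr 2
    ext s; fin_cases s <;> rfl
  have h4 : weylTerm G u y = ∑ k, ∑ k', ∑ t, ∑ t', ∑ i, ∑ i', ∑ l, ∑ l', (G y)⁻¹ l l' * (G y)⁻¹ k k'
      * (G y)⁻¹ t t' * (G y)⁻¹ i i'
      * covDeriv G (covDeriv G (covDeriv G (weyl G))) y ![l, k, t, i, l', i', t']
      * pderiv k' u y := by
    unfold weylTerm
    rw [sum_rotate]
    refine Finset.sum_congr rfl fun k _ => ?_
    rw [sum_rotate]
    refine Finset.sum_congr rfl fun k' _ => ?_
    rw [sum_rotate]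
    refine Finset.sum_congr rfl fun t _ => ?_
    rw [sum_rotate]
    refine Finset.sum_congr rfl fun t' _ => ?_
    rw [sum_rotate]
    refine Finset.sum_congr rfl fun i _ => ?_
    rw [sum_rotate]
  rw [h4]
  unfold cottonTerm
  simp only [Finset.mul_sum]
  refine Finset.sum_congr rfl fun k _ => Finset.sum_congr rfl fun k' _ =>
    Finset.sum_congr rfl fun t _ => Finset.sum_congr rfl fun t' _ =>
    Finset.sum_congr rfl fun i _ => Finset.sum_congr rfl fun i' _ => ?_
  have h5 := h3 k t i i' t'
  calc _ = (G y)⁻¹ k k' * (G y)⁻¹ t t' * (G y)⁻¹ i i' * (∑ l, ∑ l', (G y)⁻¹ l l'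
      * covDeriv G (covDeriv G (covDeriv G (weyl G))) y ![l, k, t, i, l', i', t'])
      * pderiv k' u y := by
        simp only [Finset.mul_sum, Finset.sum_mul]
        exact Finset.sum_congr rfl fun l _ => Finset.sum_congr rfl fun l' _ => by ring
    _ = _ := by rw [h5]; ring

/-! ### The flux one-form -/

/-- The soliton equation `Ric + ∇²u = c g` on `V`. -/
def IsSolitonOn (V : Set (Coord n)) (G : Coord n → Matrix (Fin n) (Fin n) ℝ) (u : Coord n → ℝ)
    (c : ℝ) : Prop :=
  ∀ y ∈ V, ∀ a : Fin 2 → Fin n,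
    ricci G y a + covDeriv G (differential u) y a = c * metricTensor G y a

/-- The five-tensor `w C_{kti,i'} u_{k'} - C_{kit} (w u_{k'i'} + u_{k'} w_{i'})` with slots
`t, k, k', i, i'`. -/
def fluxDensity (G : Coord n → Matrix (Fin n) (Fin n) ℝ) (u w : Coord n → ℝ) : LocalTensor n 5 :=
  fun y a => w y * (covDeriv G (cotton G) y (a ∘ ![1, 0, 3, 4]) * differential u y (a ∘ ![2]))
    - (w y * (cotton G y (a ∘ ![1, 3, 0]) * covDeriv G (differential u) y (a ∘ ![2, 4]))
      + cotton G y (a ∘ ![1, 3, 0])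
        * (differential u y ((a ∘ ![2, 4]) ∘ ![0]) * differential w y ((a ∘ ![2, 4]) ∘ ![1])))

/-- The one-form `Z_t = w C_{kti,i} u_k - C_{kit} (w u_{ki} + u_k w_i)`, whose divergence is
`(C_{kti,it} u_k + ½ |C|²) w` on a gradient Ricci soliton. -/
def flux (G : Coord n → Matrix (Fin n) (Fin n) ℝ) (u w : Coord n → ℝ) : LocalTensor n 1 := fun y =>
  contract ![Sum.inl 0, Sum.inr 0, Sum.inr 1] (G y)⁻¹
    (contract (κ := Fin 3) ![Sum.inl 0, Sum.inl 1, Sum.inl 2, Sum.inr 0, Sum.inr 1] (G y)⁻¹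
      (fluxDensity G u w y))

/-- The divergence `g^{ts} Z_{t,s}` of a one-form. -/
def divergence (G : Coord n → Matrix (Fin n) (Fin n) ℝ) (Z : LocalTensor n 1) (y : Coord n) : ℝ :=
  contract (κ := Fin 0) ![Sum.inr 0, Sum.inr 1] (G y)⁻¹ (covDeriv G Z y) ![]

lemma IsMetricOn.smoothOn_differential {V : Set (Coord n)}
    {G : Coord n → Matrix (Fin n) (Fin n) ℝ} (hG : IsMetricOn V G) {u : Coord n → ℝ}
    (hu : ContDiffOn ℝ ∞ u V) : SmoothOn V (differential u) := fun _ =>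
  smooth_pderiv hG.isOpen hu _

lemma contDiffOn_fluxDensity {V : Set (Coord n)} {G : Coord n → Matrix (Fin n) (Fin n) ℝ}
    (hG : IsMetricOn V G) {u w : Coord n → ℝ} (hu : ContDiffOn ℝ ∞ u V) (hw : ContDiffOn ℝ 2 w V)
    (a : Fin 5 → Fin n) : ContDiffOn ℝ 1 (fun y => fluxDensity G u w y a) V := by
  have hle : (1 : WithTop ℕ∞) ≤ ∞ := ENat.LEInfty.out
  have hC := fun a => (hG.smoothOn_cotton a).of_le hle
  have hC1 := fun a => (hG.smoothOn_covDeriv hG.smoothOn_cotton a).of_le hle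
  have hu1 := fun a => (hG.smoothOn_differential hu a).of_le hle
  have hu2 := fun a => (hG.smoothOn_covDeriv (hG.smoothOn_differential hu) a).of_le hle
  have hw0 : ContDiffOn ℝ 1 w V := hw.of_le (by norm_num)
  have hw1 : ∀ a, ContDiffOn ℝ 1 (fun y => differential w y a) V := fun a =>
    contDiffOn_pderiv hG.isOpen hw (by norm_num) _
  exact (hw0.mul ((hC1 _).mul (hu1 _))).sub ((hw0.mul ((hC _).mul (hu2 _))).add
    ((hC _).mul ((hu1 _).mul (hw1 _))))

lemma contDiffOn_flux {V : Set (Coord n)} {G : Coord n → Matrix (Fin n) (Fin n) ℝ}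
    (hG : IsMetricOn V G) {u w : Coord n → ℝ} (hu : ContDiffOn ℝ ∞ u V) (hw : ContDiffOn ℝ 2 w V)
    (a : Fin 1 → Fin n) : ContDiffOn ℝ 1 (fun y => flux G u w y a) V := by
  have hc : ∀ {r s : ℕ} {T : LocalTensor n r} (p : Fin r → Fin s ⊕ Fin 2),
      (∀ a, ContDiffOn ℝ 1 (fun y => T y a) V) →
      ∀ a, ContDiffOn ℝ 1 (fun y => contract p (G y)⁻¹ (T y) a) V := fun p hT a =>
    ContDiffOn.sum fun i _ => ContDiffOn.sum fun j _ =>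
      ((hG.smooth_inv i j).of_le ENat.LEInfty.out).mul (hT _)
  exact hc _ (hc _ fun b => contDiffOn_fluxDensity hG hu hw b) a

namespace IsPullback
variable {φ : Coord n → Coord n} {U V : Set (Coord n)}
  {G₁ G₂ : Coord n → Matrix (Fin n) (Fin n) ℝ}

lemma isSolitonOn (h : IsPullback φ U V G₁ G₂) {u : Coord n → ℝ} (hu : ContDiffOn ℝ ∞ u V) {c : ℝ}
    (hs : IsSolitonOn V G₂ u c) : IsSolitonOn U G₁ (fun x => u (φ x)) c := by
  intro x hx a
  have hdu := h.differential (u₁ := fun x => u (φ x)) (fun _ _ => rfl) fun y hy =>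
    diffAt_of_smooth h.right.isOpen hu hy
  have h1 := (h.ricci.add (h.covDeriv hdu (h.right.smoothOn_differential hu))) x hx
  have h2 := (h.metricTensor.const_mul c) x hx
  have h3 : (fun a => RicciSoliton.ricci G₂ (φ x) a
      + RicciSoliton.covDeriv G₂ (RicciSoliton.differential u) (φ x) a)
      = fun a => c * RicciSoliton.metricTensor G₂ (φ x) a := funext (hs _ (h.mapsTo hx))
  exact congrFun ((h1.trans (congrArg (pullM (jac φ x)) h3)).trans h2.symm) a

lemma divergence_flux (h : IsPullback φ U V G₁ G₂) {u w : Coord n → ℝ} (hu : ContDiffOn ℝ ∞ u V)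
    (hw : ContDiffOn ℝ 2 w V) {x : Coord n} (hx : x ∈ U) :
    divergence G₁ (flux G₁ (fun x => u (φ x)) fun x => w (φ x)) x
      = divergence G₂ (flux G₂ u w) (φ x) := by
  have hdu := h.differential (u₁ := fun x => u (φ x)) (fun _ _ => rfl) fun y hy =>
    diffAt_of_smooth h.right.isOpen hu hy
  have hdw := h.differential (u₁ := fun x => w (φ x)) (fun _ _ => rfl) fun y hy =>
    (hw.contDiffAt (h.right.isOpen.mem_nhds hy)).differentiableAt (by simp)
  have hddu := h.covDeriv hdu (h.right.smoothOn_differential hu)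
  have hdC := h.covDeriv h.cotton h.right.smoothOn_cotton
  have h1 : Pulls φ U (fluxDensity G₁ (fun x => u (φ x)) fun x => w (φ x)) (fluxDensity G₂ u w) :=
    ((hdC.mul hdu ![1, 0, 3, 4] ![2] (by decide)).fun_mul w).sub
      (((h.cotton.mul hddu ![1, 3, 0] ![2, 4] (by decide)).fun_mul w).add
        (h.cotton.mul (hdu.mul hdw ![0] ![1] (by decide)) ![1, 3, 0] ![2, 4] (by decide)))
  have h2 : Pulls φ U (flux G₁ (fun x => u (φ x)) fun x => w (φ x)) (flux G₂ u w) :=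
    (h1.contract h _ (by decide)).contract h _ (by decide)
  have h3 := (h2.covDeriv h fun y hy a => ((contDiffOn_flux h.right hu hw a).contDiffAt
    (h.right.isOpen.mem_nhds hy)).differentiableAt (by simp)).contract h (s := 0)
      ![Sum.inr 0, Sum.inr 1] (by decide)
  exact h3.eval_rank_zero hx _ _

end IsPullback

end

/-! ### The divergence of the flux -/

section

lemma cotton_antisymm (G : Coord n → Matrix (Fin n) (Fin n) ℝ) (y : Coord n) (i j k : Fin n) :
    cotton G y ![i, j, k] = - cotton G y ![i, k, j] := by
  change covDeriv G (ricci G) y ![i, j, k] - covDeriv G (ricci G) y ![i, k, j]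
    - 1 / (2 * ((n : ℝ) - 1)) * (pderiv k (scalarCurvature G) y * G y i j
        - pderiv j (scalarCurvature G) y * G y i k) =
    -(covDeriv G (ricci G) y ![i, k, j] - covDeriv G (ricci G) y ![i, j, k]
    - 1 / (2 * ((n : ℝ) - 1)) * (pderiv j (scalarCurvature G) y * G y i k
        - pderiv k (scalarCurvature G) y * G y i j))
  ring

lemma sum_swap_sub (X : Fin n → Fin n → Fin n → ℝ) :
    ∑ t, ∑ k, ∑ i, (X t k i - X i k t) = 0 := by
  simp only [Finset.sum_sub_distrib]
  rw [sub_eq_zero, sum_rotate (fun t k i => X i k t)]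
  exact Finset.sum_congr rfl fun _ _ => Finset.sum_comm

namespace IsNormalAt
variable {U : Set (Coord n)} {G : Coord n → Matrix (Fin n) (Fin n) ℝ} {x : Coord n}

lemma cottonTerm_apply (h : IsNormalAt U G x) (u : Coord n → ℝ) :
    cottonTerm G u x = ∑ t, ∑ k, ∑ i, covDeriv G (covDeriv G (cotton G)) x ![k, t, i, i, t]
      * pderiv k u x := by
  unfold cottonTerm
  simp only [h.inv_eq_one, Matrix.one_apply, ite_mul, one_mul, zero_mul, Finset.sum_ite_eq,
    Finset.mem_univ, if_true, Finset.sum_ite_irrel, Finset.sum_const_zero]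
  exact Finset.sum_comm

lemma cottonNorm_apply (h : IsNormalAt U G x) :
    tensorNormSq G (cotton G) x = ∑ t, ∑ k, ∑ i, cotton G x ![k, i, t] ^ 2 := by
  rw [cottonNorm_eq _ _ ![], contractPairs_apply]
  simp only [h.inv_eq_one, Matrix.one_apply, ite_mul, one_mul, zero_mul, Finset.sum_ite_eq,
    Finset.mem_univ, if_true, Finset.sum_ite_irrel, Finset.sum_const_zero]
  rw [Finset.sum_comm]
  refine Finset.sum_congr rfl fun t _ => Finset.sum_congr rfl fun k _ =>
    Finset.sum_congr rfl fun i _ => ?_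
  have e1 : ![k, k, t, t, i, i] ∘ ![0, 2, 4] = ![k, t, i] := by ext s; fin_cases s <;> rfl
  have e2 : ![k, k, t, t, i, i] ∘ ![1, 3, 5] = ![k, t, i] := by ext s; fin_cases s <;> rfl
  rw [e1, e2, cotton_antisymm G x k i t]
  ring

/-- Contracting the Cotton tensor with the derivative of the Ricci tensor. By antisymmetry only the
antisymmetric part of `∇ Ric` contributes, which is the Cotton tensor up to multiples of the metric;
these do not contribute because the Cotton tensor is trace free. -/
lemma cotton_mul_ricci (h : IsNormalAt U G x) (hn : 3 ≤ n) :
    ∑ t, ∑ k, ∑ i, cotton G x ![k, i, t] * pderiv t (fun z => ricci G z ![k, i]) x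
      = 1 / 2 * tensorNormSq G (cotton G) x := by
  set c : ℝ := 1 / (2 * ((n : ℝ) - 1)) with hc
  set σ : Fin n → ℝ := fun k => pderiv k (scalarCurvature G) x with hσ
  have h0 : ∑ t, ∑ k, ∑ i, cotton G x ![k, i, t] * (σ t * (1 : Matrix _ _ ℝ) k i) = 0 := by
    have : ∀ t, ∑ k, ∑ i, cotton G x ![k, i, t] * (σ t * (1 : Matrix _ _ ℝ) k i) = 0 := by
      intro t
      simp only [Matrix.one_apply, mul_ite, mul_one, mul_zero, Finset.sum_ite_eq, Finset.mem_univ,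
        if_true]
      rw [← Finset.sum_mul, h.trace_cotton hn, zero_mul]
    simp [this]
  have h1 := sum_swap_sub (n := n) fun t k i =>
    1 / 2 * (cotton G x ![k, i, t] * pderiv t (fun z => ricci G z ![k, i]) x)
      - c / 2 * (cotton G x ![k, i, t] * (σ t * (1 : Matrix _ _ ℝ) k i))
  have e : ∀ t k i : Fin n, cotton G x ![k, i, t] * pderiv t (fun z => ricci G z ![k, i]) x
      = 1 / 2 * cotton G x ![k, i, t] ^ 2
        + c * (cotton G x ![k, i, t] * (σ t * (1 : Matrix _ _ ℝ) k i))
        + ((1 / 2 * (cotton G x ![k, i, t] * pderiv t (fun z => ricci G z ![k, i]) x)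
            - c / 2 * (cotton G x ![k, i, t] * (σ t * (1 : Matrix _ _ ℝ) k i)))
          - (1 / 2 * (cotton G x ![k, t, i] * pderiv i (fun z => ricci G z ![k, t]) x)
            - c / 2 * (cotton G x ![k, t, i] * (σ i * (1 : Matrix _ _ ℝ) k t)))) := by
    intro t k i
    have h2 := h.cotton_apply k i t
    rw [cotton_antisymm G x k t i]
    linear_combination (-(1 / 2) * cotton G x ![k, i, t]) * h2
  rw [Finset.sum_congr rfl fun t _ => Finset.sum_congr rfl fun k _ =>
    Finset.sum_congr rfl fun i _ => e t k i]
  rw [h.cottonNorm_apply]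
  simp only [Finset.sum_add_distrib, h1, ← Finset.mul_sum, h0]
  ring

/-- The divergence of the flux at the centre of normal coordinates. Up to terms that are
antisymmetric in `t` and `i`, it consists of `C_{kti,it} u_k w` and of `w C_{kit} R_{ki,t}`, the
latter coming from the soliton equation `∇ ∇² u = -∇ Ric`. -/
lemma divergence_flux (h : IsNormalAt U G x) (hn : 3 ≤ n) {u w : Coord n → ℝ}
    (hu : ContDiffOn ℝ ∞ u U) (hw : ContDiffOn ℝ 2 w U) {c : ℝ} (hs : IsSolitonOn U G u c) :
    divergence G (flux G u w) x
      = w x * (cottonTerm G u x + 1 / 2 * tensorNormSq G (cotton G) x) := by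
  have hU := h.metric.isOpen
  have hC := h.metric.smoothOn_cotton
  have hC1 := h.metric.smoothOn_covDeriv hC
  have hu1 := h.metric.smoothOn_differential hu
  have hu2 := h.metric.smoothOn_covDeriv hu1
  have dC := fun a => h.diffAt (hC a)
  have dC1 := fun a => h.diffAt (hC1 a)
  have du1 := fun k => h.diffAt (smooth_pderiv hU hu k)
  have du2 := fun a => h.diffAt (hu2 a)
  have hwx := hw.contDiffAt (hU.mem_nhds h.mem)
  have dw : DifferentiableAt ℝ w x := hwx.differentiableAt (by simp)
  have dw1 : ∀ k, DifferentiableAt ℝ (pderiv k w) x := fun k =>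
    ((contDiffOn_pderiv hU hw (k := 1) (by norm_num) k).contDiffAt
      (hU.mem_nhds h.mem)).differentiableAt (by simp)
  have hdens : ∀ a, DifferentiableAt ℝ (fun z => fluxDensity G u w z a) x := fun a =>
    ((contDiffOn_fluxDensity h.metric hu hw a).contDiffAt
      (hU.mem_nhds h.mem)).differentiableAt (by simp)
  -- the divergence as a sum of partial derivatives
  have e1 : divergence G (flux G u w) x
      = ∑ t, ∑ k, ∑ i, pderiv t (fun z => fluxDensity G u w z ![t, k, k, i, i]) x := by
    unfold divergence
    rw [h.contract_apply]
    refine Finset.sum_congr rfl fun t _ => ?_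
    rw [h.covDeriv_apply]
    unfold flux
    rw [h.pderiv_contract _ fun b => h.diffAt_contract _ hdens b]
    refine Finset.sum_congr rfl fun k _ => ?_
    rw [h.pderiv_contract _ hdens]
    refine Finset.sum_congr rfl fun i _ => ?_
    congr 2
  have e2 : ∀ t k i : Fin n, (fun z => fluxDensity G u w z ![t, k, k, i, i])
      = fun z => w z * (covDeriv G (cotton G) z ![k, t, i, i] * pderiv k u z)
        - (w z * (cotton G z ![k, i, t] * covDeriv G (differential u) z ![k, i])
          + cotton G z ![k, i, t] * (pderiv k u z * pderiv i w z)) := by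
    intro t k i
    have a1 : ![t, k, k, i, i] ∘ ![1, 0, 3, 4] = ![k, t, i, i] := by ext s; fin_cases s <;> rfl
    have a2 : ![t, k, k, i, i] ∘ ![1, 3, 0] = ![k, i, t] := by ext s; fin_cases s <;> rfl
    have a3 : ![t, k, k, i, i] ∘ ![2, 4] = ![k, i] := by ext s; fin_cases s <;> rfl
    funext z
    unfold fluxDensity
    rw [a1, a2, a3]
    rfl
  -- the values of the covariant derivatives
  have v1 : ∀ k t i m : Fin n, covDeriv G (cotton G) x ![k, t, i, m]
      = pderiv m (fun z => cotton G z ![k, t, i]) x := by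
    intro k t i m
    rw [h.covDeriv_apply]
    congr 2
  have v2 : ∀ k t i m s : Fin n, pderiv s (fun z => covDeriv G (cotton G) z ![k, t, i, m]) x
      = covDeriv G (covDeriv G (cotton G)) x ![k, t, i, m, s] := by
    intro k t i m s
    rw [h.covDeriv_apply]
    congr 2
  have v3 : ∀ k i : Fin n, covDeriv G (differential u) x ![k, i] = pderiv i (pderiv k u) x := by
    intro k i
    rw [covDeriv_rank_one]
    simp only [h.christoffel_eq_zero, zero_mul, Finset.sum_const_zero, sub_zero]
    rfl
  have v4 : ∀ t k i : Fin n, pderiv t (fun z => covDeriv G (differential u) z ![k, i]) x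
      = - pderiv t (fun z => ricci G z ![k, i]) x := by
    intro t k i
    have : ∀ z ∈ U, covDeriv G (differential u) z ![k, i] = c * G z k i - ricci G z ![k, i] := by
      intro z hz
      have := hs z hz ![k, i]
      change _ = c * G z k i at this
      linarith
    have dg := h.diffAt (h.metric.smooth k i)
    rw [pderiv_congr_on hU this h.mem, pderiv_sub ((differentiableAt_const _).fun_mul dg)
      (h.diffAt (h.metric.smoothOn_ricci _)), pderiv_const_mul _ dg, h.pderiv_eq_zero]
    ring
  have v5 : ∀ k i : Fin n, pderiv i (pderiv k u) x = pderiv k (pderiv i u) x := fun k i =>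
    pderiv_comm ((hu.contDiffAt (hU.mem_nhds h.mem)).of_le ENat.LEInfty.out) i k
  have v6 : ∀ k i : Fin n, pderiv i (pderiv k w) x = pderiv k (pderiv i w) x := fun k i =>
    pderiv_comm hwx i k
  have v7 : ∀ m k t i : Fin n, pderiv m (fun z => cotton G z ![k, t, i]) x
      = - pderiv m (fun z => cotton G z ![k, i, t]) x := by
    intro m k t i
    have : (fun z => cotton G z ![k, t, i]) = fun z => (-1) * cotton G z ![k, i, t] :=
      funext fun z => by rw [cotton_antisymm]; ring
    rw [this, pderiv_const_mul _ (dC _)]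
    ring
  -- the last summand has the form `X t k i - X i k t`, so its sum vanishes
  have e3 : ∀ t k i : Fin n, pderiv t (fun z => fluxDensity G u w z ![t, k, k, i, i]) x
      = w x * (covDeriv G (covDeriv G (cotton G)) x ![k, t, i, i, t] * pderiv k u x)
        + w x * (cotton G x ![k, i, t] * pderiv t (fun z => ricci G z ![k, i]) x)
        + ((pderiv t w x * pderiv i (fun z => cotton G z ![k, t, i]) x * pderiv k u x
            + w x * pderiv i (fun z => cotton G z ![k, t, i]) x * pderiv t (pderiv k u) x
            - pderiv t w x * cotton G x ![k, i, t] * pderiv i (pderiv k u) x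
            - 1 / 2 * cotton G x ![k, i, t] * pderiv k u x * pderiv t (pderiv i w) x)
          - (pderiv i w x * pderiv t (fun z => cotton G z ![k, i, t]) x * pderiv k u x
            + w x * pderiv t (fun z => cotton G z ![k, i, t]) x * pderiv i (pderiv k u) x
            - pderiv i w x * cotton G x ![k, t, i] * pderiv t (pderiv k u) x
            - 1 / 2 * cotton G x ![k, t, i] * pderiv k u x * pderiv i (pderiv t w) x)) := by
    intro t k i
    have d1 := (dC1 ![k, t, i, i]).fun_mul (du1 k)
    have d2 := (dC ![k, i, t]).fun_mul (du2 ![k, i])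
    have d3 := (du1 k).fun_mul (dw1 i)
    rw [e2, pderiv_sub (dw.fun_mul d1) ((dw.fun_mul d2).fun_add ((dC _).fun_mul d3)),
      pderiv_add (dw.fun_mul d2) ((dC _).fun_mul d3), pderiv_mul dw d1, pderiv_mul dw d2,
      pderiv_mul (dC _) d3, pderiv_mul (dC1 _) (du1 k), pderiv_mul (dC _) (du2 _),
      pderiv_mul (du1 k) (dw1 i), v1, v2, v3, v4, cotton_antisymm G x k t i, v6 t i]
    ring
  rw [e1, h.cottonTerm_apply, mul_add, ← h.cotton_mul_ricci hn]
  have h0 := sum_swap_sub (n := n) fun t k i =>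
    pderiv t w x * pderiv i (fun z => cotton G z ![k, t, i]) x * pderiv k u x
            + w x * pderiv i (fun z => cotton G z ![k, t, i]) x * pderiv t (pderiv k u) x
            - pderiv t w x * cotton G x ![k, i, t] * pderiv i (pderiv k u) x
            - 1 / 2 * cotton G x ![k, i, t] * pderiv k u x * pderiv t (pderiv i w) x
  simp only [e3, Finset.mul_sum, Finset.sum_add_distrib, h0, add_zero]

end IsNormalAt

/-- For every function `w` of class `C²`, the function `(C_{kti,it} u_k + ½ |C|²) w` is a
divergence. -/
lemma divergence_flux_eq {V : Set (Coord n)} {G : Coord n → Matrix (Fin n) (Fin n) ℝ}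
    (hG : IsMetricOn V G) (hn : 3 ≤ n) {u w : Coord n → ℝ}
    (hu : ContDiffOn ℝ ∞ u V) (hw : ContDiffOn ℝ 2 w V) {c : ℝ} (hs : IsSolitonOn V G u c)
    {y : Coord n} (hy : y ∈ V) :
    divergence G (flux G u w) y
      = w y * (cottonTerm G u y + 1 / 2 * tensorNormSq G (cotton G) y) := by
  obtain ⟨φ, U, G₁, h, hN, rfl⟩ := hG.exists_normal hy
  have hu' : ContDiffOn ℝ ∞ (fun x => u (φ x)) U := hu.comp h.smooth h.mapsTo
  have hw' : ContDiffOn ℝ 2 (fun x => w (φ x)) U :=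
    hw.comp (h.smooth.of_le ENat.LEInfty.out) h.mapsTo
  rw [← h.divergence_flux hu hw hN.mem, hN.divergence_flux hn hu' hw' (h.isSolitonOn hu hs),
    h.cottonNorm hN.mem, h.cottonTerm (u₂ := u) (fun _ _ => rfl)
      (fun y hy => diffAt_of_smooth hG.isOpen hu hy) hN.mem]

end

/-! ### The divergence as a sum of partial derivatives -/

section

/-- Jacobi's formula for the derivative of a determinant. -/
lemma pderiv_det {A : Coord n → Matrix (Fin n) (Fin n) ℝ} {y : Coord n}
    (hA : ∀ i j, DifferentiableAt ℝ (fun z => A z i j) y) (b : Fin n) :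
    pderiv b (fun z => (A z).det) y
      = ∑ i, ∑ j, (A y).adjugate i j * pderiv b (fun z => A z j i) y := by
  have hprod : ∀ σ : Equiv.Perm (Fin n), DifferentiableAt ℝ (fun z => ∏ i, A z (σ i) i) y :=
    fun σ => (HasFDerivAt.finsetProd fun i _ => (hA (σ i) i).hasFDerivAt).differentiableAt
  simp only [Matrix.det_apply']
  rw [pderiv_sum fun σ _ => (differentiableAt_const _).fun_mul (hprod σ)]
  have e1 : ∀ σ : Equiv.Perm (Fin n),
      pderiv b (fun z => ((Equiv.Perm.sign σ : ℤ) : ℝ) * ∏ i, A z (σ i) i) y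
      = ∑ i, ((Equiv.Perm.sign σ : ℤ) : ℝ) * (pderiv b (fun z => A z (σ i) i) y
        * ∏ k ∈ Finset.univ.erase i, A y (σ k) k) := by
    intro σ
    rw [pderiv_const_mul _ (hprod σ), pderiv_prod fun i _ => hA (σ i) i, Finset.mul_sum]
  simp only [e1]
  rw [Finset.sum_comm]
  refine Finset.sum_congr rfl fun i _ => ?_
  have e2 : ∑ j, (A y).adjugate i j * pderiv b (fun z => A z j i) y
      = (A y).cramer (fun j => pderiv b (fun z => A z j i) y) i := by
    rw [Matrix.cramer_eq_adjugate_mulVec]; rfl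
  rw [e2, Matrix.cramer_apply, Matrix.det_apply']
  refine Finset.sum_congr rfl fun σ _ => ?_
  rw [← Finset.mul_prod_erase _ _ (Finset.mem_univ i), Matrix.updateCol_self]
  congr 2
  refine Finset.prod_congr rfl fun k hk => ?_
  rw [Matrix.updateCol_ne (Finset.ne_of_mem_erase hk)]

namespace IsMetricOn
variable {V : Set (Coord n)} {G : Coord n → Matrix (Fin n) (Fin n) ℝ}

lemma smooth_sqrt_det (hG : IsMetricOn V G) : ContDiffOn ℝ ∞ (fun z => √(G z).det) V :=
  (contDiffOn_det hG.smooth).sqrt fun _ hy => (hG.det_pos hy).ne'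

lemma pderiv_sqrt_det (hG : IsMetricOn V G) {y : Coord n} (hy : y ∈ V) (b : Fin n) :
    pderiv b (fun z => √(G z).det) y = √(G y).det * ∑ m, christoffel G y m b m := by
  have hd : DifferentiableAt ℝ (fun z => (G z).det) y :=
    diffAt_of_smooth hG.isOpen (contDiffOn_det hG.smooth) hy
  have hpos := hG.det_pos hy
  have h1 : pderiv b (fun z => (G z).det) y = 2 * (G y).det * ∑ m, christoffel G y m b m := by
    rw [pderiv_det (fun i j => diffAt_of_smooth hG.isOpen (hG.smooth i j) hy)]
    have e0 : ∀ i j, (G y).adjugate i j = (G y).det * (G y)⁻¹ i j := by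
      intro i j
      rw [Matrix.inv_def, Matrix.smul_apply, Ring.inverse_eq_inv', smul_eq_mul, ← mul_assoc,
        mul_inv_cancel₀ hpos.ne', one_mul]
    simp only [e0, pderiv_metric hG hy, mul_add, Finset.sum_add_distrib]
    have e1 : ∑ i, ∑ j, (G y).det * (G y)⁻¹ i j * ∑ m, christoffel G y m b j * G y m i
        = (G y).det * ∑ m, christoffel G y m b m := by
      calc _ = ∑ j, ∑ m, (G y).det * christoffel G y m b j * ∑ i, G y m i * (G y)⁻¹ i j := by
            simp only [Finset.mul_sum]
            rw [sum_rotate']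
            exact Finset.sum_congr rfl fun _ _ => Finset.sum_congr rfl fun _ _ =>
              Finset.sum_congr rfl fun _ _ => by ring
        _ = _ := by simp [hG.mul_inv_sum hy, Finset.mul_sum]
    have e2 : ∑ i, ∑ j, (G y).det * (G y)⁻¹ i j * ∑ m, christoffel G y m b i * G y j m
        = (G y).det * ∑ m, christoffel G y m b m := by
      calc _ = ∑ i, ∑ m, (G y).det * christoffel G y m b i * ∑ j, (G y)⁻¹ i j * G y j m := by
            simp only [Finset.mul_sum]
            refine Finset.sum_congr rfl fun i _ => ?_
            rw [Finset.sum_comm]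
            exact Finset.sum_congr rfl fun _ _ =>
              Finset.sum_congr rfl fun _ _ => by ring
        _ = _ := by simp [hG.inv_mul_sum hy, Finset.mul_sum]
    rw [e1, e2]
    ring
  have h2 : pderiv b (fun z => √(G z).det) y
      = 1 / (2 * √(G y).det) * pderiv b (fun z => (G z).det) y := by
    unfold pderiv
    rw [(hd.hasFDerivAt.sqrt hpos.ne').fderiv]
    rfl
  rw [h2, h1]
  have hs : √(G y).det ≠ 0 := (Real.sqrt_pos.mpr hpos).ne'
  field_simp
  rw [Real.sq_sqrt hpos.le]

/-- The inverse metric is parallel. -/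
lemma pderiv_inv (hG : IsMetricOn V G) {y : Coord n} (hy : y ∈ V) (b i j : Fin n) :
    pderiv b (fun z => (G z)⁻¹ i j) y
      = - ∑ m, christoffel G y i b m * (G y)⁻¹ m j - ∑ m, christoffel G y j b m * (G y)⁻¹ i m := by
  have dI : ∀ i j, DifferentiableAt ℝ (fun z => (G z)⁻¹ i j) y := fun i j =>
    diffAt_of_smooth hG.isOpen (hG.smooth_inv i j) hy
  have dG : ∀ i j, DifferentiableAt ℝ (fun z => G z i j) y := fun i j =>
    diffAt_of_smooth hG.isOpen (hG.smooth i j) hy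
  -- differentiate `g⁻¹ g = 1`
  have h1 : ∀ l, ∑ k, (pderiv b (fun z => (G z)⁻¹ i k) y * G y k l
      + (G y)⁻¹ i k * pderiv b (fun z => G z k l) y) = 0 := by
    intro l
    have := pderiv_congr_on (i := b) hG.isOpen (fun z hz => hG.inv_mul_sum hz i l) hy
    rw [pderiv_const, pderiv_sum fun k _ => (dI i k).fun_mul (dG k l)] at this
    simpa only [pderiv_mul (dI _ _) (dG _ _)] using this
  have h2 : ∑ l, (∑ k, (pderiv b (fun z => (G z)⁻¹ i k) y * G y k l
      + (G y)⁻¹ i k * pderiv b (fun z => G z k l) y)) * (G y)⁻¹ l j = 0 := by simp [h1]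
  simp only [Finset.sum_add_distrib, add_mul, pderiv_metric hG hy, mul_add] at h2
  have e1 : ∑ l, (∑ k, pderiv b (fun z => (G z)⁻¹ i k) y * G y k l) * (G y)⁻¹ l j
      = pderiv b (fun z => (G z)⁻¹ i j) y := by
    calc _ = ∑ k, pderiv b (fun z => (G z)⁻¹ i k) y * ∑ l, G y k l * (G y)⁻¹ l j := by
          simp only [Finset.sum_mul, Finset.mul_sum]
          rw [Finset.sum_comm]
          exact Finset.sum_congr rfl fun _ _ => Finset.sum_congr rfl fun _ _ => by ring
      _ = _ := by simp [hG.mul_inv_sum hy]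
  have e2 : ∑ l, (∑ k, (G y)⁻¹ i k * ∑ m, christoffel G y m b k * G y m l) * (G y)⁻¹ l j
      = ∑ m, christoffel G y j b m * (G y)⁻¹ i m := by
    calc _ = ∑ k, ∑ m, (G y)⁻¹ i k * christoffel G y m b k * ∑ l, G y m l * (G y)⁻¹ l j := by
          simp only [Finset.sum_mul, Finset.mul_sum]
          rw [sum_rotate']
          exact Finset.sum_congr rfl fun _ _ => Finset.sum_congr rfl fun _ _ =>
            Finset.sum_congr rfl fun _ _ => by ring
      _ = _ := by simp [hG.mul_inv_sum hy, mul_comm]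
  have e3 : ∑ l, (∑ k, (G y)⁻¹ i k * ∑ m, christoffel G y m b l * G y k m) * (G y)⁻¹ l j
      = ∑ m, christoffel G y i b m * (G y)⁻¹ m j := by
    calc _ = ∑ l, ∑ m, christoffel G y m b l * (G y)⁻¹ l j * ∑ k, (G y)⁻¹ i k * G y k m := by
          simp only [Finset.sum_mul, Finset.mul_sum]
          refine Finset.sum_congr rfl fun l _ => ?_
          rw [Finset.sum_comm]
          exact Finset.sum_congr rfl fun _ _ => Finset.sum_congr rfl fun _ _ => by ring
      _ = _ := by simp [hG.inv_mul_sum hy]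
  rw [e1, e2, e3] at h2
  linarith

/-- The divergence of a one-form, multiplied by the density `√(det g)`, is a Euclidean
divergence. -/
lemma sum_pderiv_eq_divergence (hG : IsMetricOn V G) {Z : LocalTensor n 1} {y : Coord n}
    (hy : y ∈ V) (hZ : ∀ a, DifferentiableAt ℝ (fun z => Z z a) y) :
    ∑ i, pderiv i (fun z => √(G z).det * ∑ j, (G z)⁻¹ i j * Z z ![j]) y
      = √(G y).det * divergence G Z y := by
  have ds : DifferentiableAt ℝ (fun z => √(G z).det) y :=
    diffAt_of_smooth hG.isOpen hG.smooth_sqrt_det hy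
  have dI : ∀ i j, DifferentiableAt ℝ (fun z => (G z)⁻¹ i j) y := fun i j =>
    diffAt_of_smooth hG.isOpen (hG.smooth_inv i j) hy
  have e1 : ∀ i, pderiv i (fun z => √(G z).det * ∑ j, (G z)⁻¹ i j * Z z ![j]) y
      = √(G y).det * ((∑ m, christoffel G y m i m) * (∑ j, (G y)⁻¹ i j * Z y ![j])
        + ∑ j, (pderiv i (fun z => (G z)⁻¹ i j) y * Z y ![j]
          + (G y)⁻¹ i j * pderiv i (fun z => Z z ![j]) y)) := by
    intro i
    rw [pderiv_mul ds (DifferentiableAt.fun_sum fun j _ => (dI i j).fun_mul (hZ _)),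
      pderiv_sum fun j _ => (dI i j).fun_mul (hZ _), hG.pderiv_sqrt_det hy]
    simp only [pderiv_mul (dI i _) (hZ _)]
    ring
  have e2 : divergence G Z y = ∑ i, ∑ j, (G y)⁻¹ i j * (pderiv i (fun z => Z z ![j]) y
      - ∑ m, christoffel G y m i j * Z y ![m]) := by
    unfold divergence contract
    rw [Finset.sum_comm]
    refine Finset.sum_congr rfl fun i _ => Finset.sum_congr rfl fun j _ => ?_
    rw [← covDeriv_rank_one, hG.inv_symm hy j i]
    congr 2
    ext s; fin_cases s <;> rfl
  simp only [e1, ← Finset.mul_sum]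
  rw [e2]
  congr 1
  simp only [hG.pderiv_inv hy, mul_sub, Finset.sum_add_distrib, Finset.sum_sub_distrib, sub_mul,
    neg_mul, Finset.sum_neg_distrib]
  have e3 : ∑ i, ∑ j, (∑ m, christoffel G y i i m * (G y)⁻¹ m j) * Z y ![j]
      = ∑ i, (∑ m, christoffel G y m i m) * ∑ j, (G y)⁻¹ i j * Z y ![j] := by
    calc _ = ∑ i, ∑ j, ∑ m, christoffel G y i i m * (G y)⁻¹ m j * Z y ![j] := by
          simp only [Finset.sum_mul]
      _ = ∑ m, ∑ i, ∑ j, christoffel G y i i m * (G y)⁻¹ m j * Z y ![j] := by rw [sum_rotate]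
      _ = _ := by
          refine Finset.sum_congr rfl fun m _ => ?_
          rw [Finset.sum_mul_sum]
          exact Finset.sum_congr rfl fun i _ => Finset.sum_congr rfl fun j _ => by
            rw [christoffel_symm hG hy i i m]; ring
  have e4 : ∑ i, ∑ j, (∑ m, christoffel G y j i m * (G y)⁻¹ i m) * Z y ![j]
      = ∑ i, ∑ j, (G y)⁻¹ i j * ∑ m, christoffel G y m i j * Z y ![m] := by
    refine Finset.sum_congr rfl fun i _ => ?_
    simp only [Finset.sum_mul, Finset.mul_sum]
    rw [Finset.sum_comm]
    exact Finset.sum_congr rfl fun _ _ => Finset.sum_congr rfl fun _ _ => by ring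
  rw [e3, e4]
  ring

end IsMetricOn

/-! ### Integration in a coordinate domain -/

lemma integral_pderiv_eq_zero {h : Coord n → ℝ} (hh : ContDiff ℝ 1 h) (hc : HasCompactSupport h)
    (i : Fin n) : ∫ y, pderiv i h y = 0 := by
  have hi : Integrable (fun y => fderiv ℝ h y (EuclideanSpace.single i 1)) :=
    ((hh.continuous_fderiv (by simp)).clm_apply continuous_const).integrable_of_hasCompactSupport
      (hc.fderiv_apply ℝ _)
  have := integral_mul_fderiv_eq_neg_fderiv_mul_of_integrable (𝕜 := ℝ) (μ := volume)
    (f := fun _ : Coord n => (1 : ℝ)) (g := h) (v := EuclideanSpace.single i 1)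
    (by simp) (by simpa using hi)
    (by simpa using hh.continuous.integrable_of_hasCompactSupport hc)
    (fun x _ => differentiableAt_const _) (fun x _ => hh.differentiable (by simp) x)
  simpa [pderiv] using this

/-- A function on an open set extends smoothly by zero if it vanishes off a closed subset. -/
lemma contDiff_of_contDiffOn {V : Set (Coord n)} (hV : IsOpen V) {m : WithTop ℕ∞} {h : Coord n → ℝ}
    (hh : ContDiffOn ℝ m h V) {K : Set (Coord n)} (hK : IsClosed K) (hKV : K ⊆ V)
    (h0 : ∀ y ∉ K, h y = 0) : ContDiff ℝ m h := by
  rw [contDiff_iff_contDiffAt]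
  intro y
  by_cases hy : y ∈ V
  · exact hh.contDiffAt (hV.mem_nhds hy)
  · refine (contDiffAt_const (c := (0 : ℝ))).congr_of_eventuallyEq ?_
    filter_upwards [hK.isOpen_compl.mem_nhds fun hyK => hy (hKV hyK)] with z hz
    exact h0 z hz

/-- The integral of the divergence of the flux vanishes if the weight `w` has compact support in the
coordinate domain. -/
lemma integral_chart_eq_zero {V : Set (Coord n)} {G : Coord n → Matrix (Fin n) (Fin n) ℝ}
    (hG : IsMetricOn V G) (hn : 3 ≤ n) {u w : Coord n → ℝ}
    (hu : ContDiffOn ℝ ∞ u V) (hw : ContDiffOn ℝ 2 w V) {c : ℝ} (hs : IsSolitonOn V G u c)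
    {K : Set (Coord n)} (hK : IsCompact K) (hKV : K ⊆ V) (hw0 : ∀ y ∈ V \ K, w y = 0) :
    ∫ y in V, √(G y).det * (w y * (cottonTerm G u y + 1 / 2 * tensorNormSq G (cotton G) y))
      = 0 := by
  have hVm : MeasurableSet V := hG.isOpen.measurableSet
  set X : Fin n → Coord n → ℝ := fun i y =>
    √(G y).det * ∑ j, (G y)⁻¹ i j * flux G u w y ![j] with hX
  have hle : (1 : WithTop ℕ∞) ≤ ∞ := ENat.LEInfty.out
  have hXV : ∀ i, ContDiffOn ℝ 1 (X i) V := fun i =>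
    (hG.smooth_sqrt_det.of_le hle).mul (ContDiffOn.sum fun j _ =>
      ((hG.smooth_inv i j).of_le hle).mul (contDiffOn_flux hG hu hw _))
  have hVK : IsOpen (V \ K) := hG.isOpen.sdiff hK.isClosed
  have hX0 : ∀ i, ∀ y ∈ V \ K, X i y = 0 := by
    intro i y hy
    have h1 : ∀ k, pderiv k w y = 0 := fun k => by
      rw [pderiv_congr_on hVK hw0 hy, pderiv_const]
    have h2 : ∀ a, fluxDensity G u w y a = 0 := by
      intro a
      simp [fluxDensity, differential, h1, hw0 y hy]
    simp [hX, flux, contract, h2]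
  -- extended by zero, the vector field is of class `C¹` with compact support
  set Y : Fin n → Coord n → ℝ := fun i => V.indicator (X i) with hY
  have hYV : ∀ i, ∀ y ∈ V, Y i y = X i y := fun i y hy => Set.indicator_of_mem hy _
  have hY0 : ∀ i, ∀ y ∉ K, Y i y = 0 := by
    intro i y hy
    by_cases hyV : y ∈ V
    · rw [hYV i y hyV, hX0 i y ⟨hyV, hy⟩]
    · exact Set.indicator_of_notMem hyV _
  have hYs : ∀ i, ContDiff ℝ 1 (Y i) := fun i =>
    contDiff_of_contDiffOn hG.isOpen ((hXV i).congr (hYV i)) hK.isClosed hKV (hY0 i)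
  have hYc : ∀ i, HasCompactSupport (Y i) := fun i => HasCompactSupport.intro hK (hY0 i)
  have hYi : ∀ i, Integrable (pderiv i (Y i)) := fun i =>
    (((hYs i).continuous_fderiv (by simp)).clm_apply
      continuous_const).integrable_of_hasCompactSupport ((hYc i).fderiv_apply ℝ _)
  have hsum : ∀ y, V.indicator (fun y => √(G y).det
      * (w y * (cottonTerm G u y + 1 / 2 * tensorNormSq G (cotton G) y))) y
      = ∑ i, pderiv i (Y i) y := by
    intro y
    by_cases hy : y ∈ V
    · rw [Set.indicator_of_mem hy, ← divergence_flux_eq hG hn hu hw hs hy,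
        ← hG.sum_pderiv_eq_divergence hy fun a => ((contDiffOn_flux hG hu hw a).contDiffAt
          (hG.isOpen.mem_nhds hy)).differentiableAt (by simp)]
      exact Finset.sum_congr rfl fun i _ =>
        pderiv_congr_on hG.isOpen (fun z hz => (hYV i z hz).symm) hy
    · rw [Set.indicator_of_notMem hy]
      refine (Finset.sum_eq_zero fun i _ => ?_).symm
      rw [pderiv_congr_on hK.isClosed.isOpen_compl (hY0 i) fun hyK => hy (hKV hyK), pderiv_const]
  rw [← integral_indicator hVm, integral_congr_ae (Filter.Eventually.of_forall hsum),
    integral_finsetSum _ fun i _ => hYi i]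
  exact Finset.sum_eq_zero fun i _ => integral_pderiv_eq_zero (hYs i) (hYc i) i

end

/-! ### The metric in coordinates -/

section

variable {M : Type*} [TopologicalSpace M] [ChartedSpace (EuclideanSpace ℝ (Fin n)) M]

/-- The differential of the inverse of the chart `e`, as an endomorphism of `ℝⁿ`: each tangent
space of `M` is by definition a copy of `ℝⁿ`. -/
def paramDeriv (e : OpenPartialHomeomorph M (EuclideanSpace ℝ (Fin n))) (y : Coord n) :
    Coord n →L[ℝ] Coord n :=
  mfderiv 𝓘(ℝ, EuclideanSpace ℝ (Fin n)) (𝓡 n) e.symm y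

variable {e e' : OpenPartialHomeomorph M (EuclideanSpace ℝ (Fin n))}

theorem mdifferentiable_of_mem (he : e ∈ IsManifold.maximalAtlas (𝓡 n) ∞ M) :
    e.MDifferentiable (𝓡 n) 𝓘(ℝ, EuclideanSpace ℝ (Fin n)) :=
  ⟨(contMDiffOn_of_mem_maximalAtlas he).mdifferentiableOn (by simp),
    (contMDiffOn_symm_of_mem_maximalAtlas he).mdifferentiableOn (by simp)⟩

theorem contDiffOn_transition (he : e ∈ IsManifold.maximalAtlas (𝓡 n) ∞ M)
    (he' : e' ∈ IsManifold.maximalAtlas (𝓡 n) ∞ M) :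
    ContDiffOn ℝ ∞ (fun z => e' (e.symm z)) (e.symm.trans e').source := by
  rw [← contMDiffOn_iff_contDiffOn]
  refine (contMDiffOn_of_mem_maximalAtlas he').comp
    ((contMDiffOn_symm_of_mem_maximalAtlas he).mono fun y hy => ?_) fun y hy => ?_
  · exact (show y ∈ e.target ∧ e.symm y ∈ e'.source by simpa using hy).1
  · exact (show y ∈ e.target ∧ e.symm y ∈ e'.source by simpa using hy).2

theorem paramDeriv_injective (he : e ∈ IsManifold.maximalAtlas (𝓡 n) ∞ M) {y : Coord n}
    (hy : y ∈ e.target) : Function.Injective (paramDeriv e y) := by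
  have h := (mdifferentiable_of_mem he).comp_symm_deriv hy
  intro v w hvw
  have hv := DFunLike.congr_fun h v
  have hw := DFunLike.congr_fun h w
  have hv' : mfderiv (𝓡 n) 𝓘(ℝ, EuclideanSpace ℝ (Fin n)) e (e.symm y) (paramDeriv e y v) = v := hv
  have hw' : mfderiv (𝓡 n) 𝓘(ℝ, EuclideanSpace ℝ (Fin n)) e (e.symm y) (paramDeriv e y w) = w := hw
  rw [← hv', ← hw']
  exact congrArg _ hvw

theorem paramDeriv_transition (he : e ∈ IsManifold.maximalAtlas (𝓡 n) ∞ M)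
    (he' : e' ∈ IsManifold.maximalAtlas (𝓡 n) ∞ M) {y : Coord n}
    (hy : y ∈ (e.symm.trans e').source) :
    paramDeriv e y = (paramDeriv e' (e' (e.symm y))).comp
      (fderiv ℝ (fun z => e' (e.symm z)) y) := by
  have hy' : y ∈ e.target ∧ e.symm y ∈ e'.source := by simpa using hy
  have hd : MDifferentiableAt 𝓘(ℝ, EuclideanSpace ℝ (Fin n)) 𝓘(ℝ, EuclideanSpace ℝ (Fin n))
      (fun z => e' (e.symm z)) y :=
    ((mdifferentiable_of_mem he').mdifferentiableAt hy'.2).comp y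
      ((mdifferentiable_of_mem he).mdifferentiableAt_symm hy'.1)
  have hs := ((mdifferentiable_of_mem he').mdifferentiableAt_symm
    (e'.map_source hy'.2)).hasMFDerivAt.comp y hd.hasMFDerivAt
  have hev : e.symm =ᶠ[nhds y] e'.symm ∘ fun z => e' (e.symm z) := by
    filter_upwards [(e.symm.trans e').open_source.mem_nhds hy] with z hz
    have hz' : z ∈ e.target ∧ e.symm z ∈ e'.source := by simpa using hz
    exact (e'.left_inv hz'.2).symm
  have h := (hs.congr_of_eventuallyEq hev).mfderiv
  rw [mfderiv_eq_fderiv] at h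
  exact h

variable [IsManifold (𝓡 n) ∞ M]

theorem metricIn_apply (g : Metric n M)
    (e : OpenPartialHomeomorph M (EuclideanSpace ℝ (Fin n))) (y : Coord n) (i j : Fin n) :
    metricIn g e y i j = g.inner (e.symm y) (paramDeriv e y (EuclideanSpace.single i 1))
      (paramDeriv e y (EuclideanSpace.single j 1)) := rfl

theorem euclidean_eq_sum_single (v : Coord n) :
    v = ∑ i, v i • (EuclideanSpace.single i (1 : ℝ) : Coord n) := by
  ext a
  simp [Pi.single_apply]

/-- The matrix `metricIn g e y` represents the inner product in the coordinate frame. -/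
theorem metricIn_sum_apply (g : Metric n M)
    (e : OpenPartialHomeomorph M (EuclideanSpace ℝ (Fin n))) (y : Coord n) (v w : Coord n) :
    g.inner (e.symm y) (paramDeriv e y v) (paramDeriv e y w)
      = ∑ i, ∑ j, v i * w j * metricIn g e y i j := by
  -- the bilinear form on the model space, free of the base point
  let B : Coord n →L[ℝ] Coord n →L[ℝ] ℝ := g.inner (e.symm y)
  change B (paramDeriv e y v) (paramDeriv e y w) = ∑ i, ∑ j, v i * w j *
    B (paramDeriv e y (EuclideanSpace.single i 1)) (paramDeriv e y (EuclideanSpace.single j 1))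
  conv_lhs => rw [euclidean_eq_sum_single v, euclidean_eq_sum_single w]
  simp only [map_sum, map_smul, _root_.sum_apply, _root_.smul_apply, smul_eq_mul, Finset.mul_sum]
  rw [Finset.sum_comm]
  exact Finset.sum_congr rfl fun i _ => Finset.sum_congr rfl fun j _ => by ring

/-- All tangent spaces being the same copy of `ℝⁿ`, the inner products at two equal points can be
compared without transport. -/
theorem inner_congr_point (g : Metric n M) {p q : M} (h : p = q) (v w : Coord n) :
    (show Coord n →L[ℝ] Coord n →L[ℝ] ℝ from g.inner p) v w
      = (show Coord n →L[ℝ] Coord n →L[ℝ] ℝ from g.inner q) v w := by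
  subst h; rfl

/-- The coordinate vector fields are smooth sections of the tangent bundle. -/
theorem contMDiffOn_coordVector (he : e ∈ IsManifold.maximalAtlas (𝓡 n) ∞ M) (i : Fin n) :
    ContMDiffOn 𝓘(ℝ, EuclideanSpace ℝ (Fin n)) ((𝓡 n).prod 𝓘(ℝ, EuclideanSpace ℝ (Fin n))) ∞
      (fun y : Coord n => Bundle.TotalSpace.mk' (EuclideanSpace ℝ (Fin n))
        (E := fun p : M => TangentSpace (𝓡 n) p) (e.symm y) (coordVector e y i)) e.target := by
  have h1 := (contMDiffOn_symm_of_mem_maximalAtlas he).contMDiffOn_tangentMapWithin (m := ∞)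
    (by simp) e.open_target.uniqueMDiffOn
  have h2 : ContMDiffOn 𝓘(ℝ, EuclideanSpace ℝ (Fin n))
      (𝓘(ℝ, EuclideanSpace ℝ (Fin n)).prod 𝓘(ℝ, EuclideanSpace ℝ (Fin n))) ∞
      (fun y : Coord n => (⟨y, (EuclideanSpace.single i (1 : ℝ) : Coord n)⟩ :
        TangentBundle 𝓘(ℝ, EuclideanSpace ℝ (Fin n)) (EuclideanSpace ℝ (Fin n)))) e.target :=
    contMDiffOn_vectorSpace_iff_contDiffOn.2 contDiffOn_const
  have h3 := h1.comp h2 (fun y hy => hy)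
  refine h3.congr fun y hy => ?_
  simp only [Function.comp, tangentMapWithin, coordVector]
  rw [mfderivWithin_of_isOpen e.open_target hy]

theorem metricIn_isMetricOn (g : Metric n M) (he : e ∈ IsManifold.maximalAtlas (𝓡 n) ∞ M) :
    IsMetricOn e.target (metricIn g e) where
  isOpen := e.open_target
  smooth i j := by
    rw [← contMDiffOn_iff_contDiffOn]
    have hb : ContMDiffOn 𝓘(ℝ, EuclideanSpace ℝ (Fin n)) (𝓡 n) ∞ e.symm e.target :=
      contMDiffOn_symm_of_mem_maximalAtlas he
    have h : ContMDiffOn 𝓘(ℝ, EuclideanSpace ℝ (Fin n)) ((𝓡 n).prod 𝓘(ℝ)) ∞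
        (fun y ↦ Bundle.TotalSpace.mk' ℝ (E := Bundle.Trivial M ℝ) (e.symm y)
          (g.inner (e.symm y) (coordVector e y i) (coordVector e y j))) e.target := by
      apply ContMDiffOn.clm_bundle_apply₂ (F₁ := EuclideanSpace ℝ (Fin n))
        (F₂ := EuclideanSpace ℝ (Fin n))
      · exact g.contMDiff.comp_contMDiffOn hb
      · exact contMDiffOn_coordVector he i
      · exact contMDiffOn_coordVector he j
    intro y hy
    have := h y hy
    simp only [Bundle.contMDiffWithinAt_totalSpace] at this
    exact this.2
  posDef y hy := by
    refine Matrix.PosDef.of_dotProduct_mulVec_pos ?_ fun x hx => ?_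
    · ext i j
      exact g.symm (e.symm y) _ _
    · have hx' : paramDeriv e y (WithLp.toLp 2 x) ≠ 0 := by
        intro h0
        apply hx
        have := paramDeriv_injective he hy (h0.trans (map_zero _).symm)
        simpa using this
      have h := g.pos (e.symm y) _ hx'
      rw [metricIn_sum_apply] at h
      refine h.trans_eq ?_
      simp only [dotProduct, Matrix.mulVec, Finset.mul_sum, star_trivial]
      exact Finset.sum_congr rfl fun i _ => Finset.sum_congr rfl fun j _ => by ring

/-- The components of one metric in two charts are related by pull-back under the change of
coordinates. -/
theorem isPullback_transition (g : Metric n M) (he : e ∈ IsManifold.maximalAtlas (𝓡 n) ∞ M)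
    (he' : e' ∈ IsManifold.maximalAtlas (𝓡 n) ∞ M) :
    IsPullback (fun z => e' (e.symm z)) (e.symm.trans e').source e'.target
      (metricIn g e) (metricIn g e') where
  left :=
    { isOpen := (e.symm.trans e').open_source
      smooth := fun i j => ((metricIn_isMetricOn g he).smooth i j).mono fun y hy =>
        (show y ∈ e.target ∧ e.symm y ∈ e'.source by simpa using hy).1
      posDef := fun y hy => (metricIn_isMetricOn g he).posDef y
        (show y ∈ e.target ∧ e.symm y ∈ e'.source by simpa using hy).1 }
  right := metricIn_isMetricOn g he'
  smooth := contDiffOn_transition he he'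
  mapsTo y hy := e'.map_source (show y ∈ e.target ∧ e.symm y ∈ e'.source by simpa using hy).2
  eq y hy := by
    have hy' : y ∈ e.target ∧ e.symm y ∈ e'.source := by simpa using hy
    have hd : DifferentiableAt ℝ (fun z => e' (e.symm z)) y :=
      ((contDiffOn_transition he he').contDiffAt
        ((e.symm.trans e').open_source.mem_nhds hy)).differentiableAt (by simp)
    ext i j
    have h1 : metricIn g e y i j = g.inner (e'.symm (e' (e.symm y)))
        (paramDeriv e' (e' (e.symm y)) (fderiv ℝ (fun z => e' (e.symm z)) y
          (EuclideanSpace.single i 1)))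
        (paramDeriv e' (e' (e.symm y)) (fderiv ℝ (fun z => e' (e.symm z)) y
          (EuclideanSpace.single j 1))) := by
      rw [metricIn_apply, paramDeriv_transition he he' hy]
      exact inner_congr_point g (e'.left_inv hy'.2).symm _ _
    rw [h1, metricIn_sum_apply, Matrix.mul_apply]
    simp only [Matrix.mul_apply, Matrix.transpose_apply, jac_eq_fderiv hd, Finset.sum_mul]
    rw [Finset.sum_comm]
    exact Finset.sum_congr rfl fun a _ => Finset.sum_congr rfl fun b _ => by ring

end

/-! ### The integrands as functions on the manifold -/

section

lemma IsMetricOn.smooth_cottonNorm {V : Set (Coord n)} {G : Coord n → Matrix (Fin n) (Fin n) ℝ}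
    (hG : IsMetricOn V G) : ContDiffOn ℝ ∞ (tensorNormSq G (cotton G)) V :=
  ContDiffOn.sum fun _ _ => ContDiffOn.sum fun _ _ =>
    ((contDiffOn_prod fun _ _ => hG.smooth_inv _ _).mul (hG.smoothOn_cotton _)).mul
      (hG.smoothOn_cotton _)

lemma IsMetricOn.smooth_cottonTerm {V : Set (Coord n)} {G : Coord n → Matrix (Fin n) (Fin n) ℝ}
    (hG : IsMetricOn V G) {u : Coord n → ℝ} (hu : ContDiffOn ℝ ∞ u V) :
    ContDiffOn ℝ ∞ (cottonTerm G u) V := by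
  unfold cottonTerm
  iterate 6 refine ContDiffOn.sum fun _ _ => ?_
  exact ((((hG.smooth_inv _ _).mul (hG.smooth_inv _ _)).mul (hG.smooth_inv _ _)).mul
    (hG.smoothOn_covDeriv (hG.smoothOn_covDeriv hG.smoothOn_cotton) _)).mul
      (smooth_pderiv hG.isOpen hu _)

variable {M : Type*} [TopologicalSpace M] [ChartedSpace (EuclideanSpace ℝ (Fin n)) M]
  {e : OpenPartialHomeomorph M (EuclideanSpace ℝ (Fin n))} {f : M → ℝ}

theorem contDiffOn_coord_expr (hf : ContMDiff (𝓡 n) 𝓘(ℝ, ℝ) ∞ f)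
    (he : e ∈ IsManifold.maximalAtlas (𝓡 n) ∞ M) :
    ContDiffOn ℝ ∞ (fun z => f (e.symm z)) e.target := by
  rw [← contMDiffOn_iff_contDiffOn]
  exact hf.comp_contMDiffOn (contMDiffOn_symm_of_mem_maximalAtlas he)

/-- A function which is continuous in the coordinates of each chart is continuous. -/
theorem continuous_of_coord {F : M → ℝ}
    (h : ∀ q : M, ∃ F' : Coord n → ℝ,
      ContinuousOn F' (chartAt (EuclideanSpace ℝ (Fin n)) q).target ∧
      ∀ p ∈ (chartAt (EuclideanSpace ℝ (Fin n)) q).source,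
        F p = F' (chartAt (EuclideanSpace ℝ (Fin n)) q p)) : Continuous F := by
  refine continuous_iff_continuousAt.2 fun q => ?_
  obtain ⟨F', hF', hF⟩ := h q
  set e := chartAt (EuclideanSpace ℝ (Fin n)) q
  have h1 : ContinuousOn F e.source :=
    (hF'.comp e.continuousOn e.mapsTo).congr hF
  exact h1.continuousAt (e.open_source.mem_nhds (mem_chart_source _ q))

variable [IsManifold (𝓡 n) ∞ M]

theorem IsGradientRicciSoliton.exists_isSolitonOn {g : Metric n M}
    (hf : IsGradientRicciSoliton g f) :
    ∃ c : ℝ, ∀ e ∈ IsManifold.maximalAtlas (𝓡 n) ∞ M,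
      IsSolitonOn e.target (metricIn g e) (fun z => f (e.symm z)) c := by
  obtain ⟨hf, c, hc⟩ := hf
  refine ⟨c, fun e he y hy a => ?_⟩
  have hG := metricIn_isMetricOn g he
  have h := hc e he y hy (a 0) (a 1)
  have ha : a = ![a 0, a 1] := by ext s; fin_cases s <;> rfl
  have hu := contDiffOn_coord_expr hf he
  have hcomm := pderiv_comm ((hu.contDiffAt (hG.isOpen.mem_nhds hy)).of_le ENat.LEInfty.out)
    (a 1) (a 0)
  have h2 : covDeriv (metricIn g e) (differential fun z => f (e.symm z)) y ![a 0, a 1]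
      = hessian (metricIn g e) (fun z => f (e.symm z)) y (a 0) (a 1) := by
    rw [covDeriv_rank_one]
    unfold hessian
    congr 1
    exact Finset.sum_congr rfl fun k _ => by rw [christoffel_symm hG hy]; rfl
  rw [← h2] at h
  rw [ha]
  exact h

/-- `|C|²` can be computed in any chart around the point, not only in the preferred one. -/
theorem cottonNormSq_eq (g : Metric n M) (he : e ∈ IsManifold.maximalAtlas (𝓡 n) ∞ M) {p : M}
    (hp : p ∈ e.source) :
    cottonNormSq g p = tensorNormSq (metricIn g e) (cotton (metricIn g e)) (e p) := by
  have h := isPullback_transition g he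
    (IsManifold.chart_mem_maximalAtlas (I := 𝓡 n) (n := ∞) p)
  have hmem : e p ∈ (e.symm.trans (chartAt (EuclideanSpace ℝ (Fin n)) p)).source := by
    simp [hp]
  have := h.cottonNorm hmem
  rw [this, e.left_inv hp]
  rfl

/-- `C_{kti,it} f_k` can be computed in any chart around the point. -/
theorem divDivCottonGrad_eq (g : Metric n M) (hf : ContMDiff (𝓡 n) 𝓘(ℝ, ℝ) ∞ f)
    (he : e ∈ IsManifold.maximalAtlas (𝓡 n) ∞ M) {p : M} (hp : p ∈ e.source) :
    divDivCottonGrad g f p = cottonTerm (metricIn g e) (fun z => f (e.symm z)) (e p) := by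
  have hc := IsManifold.chart_mem_maximalAtlas (I := 𝓡 n) (n := ∞) p
  have h := isPullback_transition g he hc
  have hmem : e p ∈ (e.symm.trans (chartAt (EuclideanSpace ℝ (Fin n)) p)).source := by
    simp [hp]
  have := h.cottonTerm (u₁ := fun z => f (e.symm z))
    (u₂ := fun z => f ((chartAt (EuclideanSpace ℝ (Fin n)) p).symm z)) (fun x hx => ?_)
    (fun y hy => diffAt_of_smooth h.right.isOpen (contDiffOn_coord_expr hf hc) hy) hmem
  · rw [this, e.left_inv hp]
    rfl
  · have hx' : x ∈ e.target ∧ e.symm x ∈ (chartAt (EuclideanSpace ℝ (Fin n)) p).source := by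
      simpa using hx
    exact congrArg f ((chartAt (EuclideanSpace ℝ (Fin n)) p).left_inv hx'.2).symm

theorem continuous_cottonNormSq (g : Metric n M) : Continuous (cottonNormSq g) :=
  continuous_of_coord fun q =>
    have hq := IsManifold.chart_mem_maximalAtlas (I := 𝓡 n) (n := ∞) q
    ⟨_, (metricIn_isMetricOn g hq).smooth_cottonNorm.continuousOn,
      fun _ hp => cottonNormSq_eq g hq hp⟩

theorem continuous_divDivCottonGrad (g : Metric n M) (hf : ContMDiff (𝓡 n) 𝓘(ℝ, ℝ) ∞ f) :
    Continuous (divDivCottonGrad g f) :=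
  continuous_of_coord fun q =>
    have hq := IsManifold.chart_mem_maximalAtlas (I := 𝓡 n) (n := ∞) q
    ⟨_, ((metricIn_isMetricOn g hq).smooth_cottonTerm (contDiffOn_coord_expr hf hq)).continuousOn,
      fun _ hp => divDivCottonGrad_eq g hf hq hp⟩

theorem divDivDivWeylGrad_eq (g : Metric n M) (hn : 3 ≤ n) (p : M) :
    divDivDivWeylGrad g f p = -(((n : ℝ) - 3) / ((n : ℝ) - 2)) * divDivCottonGrad g f p :=
  weylTerm_eq (metricIn_isMetricOn g (IsManifold.chart_mem_maximalAtlas (n := ∞) p)) hn _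
    ((chartAt (EuclideanSpace ℝ (Fin n)) p).map_source (mem_chart_source _ p))

end

/-! ### The Riemannian volume measure -/

section

theorem det_fderiv_eq_jac {φ : Coord n → Coord n} {x : Coord n} (hφ : DifferentiableAt ℝ φ x) :
    (fderiv ℝ φ x).det = (jac φ x).det := by
  rw [ContinuousLinearMap.det,
    ← LinearMap.det_toMatrix (EuclideanSpace.basisFun (Fin n) ℝ).toBasis]
  congr 1
  ext a i
  simp [LinearMap.toMatrix_apply, jac_eq_fderiv hφ]

/-- The densities `√(det g_{ij})` in two coordinate systems differ by the Jacobian determinant. -/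
theorem IsPullback.sqrt_det {φ : Coord n → Coord n} {U V : Set (Coord n)}
    {G₁ G₂ : Coord n → Matrix (Fin n) (Fin n) ℝ} (h : IsPullback φ U V G₁ G₂) {x : Coord n}
    (hx : x ∈ U) : √(G₁ x).det = |(fderiv ℝ φ x).det| * √(G₂ (φ x)).det := by
  rw [det_fderiv_eq_jac ((h.smooth.contDiffAt (h.left.isOpen.mem_nhds hx)).differentiableAt
    (by simp)), h.eq x hx, Matrix.det_mul, Matrix.det_mul, Matrix.det_transpose,
    mul_right_comm, Real.sqrt_mul (mul_self_nonneg _), Real.sqrt_mul_self_eq_abs]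

variable {M : Type*} [TopologicalSpace M] [MeasurableSpace M] [BorelSpace M]
  {e e' : OpenPartialHomeomorph M (EuclideanSpace ℝ (Fin n))}

theorem aemeasurable_symm (e : OpenPartialHomeomorph M (EuclideanSpace ℝ (Fin n))) :
    AEMeasurable e.symm (volume.restrict e.target) :=
  e.continuousOn_symm.aemeasurable e.open_target.measurableSet

theorem measurableSet_preimage_symm (e : OpenPartialHomeomorph M (EuclideanSpace ℝ (Fin n)))
    {A : Set M} (hA : MeasurableSet A) : MeasurableSet (e.symm ⁻¹' A ∩ e.target) := by
  have h := (continuousOn_iff_continuous_domRestrict.1 e.continuousOn_symm).measurable hA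
  have h2 := e.open_target.measurableSet.subtype_image h
  convert h2 using 1
  ext y
  simp [Set.mem_image, and_comm]

variable [ChartedSpace (EuclideanSpace ℝ (Fin n)) M] [IsManifold (𝓡 n) ∞ M]

theorem chartVolume_apply (g : Metric n M) {A : Set M} (hA : MeasurableSet A) :
    chartVolume g e A
      = ∫⁻ y in e.symm ⁻¹' A ∩ e.target, ENNReal.ofReal √(metricIn g e y).det := by
  rw [chartVolume, Measure.map_apply_of_aemeasurable
    ((aemeasurable_symm e).mono_ac (withDensity_absolutelyContinuous _ _)) hA,
    withDensity_apply', Measure.restrict_restrict' e.open_target.measurableSet]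

/-- The change of variables formula: on the domain of a second chart, the measure of the first one
is at most that of the second. -/
theorem chartVolume_restrict_le (g : Metric n M) (he : e ∈ IsManifold.maximalAtlas (𝓡 n) ∞ M)
    (he' : e' ∈ IsManifold.maximalAtlas (𝓡 n) ∞ M) :
    (chartVolume g e).restrict e'.source ≤ chartVolume g e' := by
  refine Measure.le_iff.2 fun A hA => ?_
  have hA' := hA.inter e'.open_source.measurableSet
  rw [Measure.restrict_apply hA, chartVolume_apply g hA', chartVolume_apply g hA]
  have hP := isPullback_transition g he he'
  have hmem : ∀ y ∈ e.symm ⁻¹' (A ∩ e'.source) ∩ e.target,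
      y ∈ (e.symm.trans e').source := fun y hy => by
    simpa using ⟨hy.2, hy.1.2⟩
  set s := e.symm ⁻¹' (A ∩ e'.source) ∩ e.target with hs
  have hd : ∀ y ∈ s, HasFDerivWithinAt (fun z => e' (e.symm z))
      (fderiv ℝ (fun z => e' (e.symm z)) y) s y := fun y hy =>
    (((hP.smooth.contDiffAt (hP.left.isOpen.mem_nhds (hmem y hy))).differentiableAt
      (by simp)).hasFDerivAt).hasFDerivWithinAt
  have hinj : Set.InjOn (fun z => e' (e.symm z)) s := fun y hy z hz hyz =>
    e.symm.injOn hy.2 hz.2 (e'.injOn hy.1.2 hz.1.2 hyz)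
  calc ∫⁻ y in s, ENNReal.ofReal √(metricIn g e y).det
      = ∫⁻ y in s, ENNReal.ofReal |(fderiv ℝ (fun z => e' (e.symm z)) y).det|
          * ENNReal.ofReal √(metricIn g e' (e' (e.symm y))).det :=
        setLIntegral_congr_fun (measurableSet_preimage_symm e hA') fun y hy => by
          rw [← ENNReal.ofReal_mul (abs_nonneg _)]
          exact congrArg ENNReal.ofReal (hP.sqrt_det (hmem y hy))
    _ = ∫⁻ y in (fun z => e' (e.symm z)) '' s, ENNReal.ofReal √(metricIn g e' y).det :=
        (lintegral_image_eq_lintegral_abs_det_fderiv_mul volume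
          (measurableSet_preimage_symm e hA') hd hinj
          fun y => ENNReal.ofReal √(metricIn g e' y).det).symm
    _ ≤ _ := by
        refine lintegral_mono_set ?_
        rintro _ ⟨y, hy, rfl⟩
        refine ⟨?_, e'.map_source hy.1.2⟩
        simpa [e'.left_inv hy.1.2] using hy.1.1

theorem chartVolume_restrict_source (g : Metric n M) :
    (chartVolume g e).restrict e.source = chartVolume g e := by
  refine Measure.restrict_eq_self_of_ae_mem ?_
  have h0 : chartVolume g e e.sourceᶜ = 0 := by
    rw [chartVolume_apply g e.open_source.measurableSet.compl]
    have : e.symm ⁻¹' e.sourceᶜ ∩ e.target = ∅ := by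
      ext y
      simpa using fun h hy => h (e.map_target hy)
    rw [this, Measure.restrict_empty, lintegral_zero_measure]
  exact h0

/-- On the domain of a chart the Riemannian volume is the measure `√(det g_{ij}) dy`. -/
theorem riemannianVolume_restrict (g : Metric n M) (q : M) :
    (riemannianVolume g).restrict (chartAt (EuclideanSpace ℝ (Fin n)) q).source
      = chartVolume g (chartAt (EuclideanSpace ℝ (Fin n)) q) := by
  set e := chartAt (EuclideanSpace ℝ (Fin n)) q
  have hS : MeasurableSet e.source := e.open_source.measurableSet
  refine le_antisymm ?_ ?_
  · -- the chart measure, increased to `∞` off the domain of the chart, dominates all of them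
    have hle : riemannianVolume g ≤ chartVolume g e + (⊤ : Measure M).restrict e.sourceᶜ := by
      refine iSup_le fun p => ?_
      rw [← Measure.restrict_add_restrict_compl
        (μ := chartVolume g (chartAt (EuclideanSpace ℝ (Fin n)) p)) hS]
      exact add_le_add (chartVolume_restrict_le g (IsManifold.chart_mem_maximalAtlas p)
        (IsManifold.chart_mem_maximalAtlas q)) (Measure.restrict_mono le_rfl le_top)
    refine (Measure.restrict_mono le_rfl hle).trans ?_
    rw [Measure.restrict_add, Measure.restrict_restrict hS, Set.inter_compl_self,
      Measure.restrict_empty, add_zero]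
    exact Measure.restrict_le_self
  · conv_lhs => rw [← chartVolume_restrict_source g]
    exact Measure.restrict_mono le_rfl
      (le_iSup (fun p => chartVolume g (chartAt (EuclideanSpace ℝ (Fin n)) p)) q)

instance isLocallyFiniteMeasure_riemannianVolume (g : Metric n M) :
    IsLocallyFiniteMeasure (riemannianVolume g) where
  finiteAtNhds q := by
    have hT := riemannianVolume_restrict g q
    have he : chartAt (EuclideanSpace ℝ (Fin n)) q ∈ IsManifold.maximalAtlas (𝓡 n) ∞ M :=
      IsManifold.chart_mem_maximalAtlas q
    have hq := mem_chart_source (EuclideanSpace ℝ (Fin n)) q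
    set e := chartAt (EuclideanSpace ℝ (Fin n)) q
    obtain ⟨K, hK, hqK, hKt⟩ := exists_compact_subset e.open_target (e.map_source hq)
    have hopen := e.isOpen_inter_preimage isOpen_interior (s := interior K)
    refine ⟨e.source ∩ e ⁻¹' interior K, hopen.mem_nhds ⟨hq, hqK⟩, ?_⟩
    rw [← Measure.restrict_eq_self _ (Set.inter_subset_left (t := e ⁻¹' interior K)), hT,
      chartVolume_apply g hopen.measurableSet]
    have hc : ContinuousOn (fun y => √(metricIn g e y).det) K :=
      ((metricIn_isMetricOn g he).smooth_sqrt_det.continuousOn).mono hKt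
    refine lt_of_le_of_lt (lintegral_mono_set fun y hy => ?_)
      (hc.integrableOn_compact hK).setLIntegral_lt_top
    have : e (e.symm y) ∈ interior K := hy.1.2
    rw [e.right_inv hy.2] at this
    exact interior_subset this

/-- The integral of a function supported in the domain of a chart, in coordinates. -/
theorem integral_riemannianVolume_eq (g : Metric n M) (q : M) {h : M → ℝ} (hc : Continuous h)
    (hs : ∀ p ∉ (chartAt (EuclideanSpace ℝ (Fin n)) q).source, h p = 0) :
    ∫ p, h p ∂riemannianVolume g
      = ∫ y in (chartAt (EuclideanSpace ℝ (Fin n)) q).target,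
          √(metricIn g (chartAt (EuclideanSpace ℝ (Fin n)) q) y).det
            * h ((chartAt (EuclideanSpace ℝ (Fin n)) q).symm y) := by
  have he : chartAt (EuclideanSpace ℝ (Fin n)) q ∈ IsManifold.maximalAtlas (𝓡 n) ∞ M :=
    IsManifold.chart_mem_maximalAtlas q
  rw [← setIntegral_eq_integral_of_forall_compl_eq_zero hs, riemannianVolume_restrict]
  set e := chartAt (EuclideanSpace ℝ (Fin n)) q
  have hρ : AEMeasurable (fun y => ENNReal.ofReal √(metricIn g e y).det)
      (volume.restrict e.target) :=
    ((metricIn_isMetricOn g he).smooth_sqrt_det.continuousOn.aemeasurable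
      e.open_target.measurableSet).ennreal_ofReal
  rw [chartVolume, integral_map
    ((aemeasurable_symm e).mono_ac (withDensity_absolutelyContinuous _ _))
    hc.measurable.aestronglyMeasurable, integral_withDensity_eq_integral_toReal_smul₀ hρ
    (Filter.Eventually.of_forall fun _ => ENNReal.ofReal_lt_top)]
  simp only [ENNReal.toReal_ofReal (Real.sqrt_nonneg _), smul_eq_mul]

end

/-! ### Integration by parts on the manifold -/

section

variable {M : Type*} [TopologicalSpace M] [ChartedSpace (EuclideanSpace ℝ (Fin n)) M]
  [IsManifold (𝓡 n) ∞ M] {f : M → ℝ}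

theorem continuous_density (g : Metric n M) (hf : ContMDiff (𝓡 n) 𝓘(ℝ, ℝ) ∞ f) {ψ : ℝ → ℝ}
    (hψ : ContDiff ℝ 2 ψ) :
    Continuous fun p => (divDivCottonGrad g f p + 1 / 2 * cottonNormSq g p) * ψ (f p) :=
  ((continuous_divDivCottonGrad g hf).add (continuous_const.mul (continuous_cottonNormSq g))).mul
    (hψ.continuous.comp hf.continuous)

variable [MeasurableSpace M] [BorelSpace M]

/-- The integral vanishes for a weight `ρ ψ(f)` supported in the domain of one chart. -/
theorem integral_localized_eq_zero (hn : 3 ≤ n) {g : Metric n M}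
    (hf : IsGradientRicciSoliton g f) {ψ : ℝ → ℝ} (hψ : ContDiff ℝ 2 ψ)
    (hsupp : HasCompactSupport fun p : M => ψ (f p)) (q : M) {ρ : M → ℝ}
    (hρ : ContMDiff (𝓡 n) 𝓘(ℝ, ℝ) ∞ ρ)
    (hρs : tsupport ρ ⊆ (chartAt (EuclideanSpace ℝ (Fin n)) q).source) :
    ∫ p, ρ p * ((divDivCottonGrad g f p + 1 / 2 * cottonNormSq g p) * ψ (f p))
      ∂riemannianVolume g = 0 := by
  have he : chartAt (EuclideanSpace ℝ (Fin n)) q ∈ IsManifold.maximalAtlas (𝓡 n) ∞ M :=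
    IsManifold.chart_mem_maximalAtlas q
  obtain ⟨c, hc⟩ := hf.exists_isSolitonOn
  rw [integral_riemannianVolume_eq g q (hρ.continuous.fun_mul (continuous_density g hf.1 hψ))
    fun p hp => by rw [image_eq_zero_of_notMem_tsupport fun h => hp (hρs h), zero_mul]]
  set e := chartAt (EuclideanSpace ℝ (Fin n)) q
  have hle : (2 : WithTop ℕ∞) ≤ ∞ := ENat.LEInfty.out
  have hu := contDiffOn_coord_expr hf.1 he
  have hK : IsCompact (e '' (tsupport ρ ∩ tsupport fun p => ψ (f p))) :=
    (hsupp.isCompact.inter_left (isClosed_tsupport ρ)).image_of_continuousOn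
      (e.continuousOn.mono (Set.inter_subset_left.trans hρs))
  have h := integral_chart_eq_zero (w := fun y => ρ (e.symm y) * ψ (f (e.symm y)))
    (metricIn_isMetricOn g he) hn hu
    (((contDiffOn_coord_expr hρ he).of_le hle).mul (hψ.comp_contDiffOn (hu.of_le hle)))
    (hc e he) hK (by
      rintro _ ⟨p, hp, rfl⟩
      exact e.map_source (hρs hp.1)) (by
      rintro y ⟨hy, hyK⟩
      by_contra hne
      refine hyK ⟨e.symm y, ⟨subset_tsupport _ (left_ne_zero_of_mul hne),
        subset_tsupport _ (right_ne_zero_of_mul hne)⟩, e.right_inv hy⟩)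
  rw [← h]
  refine setIntegral_congr_fun e.open_target.measurableSet fun y hy => ?_
  rw [divDivCottonGrad_eq g hf.1 he (e.map_target hy), cottonNormSq_eq g he (e.map_target hy),
    e.right_inv hy]
  ring

/-- The function `(C_{kti,it} f_k + ½ |C|²) ψ(f)` has integral zero, since it is the divergence of
a compactly supported vector field. -/
theorem integral_divDivCottonGrad_add_eq_zero [T2Space M] [SecondCountableTopology M]
    (hn : 3 ≤ n) {g : Metric n M} (hf : IsGradientRicciSoliton g f) {ψ : ℝ → ℝ}
    (hψ : ContDiff ℝ 2 ψ) (hsupp : HasCompactSupport fun p : M => ψ (f p)) :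
    ∫ p, (divDivCottonGrad g f p + 1 / 2 * cottonNormSq g p) * ψ (f p)
      ∂riemannianVolume g = 0 := by
  have : LocallyCompactSpace M := ChartedSpace.locallyCompactSpace (EuclideanSpace ℝ (Fin n)) M
  obtain ⟨ρ, hρ⟩ := SmoothPartitionOfUnity.exists_isSubordinate_chartAt_source (𝓡 n) M
  have hfin := ρ.locallyFinite.finite_nonempty_inter_compact hsupp.isCompact
  have hsum : ∀ p, (divDivCottonGrad g f p + 1 / 2 * cottonNormSq g p) * ψ (f p)
      = ∑ i ∈ hfin.toFinset,
        ρ i p * ((divDivCottonGrad g f p + 1 / 2 * cottonNormSq g p) * ψ (f p)) := by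
    intro p
    by_cases hp : ψ (f p) = 0
    · simp [hp]
    · have h1 : ∑ i ∈ hfin.toFinset, ρ i p = 1 := by
        rw [← ρ.sum_eq_one (Set.mem_univ p)]
        refine (finsum_eq_sum_of_support_subset _ fun i hi => ?_).symm
        simp only [Set.Finite.coe_toFinset, Set.mem_ofPred_eq]
        exact ⟨p, hi, subset_tsupport _ hp⟩
      rw [← Finset.sum_mul, h1, one_mul]
  rw [integral_congr_ae (Filter.Eventually.of_forall hsum), integral_finsetSum _ fun i _ => ?_]
  · exact Finset.sum_eq_zero fun i _ =>
      integral_localized_eq_zero hn hf hψ hsupp i (ρ i).contMDiff (hρ i)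
  · exact ((ρ i).contMDiff.continuous.mul
      (continuous_density g hf.1 hψ)).integrable_of_hasCompactSupport
      (hsupp.mul_left.mul_left)

end

end RicciSoliton

end

theorem theorem4p1 {n : ℕ} (hn : 3 ≤ n)
    {M : Type*} [TopologicalSpace M] [T2Space M] [SecondCountableTopology M]
    [ChartedSpace (EuclideanSpace ℝ (Fin n)) M] [IsManifold (𝓡 n) ∞ M]
    [MeasurableSpace M] [BorelSpace M]
    (g : RicciSoliton.Metric n M) (f : M → ℝ) (hf : RicciSoliton.IsGradientRicciSoliton g f)
    (ψ : ℝ → ℝ) (hψ : ContDiff ℝ 2 ψ) (hsupp : HasCompactSupport fun p : M => ψ (f p)) :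
    (Integrable (fun p => RicciSoliton.cottonNormSq g p * ψ (f p))
        (RicciSoliton.riemannianVolume g) ∧
      Integrable (fun p => RicciSoliton.divDivCottonGrad g f p * ψ (f p))
        (RicciSoliton.riemannianVolume g) ∧
      (1 / 2) * ∫ p, RicciSoliton.cottonNormSq g p * ψ (f p) ∂(RicciSoliton.riemannianVolume g)
        = - ∫ p, RicciSoliton.divDivCottonGrad g f p * ψ (f p)
            ∂(RicciSoliton.riemannianVolume g)) ∧
    (4 ≤ n →
      Integrable (fun p => RicciSoliton.divDivDivWeylGrad g f p * ψ (f p))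
        (RicciSoliton.riemannianVolume g) ∧
      (1 / 2) * ∫ p, RicciSoliton.cottonNormSq g p * ψ (f p) ∂(RicciSoliton.riemannianVolume g)
        = ((n : ℝ) - 2) / ((n : ℝ) - 3)
          * ∫ p, RicciSoliton.divDivDivWeylGrad g f p * ψ (f p)
              ∂(RicciSoliton.riemannianVolume g)) := by
  have hψf : Continuous fun p => ψ (f p) := hψ.continuous.comp hf.1.continuous
  have hN : Integrable (fun p => RicciSoliton.cottonNormSq g p * ψ (f p))
      (RicciSoliton.riemannianVolume g) :=
    ((RicciSoliton.continuous_cottonNormSq g).mul hψf).integrable_of_hasCompactSupport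
      hsupp.mul_left
  have hD : Integrable (fun p => RicciSoliton.divDivCottonGrad g f p * ψ (f p))
      (RicciSoliton.riemannianVolume g) :=
    ((RicciSoliton.continuous_divDivCottonGrad g hf.1).mul hψf).integrable_of_hasCompactSupport
      hsupp.mul_left
  have h0 := RicciSoliton.integral_divDivCottonGrad_add_eq_zero hn hf hψ hsupp
  have h1 : ∫ p, RicciSoliton.divDivCottonGrad g f p * ψ (f p) ∂(RicciSoliton.riemannianVolume g)
      + 1 / 2 * ∫ p, RicciSoliton.cottonNormSq g p * ψ (f p) ∂(RicciSoliton.riemannianVolume g)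
      = 0 := by
    rw [← integral_const_mul, ← integral_add hD (hN.const_mul _), ← h0]
    exact integral_congr_ae (Filter.Eventually.of_forall fun p => by ring)
  refine ⟨⟨hN, hD, by linarith⟩, fun hn4 => ?_⟩
  have hW : (fun p => RicciSoliton.divDivDivWeylGrad g f p * ψ (f p)) = fun p =>
      -(((n : ℝ) - 3) / ((n : ℝ) - 2)) * (RicciSoliton.divDivCottonGrad g f p * ψ (f p)) := by
    funext p
    rw [RicciSoliton.divDivDivWeylGrad_eq g hn, mul_assoc]
  have hn' : (4 : ℝ) ≤ n := by exact_mod_cast hn4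
  have h2 : (n : ℝ) - 2 ≠ 0 := by linarith
  have h3 : (n : ℝ) - 3 ≠ 0 := by linarith
  rw [hW, integral_const_mul]
  refine ⟨hD.const_mul _, ?_⟩
  field_simp
  linarith
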